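/- **Setting.** Let $0<b\le\infty$ and let $q$ be a real-valued potential on $(0,b)$, with a condition at $b$, of one of the following kinds. (1) $b<\infty$, $q\in L^1((0,b))$, with the boundary condition $u'(b_-)+hu(b_-)=0$ where $h\in\mathbb R\cup\{\infty\}$ ($h=\infty$ means $u(b_-)=0$). Or $b=\infty$, $q\in L^1((0,c))$ for all $c<\infty$, and: (2) $\sup_{c>0}\int_c^{c+1}\max(-q(x),0)\,dx<\infty$; or (3) $-\frac{d^2}{dx^2}+q$ is in the limit point case at $\infty$, and in both (2) and (3) the condition at $b$ is square integrability near $\infty$; or (4) it is in the limit circle case at $\infty$, with a self-adjoint boundary condition $\lim_{x\to\infty}[u_0(x)u'(x)-u_0'(x)u(x)]=0$ given by a nonzero solution $u_0$ of $-u_0''+qu_0=iu_0$ (self-adjoint means $\lim_{x\to\infty}[u_0\overline{u_0'}-u_0'\overline{u_0}](x)=0$). For $\operatorname{Im}z>0$ let $u(\cdot,z)$ be a nonzero solution of $-u''+qu=zu$ satisfying the condition at $b$, and let $m(z)=u'(0_+,z)/u(0_+,z)$. The $A$-amplitude of $q$ is the function $A$ on $[0,b)$ such that $A\in L^1((0,c))$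 for all $c<b$, $A-q$ is continuous on $[0,b)$, and for all $0<c<b$ and $\varepsilon>0$ $$m(-\kappa^2)=-\kappa-\int_0^c A(\alpha)e^{-2\alpha\kappa}\,d\alpha+\tilde O(e^{-2c\kappa})$$ as $|\kappa|\to\infty$ with $-\frac{\pi}{2}+\varepsilon<\arg\kappa<-\varepsilon$. Here $f=\tilde O(g)$ means that $g\to0$ and $(f/g)|g|^{\delta}\to0$ for all $\delta>0$. **Theorem 10.2.** Let $q_1,q_2$ be such potentials on $(0,b_1)$, $(0,b_2)$, with conditions at $b_1,b_2$ and $A$-amplitudes $A_1,A_2$, and let $0\le a<\infty$, $a\le\min(b_1,b_2)$. If $|q_1(x)|\le -q_2(x)$ for all $x\in[0,a]$ with $x<\min(b_1,b_2)$, then $|A_1(\alpha)|\le -A_2(\alpha)$ for all $\alpha\in[0,a]$ with $\alpha<\min(b_1,b_2)$; and if $|q_1|\le -q_2$ almost everywhere on $[0,a]$, then $|A_1|\le -A_2$ almost everywhere on $[0,a]$. In particular, let $q$ be such a potential on $(0,b)$ with $A$-amplitude $A$. For every $\alpha$ with $0<\alpha<b$ and $\sup_{0\le x\le\alpha}|q(x)|<\infty$,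 $$|A(\alpha)|\le\frac{\gamma(\alpha)}{\alpha}I_1(2\alpha\gamma(\alpha))\le\alpha^{-1}\gamma(\alpha)e^{2\alpha\gamma(\alpha)},\qquad \gamma(\alpha)=\sup_{0\le x\le\alpha}|q(x)|^{1/2},$$ where $I_1(x)=\sum_{n\ge0}\frac{(x/2)^{2n+1}}{n!\,(n+1)!}$ is the modified Bessel function of order one. If $q$ is bounded, then $$|A(\alpha)|\le\alpha^{-1}\|q\|_\infty^{1/2}\exp\bigl(2\alpha\|q\|_\infty^{1/2}\bigr),$$ for all $0<\alpha<b$ if $\|q\|_\infty$ denotes $\sup_{[0,b)}|q|$, and for almost every $\alpha\in(0,b)$ if $q\in L^\infty((0,b))$ and $\|q\|_\infty$ is the essential supremum. -/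

import Mathlib

open MeasureTheory Filter Topology Set
open scoped ComplexConjugate

noncomputable section

namespace Schrodinger

/-- The right endpoint of the half-open interval `[0, b)`, `0 < b ≤ ∞`, together with the boundary
condition imposed there. -/
inductive RightEnd where
  /-- `b < ∞` with the boundary condition `u'(b-) + h u(b-) = 0`, `h` real -/
  | robin (b h : ℝ)
  /-- `b < ∞` with the boundary condition `u(b-) = 0` (that is, `h = ∞`) -/
  | dirichlet (b : ℝ)
  /-- `b = ∞`; solutions are required to be square integrable at infinity -/
  | squareIntegrable
  /-- `b = ∞`, limit circle case, with the boundary condition given by the solution `u₀` for `z = i`;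
  the second entry is the derivative of `u₀` -/
  | limitCircle (u₀ du₀ : ℝ → ℂ)

/-- The endpoint `b ∈ (0, ∞]`. -/
def RightEnd.b : RightEnd → EReal
  | .robin b _ => (b : EReal)
  | .dirichlet b => (b : EReal)
  | .squareIntegrable => ⊤
  | .limitCircle _ _ => ⊤

/-- The interval `[0, b)`. -/
def RightEnd.dom (B : RightEnd) : Set ℝ := {x | 0 ≤ x ∧ (x : EReal) < B.b}

/-- `u` solves `-u'' + q u = z u` on the interval `D` (of the form `[0, b)`) in the sense of
Carathéodory, with derivative `du`: both `u` and `du` are locally absolutely continuous, `u' = du`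
and `du' = (q - z) u` almost everywhere, written in integrated form. -/
structure IsSolution (D : Set ℝ) (q : ℝ → ℝ) (z : ℂ) (u du : ℝ → ℂ) : Prop where
  cont : ContinuousOn u D
  dcont : ContinuousOn du D
  eq_u : ∀ x ∈ D, u x = u 0 + ∫ t in (0 : ℝ)..x, du t
  eq_du : ∀ x ∈ D, du x = du 0 + ∫ t in (0 : ℝ)..x, ((q t : ℂ) - z) * u t

/-- A solution that does not vanish identically. -/
def IsNonzeroSolution (D : Set ℝ) (q : ℝ → ℝ) (z : ℂ) (u du : ℝ → ℂ) : Prop :=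
  IsSolution D q z u du ∧ ∃ x ∈ D, u x ≠ 0

/-- `u` is square integrable at infinity. -/
def L2AtInfinity (u : ℝ → ℂ) : Prop :=
  ∃ R : ℝ, 0 ≤ R ∧ IntegrableOn (fun x => ‖u x‖ ^ 2) (Ioi R)

/-- `q` is essentially bounded from below:
`sup_{a > 0} ∫_a^{a+1} max (-q(x)) 0 dx < ∞`. -/
def EssBoundedBelow (q : ℝ → ℝ) : Prop :=
  ∃ C : ℝ, ∀ a : ℝ, 0 < a → ∫ x in a..(a + 1), max (-q x) 0 ≤ C

/-- Limit point case at infinity: for each `z` with `Im z > 0` there is, up to a multiplicative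
constant, exactly one nonzero solution on `[0, ∞)` that is square integrable at infinity. -/
def LimitPoint (q : ℝ → ℝ) : Prop :=
  ∀ z : ℂ, 0 < z.im →
    (∃ u du, IsNonzeroSolution (Ici 0) q z u du ∧ L2AtInfinity u) ∧
    ∀ u du v dv, IsNonzeroSolution (Ici 0) q z u du → L2AtInfinity u →
      IsNonzeroSolution (Ici 0) q z v dv → L2AtInfinity v →
      ∃ c : ℂ, ∀ x ∈ Ici (0 : ℝ), v x = c * u x

/-- Limit circle case at infinity: for each `z` with `Im z > 0` all solutions on `[0, ∞)` are square
integrable at infinity. -/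
def LimitCircle (q : ℝ → ℝ) : Prop :=
  ∀ z : ℂ, 0 < z.im → ∀ u du, IsSolution (Ici 0) q z u du → L2AtInfinity u

/-- The standing assumptions on a real potential `q` on `(0, b)` with a condition at `b`:
* if `b < ∞`, then `q ∈ L¹((0, b))`;
* if `b = ∞`, then `q ∈ L¹((0, a))` for all `a < ∞`, and either `q` is essentially bounded from
  below or in the limit point case (then no boundary condition is needed), or `q` is in the limit
  circle case, and `u₀` is a nonzero solution for `z = i` for which the boundary condition
  `u₀ u' - u₀' u → 0` is self-adjoint, that is, `u₀` has a vanishing Wronskian with its complex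
  conjugate at infinity. -/
def RightEnd.Admissible : RightEnd → (ℝ → ℝ) → Prop
  | .robin b _, q => 0 < b ∧ IntegrableOn q (Ioo 0 b)
  | .dirichlet b, q => 0 < b ∧ IntegrableOn q (Ioo 0 b)
  | .squareIntegrable, q =>
      (∀ a : ℝ, 0 < a → IntegrableOn q (Ioo 0 a)) ∧ (EssBoundedBelow q ∨ LimitPoint q)
  | .limitCircle u₀ du₀, q =>
      (∀ a : ℝ, 0 < a → IntegrableOn q (Ioo 0 a)) ∧ LimitCircle q ∧
      IsNonzeroSolution (Ici 0) q Complex.I u₀ du₀ ∧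
      Tendsto (fun x => u₀ x * conj (du₀ x) - du₀ x * conj (u₀ x)) atTop (𝓝 0)

/-- `u`, with derivative `du`, satisfies the condition at the right endpoint. -/
def RightEnd.Satisfies : RightEnd → (ℝ → ℂ) → (ℝ → ℂ) → Prop
  | .robin b h, u, du => Tendsto (fun x => du x + (h : ℂ) * u x) (𝓝[<] b) (𝓝 0)
  | .dirichlet b, u, _ => Tendsto u (𝓝[<] b) (𝓝 0)
  | .squareIntegrable, u, _ => L2AtInfinity u
  | .limitCircle u₀ du₀, u, du =>
      Tendsto (fun x => u₀ x * du x - du₀ x * u x) atTop (𝓝 0)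

open Classical in
/-- The Weyl–Titchmarsh function `m(z) = u'(0, z) / u(0, z)`, `Im z > 0`, where `u(·, z)` is a nonzero
solution of `-u'' + q u = z u` that satisfies the condition at the right endpoint. (The quotient
does not depend on the choice of that solution.) -/
def weylM (q : ℝ → ℝ) (B : RightEnd) (z : ℂ) : ℂ :=
  if h : ∃ m : ℂ, ∃ u du : ℝ → ℂ,
      IsNonzeroSolution B.dom q z u du ∧ B.Satisfies u du ∧ m = du 0 / u 0
  then h.choose else 0

/-- `f = Õ(g)` along the filter `l`: `g → 0` and `(f / g) |g| ^ δ → 0` for all `δ > 0`. -/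
def TildeO (l : Filter ℂ) (f g : ℂ → ℂ) : Prop :=
  Tendsto g l (𝓝 0) ∧
    ∀ δ : ℝ, 0 < δ → Tendsto (fun κ => f κ / g κ * ((‖g κ‖ ^ δ : ℝ) : ℂ)) l (𝓝 0)

/-- `|κ| → ∞` with `-π/2 + ε < arg κ < -ε`. -/
def sectorInfinity (ε : ℝ) : Filter ℂ :=
  comap (fun κ : ℂ => ‖κ‖) atTop ⊓
    𝓟 {κ : ℂ | -(Real.pi / 2) + ε < κ.arg ∧ κ.arg < -ε}

/-- `A` is the `A`-amplitude of the potential `q` with the condition `B` at the right endpoint: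
`A ∈ L¹((0, a))` for all `a < b`, and for all `0 < a < b`
`m(-κ²) = -κ - ∫_0^a A(α) e^{-2ακ} dα + Õ(e^{-2aκ})` as `|κ| → ∞` with
`-π/2 + ε < arg κ < -ε`, for every `ε > 0`. This determines `A` almost everywhere; the values are
normalized by the requirement that `A - q` is continuous on `[0, b)`. -/
structure IsAmplitude (q : ℝ → ℝ) (B : RightEnd) (A : ℝ → ℝ) : Prop where
  integrable : ∀ a : ℝ, 0 < a → (a : EReal) < B.b → IntegrableOn A (Ioo 0 a)
  continuous_sub : ContinuousOn (fun α => A α - q α) B.dom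
  asymptotics : ∀ a : ℝ, 0 < a → (a : EReal) < B.b → ∀ ε : ℝ, 0 < ε →
    TildeO (sectorInfinity ε)
      (fun κ => weylM q B (-κ ^ 2) -
        (-κ - ∫ α in (0 : ℝ)..a, (A α : ℂ) * Complex.exp (-2 * (α : ℂ) * κ)))
      (fun κ => Complex.exp (-2 * (a : ℂ) * κ))

/-- The modified Bessel function `I₁`. -/
def besselI1 (x : ℝ) : ℝ :=
  ∑' n : ℕ, (x / 2) ^ (2 * n + 1) / ((n.factorial : ℝ) * ((n + 1).factorial : ℝ))

/-- `γ(α) = sup_{0 ≤ x ≤ α} |q(x)|^{1/2}` -/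
def gammaSup (q : ℝ → ℝ) (α : ℝ) : ℝ :=
  sSup ((fun x => Real.sqrt |q x|) '' Icc 0 α)

end Schrodinger

end

/-! Write z = -κ². For a solution u, the quotient m = u'/u satisfies the Riccati equation m' = q +
κ² - m², and m = -κ + w turns this into w' = 2κw - (-q + w²). Seeking w(x) = ∫ a(x, α) e^{-2ακ} dα
leads to the quadratic equation a(x, α) = -q(x + α) + ∫_x (a(t, ·) * a(t, ·))(α + x - t) dt, and A =
-a(0, ·). Every sign on the right is positive, so nonnegative data -q have a nonnegative solution,
the limit of a monotone iteration from 0 in [0, ∞] (`kernel`, `kernel_eq`).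

Comparison is then a matter of parity. For |g₁| ≤ g₂ with g₁ = -q₁ and g₂ = -q₂, write g₂ = f₀ + f₁
and g₁ = f₀ - f₁ with f₀, f₁ ≥ 0, and solve a system graded by ℤ/2, in which a₀ collects the
products with an even number of factors f₁ and a₁ those with an odd number. Then a₀ + a₁ belongs to
g₂ and a₀ - a₁ to g₁, so that |A₁| = |a₀ - a₁| ≤ a₀ + a₁ = -A₂. For |q| ≤ γ² the constant g₂ = γ² is
admissible; its kernel is dominated by a power series with Catalan coefficients, which sums to the
Bessel function.

The analytic work is the identification A = -(a₀ ± a₁) almost everywhere on (0, c),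
`IsAmplitude.ae_eq_kernel`. The data are cut off at c. In a norm with a large exponential weight the
kernel is finite, and its Laplace transform w solves the Riccati equation on (0, c) with w(c) = 0
(`KernelData.exists_riccati`). On the ray κ = r(1 - i) one has z = 2ir², and the solution u that
defines m has Im(ū u') ≥ 0 at c, whatever the condition at b (`flux_nonneg`). This alone forces
u'(0)/u(0) and -κ + w(0) to differ by O(|κ| e^{-2rc}) (`norm_sub_le_of_riccati`). With the
asymptotics that define A, the Laplace transform of A + a₀ ± a₁ over (0, c) is O(e^{-2(c-δ)r}) on
the ray for small δ > 0, and Phragmén–Lindelöf together with Liouville shows that the function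
vanishes (`ae_eq_zero_of_laplace_small`).

Statements at every point come from the continuity of A - q, which is almost everywhere minus the
signed sum of the nonlinear parts of the kernels. Inequalities are proved for A - q, extended to all
α > 0 by continuity, and only then are the values of q added. At α = 0 one needs A(0) = q(0)
(`IsAmplitude.apply_zero`). -/

noncomputable section

namespace Schrodinger

/-! ### Calculus of absolutely continuous complex functions -/

section

/-- `f` is a primitive of the integrable function `f'` on `[a, b]`. -/
structure HasPrim (f f' : ℝ → ℂ) (a b : ℝ) : Prop where
  le : a ≤ b
  integrable : IntervalIntegrable f' volume a b
  eq : ∀ x ∈ Icc a b, f x = f a + ∫ t in a..x, f' t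

theorem absolutelyContinuousOnInterval_const (c : ℂ) (a b : ℝ) :
    AbsolutelyContinuousOnInterval (fun _ : ℝ => c) a b :=
  (LipschitzWith.const c).lipschitzOnWith.absolutelyContinuousOnInterval (K := 0)

/-- Real and imaginary parts reduce this to real integrands; they are reassembled as multiples of
the constant functions 1 and i. -/
theorem absolutelyContinuousOnInterval_integral {f : ℝ → ℂ} {a b : ℝ}
    (h : IntervalIntegrable f volume a b) :
    AbsolutelyContinuousOnInterval (fun x => ∫ t in a..x, f t) a b := by
  have h1 : IntervalIntegrable (fun t => (f t).re) volume a b := ⟨h.1.re, h.2.re⟩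
  have h2 : IntervalIntegrable (fun t => (f t).im) volume a b := ⟨h.1.im, h.2.im⟩
  have e1 := (h1.absolutelyContinuousOnInterval_intervalIntegral (c := a) (by simp)).smul
    (absolutelyContinuousOnInterval_const 1 a b)
  have e2 := (h2.absolutelyContinuousOnInterval_intervalIntegral (c := a) (by simp)).smul
    (absolutelyContinuousOnInterval_const Complex.I a b)
  rw [absolutelyContinuousOnInterval_iff]
  have e3 := e1.add e2
  rw [absolutelyContinuousOnInterval_iff] at e3
  intro ε hε
  obtain ⟨δ, hδ, H⟩ := e3 ε hε
  refine ⟨δ, hδ, fun E hE hE' => ?_⟩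
  have key : ∀ x ∈ uIcc a b, (∫ t in a..x, f t) =
      ((fun x => ∫ t in a..x, (f t).re) • (fun _ : ℝ => (1 : ℂ)) +
        (fun x => ∫ t in a..x, (f t).im) • (fun _ : ℝ => Complex.I)) x := by
    intro x hx
    have hx' : IntervalIntegrable f volume a x := h.mono_set (uIcc_subset_uIcc_left hx)
    have hr : (∫ t in a..x, (f t).re) = (∫ t in a..x, f t).re := by
      simpa using (Complex.reCLM.intervalIntegral_comp_comm hx')
    have hi : (∫ t in a..x, (f t).im) = (∫ t in a..x, f t).im := by
      simpa using (Complex.imCLM.intervalIntegral_comp_comm hx')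
    simp only [Pi.add_apply, Pi.smul_apply', hr, hi]
    simp [Complex.re_add_im]
  have := H E hE hE'
  refine lt_of_eq_of_lt (Finset.sum_congr rfl fun i hi => ?_) this
  have hm := hE.1 i hi
  rw [key _ hm.1, key _ hm.2]

namespace HasPrim

variable {f f' g g' : ℝ → ℂ} {a b : ℝ}

theorem absolutelyContinuous (h : HasPrim f f' a b) : AbsolutelyContinuousOnInterval f a b := by
  have h1 := (absolutelyContinuousOnInterval_const (f a) a b).add
    (absolutelyContinuousOnInterval_integral h.integrable)
  rw [absolutelyContinuousOnInterval_iff] at h1 ⊢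
  intro ε hε
  obtain ⟨δ, hδ, H⟩ := h1 ε hε
  refine ⟨δ, hδ, fun E hE hE' => lt_of_eq_of_lt (Finset.sum_congr rfl fun i hi => ?_) (H E hE hE')⟩
  have hm := hE.1 i hi
  rw [uIcc_of_le h.le] at hm
  rw [h.eq _ hm.1, h.eq _ hm.2]; rfl

theorem continuousOn (h : HasPrim f f' a b) : ContinuousOn f (Icc a b) := by
  have := h.absolutelyContinuous.continuousOn
  rwa [uIcc_of_le h.le] at this

theorem ae_hasDerivAt (h : HasPrim f f' a b) :
    ∀ᵐ x, x ∈ uIcc a b → HasDerivAt f (f' x) x := by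
  have h₁ : ∀ᵐ x : ℝ, x ≠ a := by simp [ae_iff, measure_singleton]
  have h₂ : ∀ᵐ x : ℝ, x ≠ b := by simp [ae_iff, measure_singleton]
  filter_upwards [h.integrable.ae_hasDerivAt_integral, h₁, h₂] with x hx ha hb hm
  have := (hx hm a (by simp)).const_add (f a)
  rw [uIcc_of_le h.le] at hm
  refine this.congr_of_eventuallyEq ?_
  filter_upwards [Ioo_mem_nhds (lt_of_le_of_ne hm.1 ha.symm) (lt_of_le_of_ne hm.2 hb)] with y hy
  exact h.eq y (Ioo_subset_Icc_self hy)

/-- The difference of f and the integral of f' is absolutely continuous with derivative zero almost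
everywhere, hence constant. Through this converse, product and sum rules follow from the pointwise
ones. -/
theorem of_ae (hab : a ≤ b) (hac : AbsolutelyContinuousOnInterval f a b)
    (hd : ∀ᵐ x, x ∈ uIcc a b → HasDerivAt f (f' x) x) (hi : IntervalIntegrable f' volume a b) :
    HasPrim f f' a b := by
  refine ⟨hab, hi, fun x hx => ?_⟩
  have h0 := hac.sub (absolutelyContinuousOnInterval_integral hi)
  obtain ⟨C, hC⟩ := h0.const_of_ae_hasDerivAt_zero (by
    filter_upwards [hd, hi.ae_hasDerivAt_integral] with y hy hy' hm
    simpa using (hy hm).sub (hy' hm a (by simp)))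
  rw [← uIcc_of_le hab] at hx
  have h1 := hC a (by simp)
  have h2 := hC x hx
  simp only [Pi.sub_apply, intervalIntegral.integral_same, sub_zero] at h1 h2
  rw [h1, ← h2]; ring

theorem mul (hf : HasPrim f f' a b) (hg : HasPrim g g' a b) :
    HasPrim (fun x => f x * g x) (fun x => f' x * g x + f x * g' x) a b := by
  refine of_ae hf.le ?_ ?_ ?_
  · exact hf.absolutelyContinuous.smul hg.absolutelyContinuous
  · filter_upwards [hf.ae_hasDerivAt, hg.ae_hasDerivAt] with x h1 h2 hx
    exact (h1 hx).mul (h2 hx)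
  · exact (hf.integrable.mul_continuousOn hg.absolutelyContinuous.continuousOn).add
      (hg.integrable.continuousOn_mul hf.absolutelyContinuous.continuousOn)

theorem add (hf : HasPrim f f' a b) (hg : HasPrim g g' a b) :
    HasPrim (fun x => f x + g x) (fun x => f' x + g' x) a b := by
  refine of_ae hf.le (hf.absolutelyContinuous.add hg.absolutelyContinuous) ?_
    (hf.integrable.add hg.integrable)
  filter_upwards [hf.ae_hasDerivAt, hg.ae_hasDerivAt] with x h1 h2 hx
  exact (h1 hx).add (h2 hx)

theorem sub (hf : HasPrim f f' a b) (hg : HasPrim g g' a b) :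
    HasPrim (fun x => f x - g x) (fun x => f' x - g' x) a b := by
  refine of_ae hf.le (hf.absolutelyContinuous.sub hg.absolutelyContinuous) ?_
    (hf.integrable.sub hg.integrable)
  filter_upwards [hf.ae_hasDerivAt, hg.ae_hasDerivAt] with x h1 h2 hx
  exact (h1 hx).sub (h2 hx)

theorem const (c : ℂ) (hab : a ≤ b) : HasPrim (fun _ => c) (fun _ => 0) a b :=
  ⟨hab, by simp, fun x _ => by simp⟩

theorem const_mul (c : ℂ) (hf : HasPrim f f' a b) :
    HasPrim (fun x => c * f x) (fun x => c * f' x) a b :=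
  ⟨hf.le, hf.integrable.const_mul c, fun x hx => by
    simp only [intervalIntegral.integral_const_mul]; rw [hf.eq x hx]; ring⟩

theorem starRing (hf : HasPrim f f' a b) :
    HasPrim (fun x => starRingEnd ℂ (f x)) (fun x => starRingEnd ℂ (f' x)) a b := by
  refine ⟨hf.le, ?_, fun x hx => ?_⟩
  · exact ⟨Complex.conjCLE.toContinuousLinearMap.integrable_comp hf.integrable.1,
      Complex.conjCLE.toContinuousLinearMap.integrable_comp hf.integrable.2⟩
  · simp only [intervalIntegral.intervalIntegral_conj]
    rw [hf.eq x hx, map_add]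

theorem congr_left (hf : HasPrim f f' a b) (h : ∀ x ∈ Icc a b, f x = g x) : HasPrim g f' a b :=
  ⟨hf.le, hf.integrable, fun x hx => by
    rw [← h x hx, ← h a (left_mem_Icc.2 hf.le)]; exact hf.eq x hx⟩

theorem congr_right (hf : HasPrim f f' a b)
    (h : ∀ᵐ x ∂volume.restrict (Ioc a b), f' x = g' x) : HasPrim f g' a b := by
  refine ⟨hf.le, ?_, fun x hx => ?_⟩
  · refine hf.integrable.congr_ae ?_
    rwa [uIoc_of_le hf.le]
  · rw [hf.eq x hx]
    congr 1
    refine intervalIntegral.integral_congr_ae ?_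
    rw [uIoc_of_le hx.1]
    rw [ae_restrict_iff' measurableSet_Ioc] at h
    filter_upwards [h] with y hy hm using hy ⟨hm.1, hm.2.trans hx.2⟩

theorem mono (hf : HasPrim f f' a b) {c d : ℝ} (hac : a ≤ c) (hcd : c ≤ d) (hdb : d ≤ b) :
    HasPrim f f' c d := by
  have hi : ∀ y ∈ Icc a b, IntervalIntegrable f' volume a y := fun y hy =>
    hf.integrable.mono_set (uIcc_subset_uIcc_left (by rw [uIcc_of_le hf.le]; exact hy))
  have hc : c ∈ Icc a b := ⟨hac, hcd.trans hdb⟩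
  refine ⟨hcd, (hi c hc).symm.trans (hi d ⟨hac.trans hcd, hdb⟩), fun x hx => ?_⟩
  have hx' : x ∈ Icc a b := ⟨hac.trans hx.1, hx.2.trans hdb⟩
  rw [hf.eq x hx', hf.eq c hc, ← intervalIntegral.integral_add_adjacent_intervals (hi c hc)
    ((hi c hc).symm.trans (hi x hx'))]
  ring

/-- The fundamental theorem of calculus between the endpoints. -/
theorem integral_eq (hf : HasPrim f f' a b) : ∫ t in a..b, f' t = f b - f a := by
  rw [hf.eq b (right_mem_Icc.2 hf.le)]; ring

theorem of_integral (hab : a ≤ b) (hi : IntervalIntegrable f' volume a b) :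
    HasPrim (fun x => ∫ t in a..x, f' t) f' a b :=
  ⟨hab, hi, fun x _ => by simp⟩

theorem of_hasDerivAt (hab : a ≤ b) (h : ∀ x ∈ Icc a b, HasDerivAt f (f' x) x)
    (hc : ContinuousOn f' (Icc a b)) : HasPrim f f' a b := by
  refine ⟨hab, (hc.mono (by rw [uIcc_of_le hab])).intervalIntegrable, fun x hx => ?_⟩
  have hs : uIcc a x ⊆ Icc a b := by
    rw [uIcc_of_le hx.1]; exact Icc_subset_Icc_right hx.2
  rw [intervalIntegral.integral_eq_sub_of_hasDerivAt (fun y hy => h y (hs hy))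
    (hc.mono hs).intervalIntegrable]
  ring

/-- A function with vanishing derivative is constant. -/
theorem eq_of_zero (hf : HasPrim f f' a b) (h : ∀ x ∈ Ioc a b, f' x = 0) {x : ℝ}
    (hx : x ∈ Icc a b) : f x = f a := by
  rw [hf.eq x hx, intervalIntegral.integral_congr_ae (g := fun _ => 0)]
  · simp
  · filter_upwards with y hy
    rw [uIoc_of_le hx.1] at hy
    exact h y ⟨hy.1, hy.2.trans hx.2⟩

end HasPrim

variable {D : Set ℝ} {q : ℝ → ℝ} {z : ℂ} {u du : ℝ → ℂ}

theorem IsSolution.hasPrim (h : IsSolution D q z u du) {c : ℝ} (hc : 0 ≤ c) (hD : Icc 0 c ⊆ D) :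
    HasPrim u du 0 c :=
  ⟨hc, ((h.dcont.mono hD).mono (by rw [uIcc_of_le hc])).intervalIntegrable,
    fun x hx => h.eq_u x (hD hx)⟩

theorem IsSolution.hasPrim_deriv (h : IsSolution D q z u du) {c : ℝ} (hc : 0 ≤ c)
    (hD : Icc 0 c ⊆ D) (hq : IntegrableOn q (Ioo 0 c)) :
    HasPrim du (fun t => ((q t : ℂ) - z) * u t) 0 c := by
  refine ⟨hc, ?_, fun x hx => h.eq_du x (hD hx)⟩
  have hq' : IntervalIntegrable (fun t => (q t : ℂ)) volume 0 c := by
    rw [intervalIntegrable_iff_integrableOn_Ioo_of_le hc]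
    exact hq.ofReal
  exact (hq'.sub intervalIntegrable_const).mul_continuousOn
    ((h.cont.mono hD).mono (by rw [uIcc_of_le hc]))

end

/-! ### The kernel equation: monotone iteration and weighted bounds -/

section

open scoped ENNReal

/-- One step of the monotone iteration for the kernel: the right hand side of the integral equation
`a σ x α = f σ (x + α) + ∫_x^c ∑ τ, (a τ t * a (σ + τ) t) (α + x - t) dt`, graded by `ℤ / 2`. -/
def kernelStep (f : Bool → ℝ → ℝ≥0∞) (c : ℝ) (a : Bool → ℝ → ℝ → ℝ≥0∞) : Bool → ℝ → ℝ → ℝ≥0∞ :=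
  fun σ x α => (Ioi (0 : ℝ)).indicator (fun α => f σ (x + α)) α +
    ∑ τ, ∫⁻ t in Ioc x c, ∫⁻ β, a τ t β * a (xor σ τ) t (α + x - t - β)

/-- The iterates of `kernelStep`, starting at zero. -/
def kernelIter (f : Bool → ℝ → ℝ≥0∞) (c : ℝ) : ℕ → Bool → ℝ → ℝ → ℝ≥0∞
  | 0 => fun _ _ _ => 0
  | n + 1 => kernelStep f c (kernelIter f c n)

/-- The least solution of the kernel equation. -/
def kernel (f : Bool → ℝ → ℝ≥0∞) (c : ℝ) : Bool → ℝ → ℝ → ℝ≥0∞ :=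
  fun σ x α => ⨆ n, kernelIter f c n σ x α

variable {f : Bool → ℝ → ℝ≥0∞} {c : ℝ} {a b : ℝ → ℝ → ℝ≥0∞}

/-- The variable is ((x, α), (t, β)); joint measurability in all four is what the later uses of
Tonelli require. -/
theorem measurable_convIntegrand (ha : Measurable (Function.uncurry a))
    (hb : Measurable (Function.uncurry b)) :
    Measurable fun p : (ℝ × ℝ) × ℝ × ℝ =>
      a p.2.1 p.2.2 * b p.2.1 (p.1.2 + p.1.1 - p.2.1 - p.2.2) := by
  refine (ha.comp (f := fun p : (ℝ × ℝ) × ℝ × ℝ => p.2) measurable_snd).mul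
    (hb.comp (f := fun p : (ℝ × ℝ) × ℝ × ℝ => (p.2.1, p.1.2 + p.1.1 - p.2.1 - p.2.2)) ?_)
  fun_prop

/-- The domain of integration depends on x, so it is moved into an indicator before integrating out
t. -/
theorem measurable_convTerm (ha : Measurable (Function.uncurry a))
    (hb : Measurable (Function.uncurry b)) :
    Measurable fun p : ℝ × ℝ =>
      ∫⁻ t in Ioc p.1 c, ∫⁻ β, a t β * b t (p.2 + p.1 - t - β) := by
  have h : (fun p : ℝ × ℝ => ∫⁻ t in Ioc p.1 c, ∫⁻ β, a t β * b t (p.2 + p.1 - t - β)) =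
      fun p : ℝ × ℝ => ∫⁻ t, {s : (ℝ × ℝ) × ℝ | s.1.1 < s.2 ∧ s.2 ≤ c}.indicator
        (fun s => ∫⁻ β, a s.2 β * b s.2 (s.1.2 + s.1.1 - s.2 - β)) (p, t) := by
    ext p
    rw [← lintegral_indicator measurableSet_Ioc]
    rfl
  rw [h]
  refine Measurable.lintegral_prod_right' (f := fun s : (ℝ × ℝ) × ℝ => _) ?_
  refine Measurable.indicator ?_ ?_
  · have := measurable_convIntegrand ha hb
    have h2 : Measurable fun p : ((ℝ × ℝ) × ℝ) × ℝ =>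
      a p.1.2 p.2 * b p.1.2 (p.1.1.2 + p.1.1.1 - p.1.2 - p.2) :=
      this.comp (f := fun p : ((ℝ × ℝ) × ℝ) × ℝ => (p.1.1, p.1.2, p.2)) (by fun_prop)
    exact h2.lintegral_prod_right'
  · exact (measurableSet_lt (f := fun s : (ℝ × ℝ) × ℝ => s.1.1) (g := fun s => s.2) (by fun_prop)
      (by fun_prop)).inter
      (measurableSet_le (f := fun s : (ℝ × ℝ) × ℝ => s.2) (g := fun _ => c) (by fun_prop)
      (by fun_prop))

theorem measurable_kernelStep (hf : ∀ σ, Measurable (f σ)) {a : Bool → ℝ → ℝ → ℝ≥0∞}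
    (ha : ∀ σ, Measurable (Function.uncurry (a σ))) (σ : Bool) :
    Measurable (Function.uncurry (kernelStep f c a σ)) := by
  unfold kernelStep
  refine Measurable.add ?_ (Finset.measurable_sum _ fun τ _ =>
    measurable_convTerm (ha τ) (ha (xor σ τ)))
  have : (fun p : ℝ × ℝ => (Ioi (0 : ℝ)).indicator (fun α => f σ (p.1 + α)) p.2) =
      (Prod.snd ⁻¹' Ioi (0 : ℝ)).indicator fun p : ℝ × ℝ => f σ (p.1 + p.2) := by
    ext p; rfl
  change Measurable fun p : ℝ × ℝ => (Ioi (0 : ℝ)).indicator (fun α => f σ (p.1 + α)) p.2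
  rw [this]
  exact ((hf σ).comp (by fun_prop)).indicator (measurable_snd measurableSet_Ioi)

theorem measurable_kernelIter (hf : ∀ σ, Measurable (f σ)) (n : ℕ) (σ : Bool) :
    Measurable (Function.uncurry (kernelIter f c n σ)) := by
  induction n generalizing σ with
  | zero => exact measurable_const
  | succ n ih => exact measurable_kernelStep hf ih σ

theorem measurable_kernel (hf : ∀ σ, Measurable (f σ)) (σ : Bool) :
    Measurable (Function.uncurry (kernel f c σ)) :=
  Measurable.iSup fun n => measurable_kernelIter hf n σ

theorem kernelStep_mono {a b : Bool → ℝ → ℝ → ℝ≥0∞} (h : ∀ σ x α, a σ x α ≤ b σ x α)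
    (σ : Bool) (x α : ℝ) : kernelStep f c a σ x α ≤ kernelStep f c b σ x α := by
  unfold kernelStep
  gcongr <;> apply h

theorem kernelIter_monotone (σ : Bool) (x α : ℝ) : Monotone fun n => kernelIter f c n σ x α := by
  refine monotone_nat_of_le_succ fun n => ?_
  induction n generalizing σ x α with
  | zero => exact zero_le
  | succ n ih => exact kernelStep_mono ih σ x α

theorem iSup_mul_iSup {u v : ℕ → ℝ≥0∞} (hu : Monotone u) (hv : Monotone v) :
    (⨆ n, u n) * (⨆ n, v n) = ⨆ n, u n * v n := by
  refine le_antisymm ?_ (iSup_le fun n => mul_le_mul' (le_iSup u n) (le_iSup v n))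
  rw [ENNReal.iSup_mul]
  refine iSup_le fun i => ?_
  rw [ENNReal.mul_iSup]
  refine iSup_le fun j => ?_
  refine le_iSup_of_le (max i j) ?_
  exact mul_le_mul' (hu (le_max_left _ _)) (hv (le_max_right _ _))

/-- Monotone convergence passes to the limit in the iteration. Since both factors increase in the
same index, the supremum of the products is the product of the suprema. -/
theorem kernel_eq (hf : ∀ σ, Measurable (f σ)) (σ : Bool) (x α : ℝ) :
    kernel f c σ x α = kernelStep f c (kernel f c) σ x α := by
  have h1 : kernel f c σ x α = ⨆ n, kernelIter f c (n + 1) σ x α :=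
    ((kernelIter_monotone σ x α).iSup_nat_add 1).symm
  have hconv : ∀ τ, (⨆ n, ∫⁻ t in Ioc x c, ∫⁻ β, kernelIter f c n τ t β *
      kernelIter f c n (xor σ τ) t (α + x - t - β)) =
      ∫⁻ t in Ioc x c, ∫⁻ β, kernel f c τ t β * kernel f c (xor σ τ) t (α + x - t - β) := by
    intro τ
    have hm : ∀ n, Measurable fun p : ℝ × ℝ => kernelIter f c n τ p.1 p.2 *
        kernelIter f c n (xor σ τ) p.1 (α + x - p.1 - p.2) := fun n =>
      (measurable_convIntegrand (measurable_kernelIter (c := c) hf n τ)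
        (measurable_kernelIter (c := c) hf n (xor σ τ))).comp
        (f := fun p : ℝ × ℝ => ((x, α), p)) (by fun_prop)
    rw [← lintegral_iSup (fun n => (hm n).lintegral_prod_right')]
    · refine lintegral_congr fun t => ?_
      have hm' : ∀ n, Measurable fun β => kernelIter f c n τ t β *
        kernelIter f c n (xor σ τ) t (α + x - t - β) := fun n =>
          (hm n).comp (f := fun β => (t, β)) (by fun_prop)
      refine (lintegral_iSup hm' ?_).symm.trans ?_
      rotate_left
      · refine lintegral_congr fun β => ?_
        exact (iSup_mul_iSup (kernelIter_monotone _ _ _) (kernelIter_monotone _ _ _)).symm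
      · intro m n hmn β
        exact mul_le_mul' (kernelIter_monotone _ _ _ hmn) (kernelIter_monotone _ _ _ hmn)
    · intro m n hmn t
      exact lintegral_mono fun β =>
        mul_le_mul' (kernelIter_monotone _ _ _ hmn) (kernelIter_monotone _ _ _ hmn)
  rw [h1]
  change (⨆ n, (_ + ∑ τ, _)) = _ + ∑ τ, _
  rw [← ENNReal.add_iSup, Finset.sum_congr rfl fun τ _ => (hconv τ).symm]
  congr 1
  refine ENNReal.finsetSum_iSup_of_monotone (fun τ => ?_) |>.symm
  intro m n hmn
  exact lintegral_mono fun t => lintegral_mono fun β =>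
    mul_le_mul' (kernelIter_monotone _ _ _ hmn) (kernelIter_monotone _ _ _ hmn)

/-- A supersolution of the total equation dominates the kernel. -/
theorem sum_kernel_le (hf : ∀ σ, Measurable (f σ)) {B : ℝ → ℝ≥0∞} {x₀ : ℝ}
    (hB : ∀ x α : ℝ, x₀ ≤ x → (Ioi (0 : ℝ)).indicator (fun α => ∑ σ : Bool, f σ (x + α)) α +
        ∫⁻ t in Ioc x c, ∫⁻ β, B β * B (α + x - t - β) ≤ B α)
    {x : ℝ} (hx : x₀ ≤ x) (α : ℝ) : ∑ σ, kernel f c σ x α ≤ B α := by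
  have key : ∀ n x α, x₀ ≤ x → ∑ σ, kernelIter f c n σ x α ≤ B α := by
    intro n
    induction n with
    | zero => intro x α _; simp [kernelIter]
    | succ n ih =>
      intro x α hx
      refine le_trans ?_ (hB x α hx)
      simp_rw [kernelIter, kernelStep, Finset.sum_add_distrib]
      refine add_le_add (le_of_eq ?_) ?_
      · by_cases h : 0 < α
        · simp [indicator_of_mem (mem_Ioi.2 h)]
        · simp [indicator_of_notMem (mt mem_Ioi.1 h)]
      · have hm : ∀ σ τ, Measurable fun p : ℝ × ℝ => kernelIter f c n τ p.1 p.2 *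
            kernelIter f c n (xor σ τ) p.1 (α + x - p.1 - p.2) := fun σ τ =>
          (measurable_convIntegrand (measurable_kernelIter (c := c) hf n τ)
            (measurable_kernelIter (c := c) hf n (xor σ τ))).comp
            (f := fun p : ℝ × ℝ => ((x, α), p)) (by fun_prop)
        have hm2 : ∀ σ τ t, Measurable fun β => kernelIter f c n τ t β *
            kernelIter f c n (xor σ τ) t (α + x - t - β) := fun σ τ t =>
          (hm σ τ).comp (f := fun β => (t, β)) (by fun_prop)
        simp_rw [← lintegral_finsetSum _ (fun τ _ => (hm _ τ).lintegral_prod_right')]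
        rw [← lintegral_finsetSum _ (fun σ _ => Finset.measurable_sum _
          fun τ _ => (hm σ τ).lintegral_prod_right')]
        refine setLIntegral_mono' measurableSet_Ioc fun t ht => ?_
        simp_rw [← lintegral_finsetSum _ (fun τ _ => hm2 _ τ t)]
        rw [← lintegral_finsetSum _ (fun σ _ => Finset.measurable_sum _ fun τ _ => hm2 σ τ t)]
        refine lintegral_mono fun β => ?_
        have h1 := ih t β (hx.trans ht.1.le)
        have h2 := ih t (α + x - t - β) (hx.trans ht.1.le)
        -- Summed over both grades, the products of components run over all pairs and factor into
        -- the product of the two totals.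
        refine le_trans (le_of_eq ?_) (mul_le_mul' h1 h2)
        simp only [Fintype.univ_bool, Finset.mem_singleton, Bool.true_eq_false, not_false_eq_true,
          Finset.sum_insert, Finset.sum_singleton, Bool.xor_true, Bool.xor_false,
          Bool.not_true, Bool.not_false]
        ring
  have hmono : ∑ σ, kernel f c σ x α = ⨆ n, ∑ σ, kernelIter f c n σ x α :=
    ENNReal.finsetSum_iSup_of_monotone fun σ => kernelIter_monotone σ x α
  rw [hmono]
  exact iSup_le fun n => key n x α hx

/-- Tonelli, followed by the translation γ = α + x - t - β in the variable α. -/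
theorem lintegral_mul_convTerm (ha : Measurable (Function.uncurry a))
    (hb : Measurable (Function.uncurry b)) {φ : ℝ → ℝ≥0∞} (hφ : Measurable φ) (x : ℝ) :
    ∫⁻ α, φ α * ∫⁻ t in Ioc x c, ∫⁻ β, a t β * b t (α + x - t - β) =
      ∫⁻ t in Ioc x c, ∫⁻ β, ∫⁻ γ, φ (β + γ + t - x) * (a t β * b t γ) := by
  have hm := measurable_convIntegrand ha hb
  have h1 : ∀ α, φ α * ∫⁻ t in Ioc x c, ∫⁻ β, a t β * b t (α + x - t - β) =
      ∫⁻ t in Ioc x c, ∫⁻ β, φ α * (a t β * b t (α + x - t - β)) := by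
    intro α
    have hm2 : Measurable fun p : ℝ × ℝ => a p.1 p.2 * b p.1 (α + x - p.1 - p.2) :=
      hm.comp (f := fun p : ℝ × ℝ => ((x, α), p)) (by fun_prop)
    rw [← lintegral_const_mul _ hm2.lintegral_prod_right']
    refine lintegral_congr fun t => ?_
    rw [lintegral_const_mul]
    exact hm2.comp (f := fun β => (t, β)) (by fun_prop)
  simp_rw [h1]
  have hm3 : Measurable fun p : (ℝ × ℝ) × ℝ =>
      φ p.1.1 * (a p.1.2 p.2 * b p.1.2 (p.1.1 + x - p.1.2 - p.2)) :=
    (hφ.comp (by fun_prop)).mul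
      (hm.comp (f := fun p : (ℝ × ℝ) × ℝ => ((x, p.1.1), p.1.2, p.2)) (by fun_prop))
  rw [lintegral_lintegral_swap hm3.lintegral_prod_right'.aemeasurable]
  refine lintegral_congr fun t => ?_
  have hm4 : Measurable (Function.uncurry fun α β => φ α * (a t β * b t (α + x - t - β))) :=
    hm3.comp (f := fun p : ℝ × ℝ => ((p.1, t), p.2)) (by fun_prop)
  rw [lintegral_lintegral_swap hm4.aemeasurable]
  refine lintegral_congr fun β => ?_
  rw [← lintegral_add_right_eq_self _ (β + t - x)]
  refine lintegral_congr fun γ => ?_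
  rw [show γ + (β + t - x) = β + γ + t - x by ring,
    show β + γ + t - x + x - t - β = γ by ring]

theorem lintegral_mul_indicator {g : ℝ → ℝ≥0∞} {φ : ℝ → ℝ≥0∞} (x : ℝ) :
    ∫⁻ α, φ α * (Ioi (0 : ℝ)).indicator (fun α => g (x + α)) α =
      ∫⁻ t in Ioi x, φ (t - x) * g t := by
  rw [← lintegral_indicator measurableSet_Ioi,
    ← lintegral_add_right_eq_self ((Ioi x).indicator fun t => φ (t - x) * g t) x]
  refine lintegral_congr fun α => ?_
  by_cases h : 0 < α
  · rw [indicator_of_mem (mem_Ioi.2 h), indicator_of_mem (by simpa using h)]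
    rw [add_sub_cancel_right, add_comm]
  · rw [indicator_of_notMem (mt mem_Ioi.1 h), indicator_of_notMem (by simpa using h), mul_zero]

/-- The weak form of the kernel equation. -/
theorem lintegral_mul_kernelStep (hf : ∀ σ, Measurable (f σ)) {a : Bool → ℝ → ℝ → ℝ≥0∞}
    (ha : ∀ σ, Measurable (Function.uncurry (a σ))) {φ : ℝ → ℝ≥0∞} (hφ : Measurable φ)
    (σ : Bool) (x : ℝ) :
    ∫⁻ α, φ α * kernelStep f c a σ x α =
      (∫⁻ t in Ioi x, φ (t - x) * f σ t) +
        ∑ τ, ∫⁻ t in Ioc x c, ∫⁻ β, ∫⁻ γ, φ (β + γ + t - x) * (a τ t β * a (xor σ τ) t γ) := by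
  unfold kernelStep
  simp_rw [mul_add, Finset.mul_sum]
  rw [lintegral_add_left, lintegral_finsetSum, lintegral_mul_indicator]
  · congr 1
    exact Finset.sum_congr rfl fun τ _ => lintegral_mul_convTerm (ha τ) (ha _) hφ x
  · intro τ _
    exact hφ.mul ((measurable_convTerm (ha τ) (ha _)).comp (f := fun α => (x, α)) (by fun_prop))
  · exact hφ.mul (((hf σ).comp (measurable_const_add x)).indicator measurableSet_Ioi)

/-- The weight `e^{-2kα}`. -/
def expWeight (k α : ℝ) : ℝ≥0∞ := ENNReal.ofReal (Real.exp (-2 * k * α))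

theorem measurable_expWeight (k : ℝ) : Measurable (expWeight k) := by
  unfold expWeight; fun_prop

theorem expWeight_add (k α β : ℝ) : expWeight k (α + β) = expWeight k α * expWeight k β := by
  unfold expWeight
  rw [← ENNReal.ofReal_mul (Real.exp_pos _).le, ← Real.exp_add]; ring_nf

theorem lintegral_expWeight {k : ℝ} (hk : 0 < k) (x : ℝ) :
    ∫⁻ t in Ioi x, expWeight k (t - x) = ENNReal.ofReal (1 / (2 * k)) := by
  have h0 : ∫⁻ t in Ioi x, expWeight k (t - x) = ∫⁻ t in Ioi (0 : ℝ), expWeight k t := by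
    rw [← lintegral_indicator measurableSet_Ioi, ← lintegral_indicator measurableSet_Ioi,
      ← lintegral_add_right_eq_self _ x]
    refine lintegral_congr fun α => ?_
    by_cases h : 0 < α
    · rw [indicator_of_mem (s := Ioi (0 : ℝ)) h, indicator_of_mem (by simpa using h)]
      simp
    · rw [indicator_of_notMem (s := Ioi (0 : ℝ)) h, indicator_of_notMem (by simpa using h)]
  have hi : IntegrableOn (fun t : ℝ => Real.exp (-2 * k * t)) (Ioi 0) :=
    integrableOn_exp_mul_Ioi (by linarith) 0
  rw [h0]
  unfold expWeight
  rw [← ofReal_integral_eq_lintegral_ofReal hi (ae_of_all _ fun t => (Real.exp_pos _).le),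
    integral_exp_mul_Ioi (by linarith) 0]
  congr 1
  simp only [mul_zero, Real.exp_zero]
  field_simp

/-- The exponential weight is multiplicative, so the convolution in α becomes a product of weighted
integrals. -/
theorem lintegral_expWeight_kernelStep (hf : ∀ σ, Measurable (f σ)) {a : Bool → ℝ → ℝ → ℝ≥0∞}
    (ha : ∀ σ, Measurable (Function.uncurry (a σ))) (k : ℝ) (σ : Bool) (x : ℝ) :
    ∫⁻ α, expWeight k α * kernelStep f c a σ x α =
      (∫⁻ t in Ioi x, expWeight k (t - x) * f σ t) +
        ∑ τ, ∫⁻ t in Ioc x c, expWeight k (t - x) *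
          ((∫⁻ β, expWeight k β * a τ t β) * ∫⁻ γ, expWeight k γ * a (xor σ τ) t γ) := by
  rw [lintegral_mul_kernelStep hf ha (measurable_expWeight k)]
  congr 1
  refine Finset.sum_congr rfl fun τ _ => lintegral_congr fun t => ?_
  have hmeas : ∀ ρ, Measurable fun β => expWeight k β * a ρ t β := fun ρ =>
    (measurable_expWeight k).mul ((ha ρ).comp (f := fun β => (t, β)) (by fun_prop))
  rw [← lintegral_mul_const _ (hmeas τ), ← lintegral_const_mul _ ((hmeas τ).mul_const _)]
  refine lintegral_congr fun β => ?_
  rw [← mul_assoc, ← lintegral_const_mul _ (hmeas _)]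
  refine lintegral_congr fun γ => ?_
  rw [show β + γ + t - x = (t - x) + (β + γ) by ring, expWeight_add, expWeight_add]
  ring

/-- After the convolution has become a product bounded by M², the remaining weight in t integrates
to 1/(2k). The quadratic term is thus small for large k, and the iteration preserves a ball. -/
theorem sum_lintegral_expWeight_kernelStep_le (hf : ∀ σ, Measurable (f σ))
    {a : Bool → ℝ → ℝ → ℝ≥0∞} (ha : ∀ σ, Measurable (Function.uncurry (a σ))) {k : ℝ} (hk : 0 < k)
    {M : ℝ≥0∞} (hM : ∀ x, ∑ σ, ∫⁻ α, expWeight k α * a σ x α ≤ M) (x : ℝ) :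
    ∑ σ, ∫⁻ α, expWeight k α * kernelStep f c a σ x α ≤
      (∑ σ, ∫⁻ t, f σ t) + M ^ 2 * ENNReal.ofReal (1 / (2 * k)) := by
  have hle : ∀ t ∈ Ioi x, expWeight k (t - x) ≤ 1 := by
    intro t ht
    have ht' : x < t := ht
    unfold expWeight
    rw [← ENNReal.ofReal_one]
    refine ENNReal.ofReal_le_ofReal (Real.exp_le_one_iff.2 ?_)
    nlinarith
  simp_rw [lintegral_expWeight_kernelStep hf ha, Finset.sum_add_distrib]
  refine add_le_add (Finset.sum_le_sum fun σ _ => ?_) ?_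
  · refine le_trans (setLIntegral_mono' measurableSet_Ioi (g := f σ) fun t ht => ?_)
      (setLIntegral_le_lintegral _ _)
    exact mul_le_of_le_one_left zero_le (hle t ht)
  · have hm2 : ∀ σ, Measurable fun t => ∫⁻ β, expWeight k β * a σ t β := fun σ =>
      (((measurable_expWeight k).comp measurable_snd).mul (ha σ)).lintegral_prod_right'
    have hm3 : ∀ σ τ, Measurable fun t => expWeight k (t - x) *
        ((∫⁻ β, expWeight k β * a τ t β) *
          ∫⁻ γ, expWeight k γ * a (xor σ τ) t γ) := fun σ τ =>
      ((measurable_expWeight k).comp (measurable_id.sub_const x)).mul ((hm2 τ).mul (hm2 _))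
    have hw : Measurable fun t => expWeight k (t - x) :=
      (measurable_expWeight k).comp (measurable_id.sub_const x)
    rw [← lintegral_expWeight hk x, mul_comm, ← lintegral_mul_const _ hw]
    simp_rw [← lintegral_finsetSum _ (fun τ _ => hm3 _ τ)]
    rw [← lintegral_finsetSum _ (fun σ _ => Finset.measurable_sum _ fun τ _ => hm3 σ τ)]
    refine (lintegral_mono_set (Ioc_subset_Ioi_self)).trans (lintegral_mono fun t => ?_)
    have := hM t
    simp only [Fintype.univ_bool, Finset.mem_singleton, Bool.true_eq_false, not_false_eq_true,
      Finset.sum_insert, Finset.sum_singleton, Bool.bne_true, Bool.not_false,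
      Bool.bne_false, Bool.not_true] at this ⊢
    calc _ = expWeight k (t - x) * ((∫⁻ α, expWeight k α * a true t α) +
          ∫⁻ α, expWeight k α * a false t α) ^ 2 := by ring
      _ ≤ _ := by gcongr

/-- The exponentially weighted norm of the kernel is bounded uniformly in `x`. -/
theorem lintegral_expWeight_kernelIter_le (hf : ∀ σ, Measurable (f σ)) {k : ℝ} (hk : 0 < k)
    {M : ℝ≥0∞} (hM : (∑ σ, ∫⁻ t, f σ t) + M ^ 2 * ENNReal.ofReal (1 / (2 * k)) ≤ M) (n : ℕ)
    {x : ℝ} : ∑ σ, ∫⁻ α, expWeight k α * kernelIter f c n σ x α ≤ M := by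
  induction n generalizing x with
  | zero => simp [kernelIter]
  | succ n ih =>
    exact (sum_lintegral_expWeight_kernelStep_le hf (measurable_kernelIter hf n) hk
      (fun x => ih) x).trans hM

theorem lintegral_expWeight_kernel_le (hf : ∀ σ, Measurable (f σ)) {k : ℝ} (hk : 0 < k)
    {M : ℝ≥0∞} (hM : (∑ σ, ∫⁻ t, f σ t) + M ^ 2 * ENNReal.ofReal (1 / (2 * k)) ≤ M)
    (x : ℝ) : ∑ σ, ∫⁻ α, expWeight k α * kernel f c σ x α ≤ M := by
  have h : ∀ σ, ∫⁻ α, expWeight k α * kernel f c σ x α =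
      ⨆ n, ∫⁻ α, expWeight k α * kernelIter f c n σ x α := by
    intro σ
    rw [← lintegral_iSup]
    · simp only [kernel, ENNReal.mul_iSup]
    · exact fun n => (measurable_expWeight k).mul
        ((measurable_kernelIter hf n σ).comp (f := fun α => (x, α)) (by fun_prop))
    · exact fun m n hmn α => mul_le_mul_right (kernelIter_monotone σ x α hmn) _
  simp_rw [h]
  rw [ENNReal.finsetSum_iSup_of_monotone]
  · exact iSup_le fun n => lintegral_expWeight_kernelIter_le hf hk hM n
  · exact fun σ m n hmn => lintegral_mono fun α =>
      mul_le_mul_right (kernelIter_monotone σ x α hmn) _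

end

/-! ### Laplace transform of the kernel -/

section

open scoped ENNReal

variable {f : Bool → ℝ → ℝ≥0∞} {c : ℝ}

/-- The bilateral Laplace transform `∫ g(α) e^{-2κα} dα` of a nonnegative function. -/
def laplace (g : ℝ → ℝ≥0∞) (κ : ℂ) : ℂ := ∫ α, ((g α).toReal : ℂ) * Complex.exp (-2 * κ * α)

theorem norm_cexp_weight (κ : ℂ) (α : ℝ) :
    ‖Complex.exp (-2 * κ * α)‖ = Real.exp (-2 * κ.re * α) := by
  rw [Complex.norm_exp]; simp

theorem enorm_cexp_weight (κ : ℂ) (α : ℝ) :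
    ‖Complex.exp (-2 * κ * α)‖ₑ = expWeight κ.re α := by
  rw [← ofReal_norm, norm_cexp_weight, expWeight]

theorem expWeight_ne_zero (k α : ℝ) : expWeight k α ≠ 0 := by
  simp [expWeight, Real.exp_pos]

theorem ae_lt_top_of_weight {X : Type*} [MeasurableSpace X] {μ : Measure X} {g w : X → ℝ≥0∞}
    (hw : Measurable w) (hg : Measurable g) (hw0 : ∀ x, w x ≠ 0)
    (h : ∫⁻ x, w x * g x ∂μ ≠ ∞) : ∀ᵐ x ∂μ, g x < ∞ := by
  filter_upwards [ae_lt_top (hw.mul hg) h] with x hx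
  by_contra hcon
  simp only [Pi.mul_apply, not_lt, top_le_iff] at hcon hx
  rw [hcon, ENNReal.mul_top (hw0 x)] at hx
  exact lt_irrefl _ hx

/-- Change of variables for a complex integral against a density. -/
theorem integral_map_withDensity {X : Type*} [MeasurableSpace X] {μ : Measure X} {g : X → ℝ≥0∞}
    {ψ : X → ℝ} (hg : Measurable g) (hψ : Measurable ψ) {κ : ℂ}
    (hi : Integrable (fun α : ℝ => Complex.exp (-2 * κ * α)) ((μ.withDensity g).map ψ)) :
    Integrable (fun x => ((g x).toReal : ℂ) * Complex.exp (-2 * κ * ψ x)) μ ∧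
    ∫ α : ℝ, Complex.exp (-2 * κ * α) ∂((μ.withDensity g).map ψ) =
      ∫ x, ((g x).toReal : ℂ) * Complex.exp (-2 * κ * ψ x) ∂μ := by
  have hce : Measurable fun α : ℝ => Complex.exp (-2 * κ * α) := by fun_prop
  have hlt : ∀ᵐ x ∂μ, g x < ∞ := by
    refine ae_lt_top_of_weight (w := fun x => expWeight κ.re (ψ x))
      ((measurable_expWeight _).comp hψ) hg (fun x => expWeight_ne_zero _ _) ?_
    have hce2 : Measurable fun x => ‖Complex.exp (-2 * κ * ψ x)‖ₑ := hce.enorm.comp hψ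
    have := hi.2
    rw [HasFiniteIntegral, lintegral_map hce.enorm hψ,
      lintegral_withDensity_eq_lintegral_mul _ hg hce2] at this
    refine ne_of_lt (lt_of_eq_of_lt (lintegral_congr fun x => ?_) this)
    rw [Pi.mul_apply, enorm_cexp_weight, mul_comm]
  have hi2 := (integrable_map_measure hce.aestronglyMeasurable hψ.aemeasurable).1 hi
  have e : ∀ x, (g x).toReal • Complex.exp (-2 * κ * ψ x) =
      ((g x).toReal : ℂ) * Complex.exp (-2 * κ * ψ x) := fun x => Complex.real_smul
  refine ⟨?_, ?_⟩
  · have := (integrable_withDensity_iff_integrable_smul' hg hlt).1 hi2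
    exact this.congr (ae_of_all _ fun x => e x)
  · rw [integral_map hψ.aemeasurable hce.aestronglyMeasurable,
      integral_withDensity_eq_integral_toReal_smul hg hlt]
    exact integral_congr_ae (ae_of_all _ fun x => e x)

/-- An identity of measures can be tested on nonnegative functions, where the weak form applies
without integrability conditions; afterwards complex exponentials may be integrated against both
sides. -/
theorem kernel_measure_eq (hf : ∀ σ, Measurable (f σ)) (σ : Bool) (x : ℝ) :
    volume.withDensity (kernel f c σ x) =
      ((volume.restrict (Ioi x)).withDensity (f σ)).map (fun t => t - x) +
      ∑ τ, ((((volume.restrict (Ioc x c)).prod (volume.prod volume)).withDensity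
        (fun p : ℝ × ℝ × ℝ => kernel f c τ p.1 p.2.1 * kernel f c (xor σ τ) p.1 p.2.2)).map
          (fun p => p.2.1 + p.2.2 + p.1 - x)) := by
  have hk := measurable_kernel (c := c) hf
  have hk3 : ∀ τ, Measurable fun p : ℝ × ℝ × ℝ =>
      kernel f c τ p.1 p.2.1 * kernel f c (xor σ τ) p.1 p.2.2 := fun τ =>
    ((hk τ).comp (f := fun p : ℝ × ℝ × ℝ => (p.1, p.2.1)) (by fun_prop)).mul
      ((hk _).comp (f := fun p : ℝ × ℝ × ℝ => (p.1, p.2.2)) (by fun_prop))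
  refine Measure.ext_of_lintegral _ fun φ hφ => ?_
  have hkx : Measurable (kernel f c σ x) := (hk σ).comp (f := fun α => (x, α)) (by fun_prop)
  rw [lintegral_withDensity_eq_lintegral_mul _ hkx hφ]
  have h1 : ∫⁻ α, (kernel f c σ x * φ) α = ∫⁻ α, φ α * kernelStep f c (kernel f c) σ x α := by
    refine lintegral_congr fun α => ?_
    rw [Pi.mul_apply, mul_comm, ← kernel_eq hf]
  rw [h1, lintegral_mul_kernelStep hf hk hφ, lintegral_add_measure, lintegral_finsetSum_measure]
  congr 1
  · have hφ1 : Measurable fun t => φ (t - x) := hφ.comp (by fun_prop)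
    rw [lintegral_map hφ (by fun_prop), lintegral_withDensity_eq_lintegral_mul _ (hf σ) hφ1]
    exact lintegral_congr fun t => mul_comm _ _
  · refine Finset.sum_congr rfl fun τ _ => ?_
    have hφ3 : Measurable fun p : ℝ × ℝ × ℝ => φ (p.2.1 + p.2.2 + p.1 - x) :=
      hφ.comp (by fun_prop)
    rw [lintegral_map hφ (by fun_prop), lintegral_withDensity_eq_lintegral_mul _ (hk3 τ) hφ3,
      lintegral_prod _ ((hk3 τ).mul hφ3).aemeasurable]
    refine lintegral_congr fun t => ?_
    have h3 : Measurable fun p : ℝ × ℝ => ((fun p : ℝ × ℝ × ℝ => kernel f c τ p.1 p.2.1 *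
        kernel f c (xor σ τ) p.1 p.2.2) * fun p : ℝ × ℝ × ℝ => φ (p.2.1 + p.2.2 + p.1 - x)) (t, p) :=
      ((hk3 τ).mul hφ3).comp (f := fun p : ℝ × ℝ => (t, p)) (by fun_prop)
    rw [lintegral_prod _ h3.aemeasurable]
    exact lintegral_congr fun β => lintegral_congr fun γ => mul_comm _ _

theorem integrable_laplace {g : ℝ → ℝ≥0∞} (hg : Measurable g) {κ : ℂ}
    (h : ∫⁻ α, expWeight κ.re α * g α ≠ ∞) :
    Integrable fun α : ℝ => ((g α).toReal : ℂ) * Complex.exp (-2 * κ * α) := by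
  refine ⟨?_, ?_⟩
  · exact ((Complex.measurable_ofReal.comp hg.ennreal_toReal).mul
      (by fun_prop)).aestronglyMeasurable
  · refine lt_of_le_of_lt (lintegral_mono fun α => ?_) (lt_top_iff_ne_top.2 h)
    rw [enorm_mul, enorm_cexp_weight, mul_comm]
    gcongr
    rw [← ofReal_norm, Complex.norm_real, Real.norm_of_nonneg ENNReal.toReal_nonneg]
    exact ENNReal.ofReal_toReal_le

theorem integrable_cexp_withDensity {g : ℝ → ℝ≥0∞} (hg : Measurable g) {κ : ℂ}
    (h : ∫⁻ α, expWeight κ.re α * g α ≠ ∞) :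
    Integrable (fun α : ℝ => Complex.exp (-2 * κ * α)) (volume.withDensity g) := by
  have hce : Measurable fun α : ℝ => Complex.exp (-2 * κ * α) := by fun_prop
  refine ⟨hce.aestronglyMeasurable, ?_⟩
  rw [HasFiniteIntegral, lintegral_withDensity_eq_lintegral_mul _ hg hce.enorm]
  refine lt_of_eq_of_lt (lintegral_congr fun x => ?_) (lt_top_iff_ne_top.2 h)
  rw [Pi.mul_apply, enorm_cexp_weight, mul_comm]

/-- The Laplace transform of the kernel satisfies a Riccati integral equation. -/
theorem laplace_kernel_eq (hf : ∀ σ, Measurable (f σ)) {κ : ℂ}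
    (hfin : ∀ σ x, ∫⁻ α, expWeight κ.re α * kernel f c σ x α ≠ ∞) (σ : Bool) (x : ℝ) :
    laplace (kernel f c σ x) κ =
      (∫ t in Ioi x, ((f σ t).toReal : ℂ) * Complex.exp (-2 * κ * (t - x : ℝ))) +
      ∑ τ, ∫ t in Ioc x c, Complex.exp (-2 * κ * (t - x : ℝ)) *
        (laplace (kernel f c τ t) κ * laplace (kernel f c (xor σ τ) t) κ) := by
  have hk := measurable_kernel (c := c) hf
  have hkx : Measurable (kernel f c σ x) := (hk σ).comp (f := fun α => (x, α)) (by fun_prop)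
  have hk3 : ∀ τ, Measurable fun p : ℝ × ℝ × ℝ =>
      kernel f c τ p.1 p.2.1 * kernel f c (xor σ τ) p.1 p.2.2 := fun τ =>
    ((hk τ).comp (f := fun p : ℝ × ℝ × ℝ => (p.1, p.2.1)) (by fun_prop)).mul
      ((hk _).comp (f := fun p : ℝ × ℝ × ℝ => (p.1, p.2.2)) (by fun_prop))
  have h0 := integrable_cexp_withDensity hkx (hfin σ x)
  have h1 : laplace (kernel f c σ x) κ =
      ∫ α : ℝ, Complex.exp (-2 * κ * α) ∂(volume.withDensity (kernel f c σ x)) := by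
    have := (integral_map_withDensity (μ := volume) hkx measurable_id (κ := κ)
      (by rwa [Measure.map_id])).2
    rw [Measure.map_id] at this
    exact this.symm
  rw [kernel_measure_eq hf] at h0 h1
  rw [integrable_add_measure, integrable_finsetSum_measure] at h0
  rw [h1, integral_add_measure h0.1 (integrable_finsetSum_measure.2 h0.2),
    integral_finsetSum_measure h0.2]
  congr 1
  · exact (integral_map_withDensity (hf σ) (by fun_prop) h0.1).2
  · refine Finset.sum_congr rfl fun τ hτ => ?_
    obtain ⟨hi, he⟩ := integral_map_withDensity (hk3 τ) (by fun_prop) (h0.2 τ hτ)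
    rw [he, integral_prod _ hi]
    refine integral_congr_ae (ae_of_all _ fun t => ?_)
    simp only [laplace]
    rw [← integral_prod_mul, ← integral_const_mul]
    refine integral_congr_ae (ae_of_all _ fun p => ?_)
    simp only [ENNReal.toReal_mul, Complex.ofReal_mul]
    rw [show (-2 * κ * ((p.1 + p.2 + t - x : ℝ) : ℂ)) =
      -2 * κ * ((t - x : ℝ) : ℂ) + (-2 * κ * p.1 + -2 * κ * p.2) by push_cast; ring,
      Complex.exp_add, Complex.exp_add]
    ring

end

/-! ### Uniqueness for Laplace transforms over a finite interval -/

section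

open scoped ENNReal

/-- The entire function `∫_0^c f(α) e^{2(c-α)κ} dα`. -/
def reversedLaplace (f : ℝ → ℝ) (c : ℝ) (κ : ℂ) : ℂ :=
  ∫ α in Ioo 0 c, (f α : ℂ) * Complex.exp (2 * (c - α) * κ)

variable {f : ℝ → ℝ} {c : ℝ}

theorem norm_cexp_reversed (α : ℝ) (κ : ℂ) :
    ‖Complex.exp (2 * (c - α) * κ)‖ = Real.exp (2 * (c - α) * κ.re) := by
  rw [Complex.norm_exp]
  congr 1
  have : (2 * ((c : ℂ) - α) * κ) = ((2 * (c - α) : ℝ) : ℂ) * κ := by push_cast; ring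
  rw [this, Complex.re_ofReal_mul]

theorem aestronglyMeasurable_reversed (hf : IntegrableOn f (Ioo 0 c)) (κ : ℂ) :
    AEStronglyMeasurable (fun α : ℝ => (f α : ℂ) * Complex.exp (2 * (c - α) * κ))
      (volume.restrict (Ioo 0 c)) :=
  hf.ofReal.aestronglyMeasurable.mul (by fun_prop : Continuous fun α : ℝ =>
    Complex.exp (2 * (c - α) * κ)).aestronglyMeasurable

theorem norm_reversed_le {K : ℝ} {κ : ℂ} (hK : κ.re ≤ K) (hK0 : 0 ≤ K) {α : ℝ}
    (hα : α ∈ Ioo 0 c) :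
    ‖(f α : ℂ) * Complex.exp (2 * (c - α) * κ)‖ ≤ |f α| * Real.exp (2 * c * K) := by
  rw [norm_mul, norm_cexp_reversed, Complex.norm_real, Real.norm_eq_abs]
  have h1 : 0 ≤ c - α := by linarith [hα.2]
  refine mul_le_mul_of_nonneg_left (Real.exp_le_exp.2 ?_) (abs_nonneg _)
  calc 2 * (c - α) * κ.re ≤ 2 * (c - α) * K := by gcongr
    _ ≤ 2 * c * K := by gcongr; linarith [hα.1]

theorem norm_reversedLaplace_le (hf : IntegrableOn f (Ioo 0 c)) {K : ℝ} {κ : ℂ} (hK : κ.re ≤ K)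
    (hK0 : 0 ≤ K) :
    ‖reversedLaplace f c κ‖ ≤ (∫ α in Ioo 0 c, |f α|) * Real.exp (2 * c * K) := by
  rw [← integral_mul_const]
  refine norm_integral_le_of_norm_le (hf.abs.mul_const _) ?_
  filter_upwards [ae_restrict_mem measurableSet_Ioo] with α hα using norm_reversed_le hK hK0 hα

theorem differentiable_reversedLaplace (hf : IntegrableOn f (Ioo 0 c)) :
    Differentiable ℂ (reversedLaplace f c) := by
  intro κ
  refine (hasDerivAt_integral_of_dominated_loc_of_deriv_le
    (F' := fun κ α => (f α : ℂ) * (Complex.exp (2 * (c - α) * κ) * (2 * (c - α))))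
    (bound := fun α => |f α| * Real.exp (2 * c * (|κ.re| + 1)) * (2 * c))
    (Metric.ball_mem_nhds κ one_pos) (Eventually.of_forall fun κ =>
      aestronglyMeasurable_reversed hf κ) ?_ ?_ ?_ ((hf.abs.mul_const _).mul_const _)
      ?_).2.differentiableAt
  · refine Integrable.mono' (hf.abs.mul_const (Real.exp (2 * c * |κ.re|)))
      (aestronglyMeasurable_reversed hf κ) ?_
    filter_upwards [ae_restrict_mem measurableSet_Ioo] with α hα
      using norm_reversed_le (le_abs_self _) (abs_nonneg _) hα
  · exact hf.ofReal.aestronglyMeasurable.mul (by fun_prop : Continuous fun α : ℝ =>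
      Complex.exp (2 * (c - α) * κ) * (2 * (c - α))).aestronglyMeasurable
  · filter_upwards [ae_restrict_mem measurableSet_Ioo] with α hα w hw
    rw [← mul_assoc, norm_mul]
    have hw' : w.re ≤ |κ.re| + 1 := by
      have h1 : |(w - κ).re| < 1 := (Complex.abs_re_le_norm _).trans_lt (by
        simpa [dist_eq_norm] using hw)
      rw [Complex.sub_re] at h1
      linarith [(abs_lt.1 h1).2, le_abs_self κ.re]
    refine mul_le_mul (norm_reversed_le hw' (by positivity) hα) ?_ (norm_nonneg _) (by positivity)
    have : (2 * ((c : ℂ) - α)) = ((2 * (c - α) : ℝ) : ℂ) := by push_cast; ring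
    rw [this, Complex.norm_real, Real.norm_eq_abs, abs_of_nonneg (by linarith [hα.2])]
    linarith [hα.1]
  · refine ae_of_all _ fun α w _ => ?_
    have := (((hasDerivAt_id w).const_mul (2 * ((c : ℂ) - α))).cexp).const_mul (f α : ℂ)
    simpa using this

theorem reversedLaplace_conj (κ : ℂ) :
    reversedLaplace f c (conj κ) = conj (reversedLaplace f c κ) := by
  unfold reversedLaplace
  rw [← integral_conj]
  refine integral_congr_ae (ae_of_all _ fun α => ?_)
  simp only [map_mul, Complex.conj_ofReal, ← Complex.exp_conj, map_sub, map_ofNat]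

theorem reversedLaplace_eq (κ : ℂ) :
    reversedLaplace f c κ = Complex.exp (2 * c * κ) *
      ∫ α in Ioo 0 c, (f α : ℂ) * Complex.exp (-2 * (α : ℂ) * κ) := by
  unfold reversedLaplace
  rw [← integral_const_mul]
  refine integral_congr_ae (ae_of_all _ fun α => ?_)
  simp only
  rw [show 2 * ((c : ℂ) - α) * κ = 2 * c * κ + -2 * α * κ by ring, Complex.exp_add]
  ring

/-- Exponential type means order 1, below the critical order 2 of the Phragmén–Lindelöf principle in
a quadrant or a half-plane. -/
theorem isBigO_of_norm_le_exp {g : ℂ → ℂ} {l : Filter ℂ} {A K : ℝ}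
    (h : ∀ κ, ‖g κ‖ ≤ A * Real.exp (K * ‖κ‖)) :
    ∃ e < (2 : ℝ), ∃ K, g =O[l] fun z => Real.exp (K * ‖z‖ ^ e) := by
  refine ⟨1, by norm_num, K, Asymptotics.IsBigO.of_bound A (Eventually.of_forall fun κ => ?_)⟩
  rw [Real.rpow_one, Real.norm_of_nonneg (Real.exp_pos _).le]
  exact h κ

theorem norm_reversedLaplace_mul_exp_le (hf : IntegrableOn f (Ioo 0 c)) {δ : ℝ}
    (hδ : 0 ≤ δ) (κ : ℂ) :
    ‖reversedLaplace f c κ * Complex.exp (-δ * κ)‖ ≤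
      (∫ α in Ioo 0 c, |f α|) * Real.exp ((2 * c + δ) * ‖κ‖) := by
  have h0 : 0 ≤ ∫ α in Ioo 0 c, |f α| := integral_nonneg fun _ => abs_nonneg _
  rw [norm_mul, add_mul, Real.exp_add, ← mul_assoc]
  refine mul_le_mul (norm_reversedLaplace_le hf (Complex.re_le_norm κ) (norm_nonneg _)) ?_
    (norm_nonneg _) (by positivity)
  rw [Complex.norm_exp, ← Complex.ofReal_neg, Complex.re_ofReal_mul]
  refine Real.exp_le_exp.2 ?_
  have := (abs_le.1 (Complex.abs_re_le_norm κ)).1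
  nlinarith

/-- An entire function of the form `∫_0^c f(α) e^{2(c-α)κ} dα` which has subexponential growth along
one ray in the open fourth quadrant vanishes. -/
theorem reversedLaplace_eq_zero (hf : IntegrableOn f (Ioo 0 c))
    (h : ∀ δ : ℝ, 0 < δ → ∃ C : ℝ, ∀ r : ℝ, 0 ≤ r →
      ‖reversedLaplace f c (r * (1 - Complex.I))‖ ≤ C * Real.exp (δ * r)) (κ : ℂ) :
    reversedLaplace f c κ = 0 := by
  set B := ∫ α in Ioo 0 c, |f α| with hB
  have hd := differentiable_reversedLaplace hf
  have hB0 : 0 ≤ B := integral_nonneg fun _ => abs_nonneg _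
  -- The factor e^{-δκ} makes the function bounded on the ray through 1 - i and, by conjugation, on
  -- the one through 1 + i, hence on the positive axis between them. The half-plane version then
  -- improves the bound to the value B valid on the imaginary axis, which is independent of δ; let δ
  -- → 0.
  have hright : ∀ κ : ℂ, 0 ≤ κ.re → ‖reversedLaplace f c κ‖ ≤ B := by
    intro κ hκ
    have key : ∀ δ : ℝ, 0 < δ → ‖reversedLaplace f c κ * Complex.exp (-δ * κ)‖ ≤ B := by
      intro δ hδ
      obtain ⟨C, hC⟩ := h δ hδ
      have hn : ∀ w : ℂ, ‖Complex.exp (-δ * w)‖ = Real.exp (-δ * w.re) := fun w => by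
        rw [Complex.norm_exp, ← Complex.ofReal_neg, Complex.re_ofReal_mul]
      have hdiff : Differentiable ℂ fun κ => reversedLaplace f c κ * Complex.exp (-δ * κ) :=
        hd.mul (by fun_prop)
      have hray : ∀ r : ℝ, 0 ≤ r → ‖reversedLaplace f c (r * (1 - Complex.I)) *
          Complex.exp (-δ * (r * (1 - Complex.I)))‖ ≤ C := by
        intro r hr
        rw [norm_mul, hn, Complex.re_ofReal_mul]
        simp only [Complex.sub_re, Complex.one_re, Complex.I_re, sub_zero, mul_one]
        calc _ ≤ C * Real.exp (δ * r) * Real.exp (-δ * r) := by gcongr; exact hC r hr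
          _ = C := by rw [mul_assoc, ← Real.exp_add]; simp
      have hray' : ∀ r : ℝ, 0 ≤ r → ‖reversedLaplace f c (r * (1 + Complex.I)) *
          Complex.exp (-δ * (r * (1 + Complex.I)))‖ ≤ C := by
        intro r hr
        have := hray r hr
        have e : (r : ℂ) * (1 + Complex.I) = conj ((r : ℂ) * (1 - Complex.I)) := by simp
        rw [norm_mul, hn] at this ⊢
        rw [e, reversedLaplace_conj, Complex.norm_conj, Complex.conj_re]
        exact this
      -- The substitution κ = (1 - i)ζ carries the first quadrant to the sector between the two
      -- rays.
      have hreal : ∀ x : ℝ, 0 ≤ x →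
          ‖reversedLaplace f c x * Complex.exp (-δ * x)‖ ≤ C := by
        intro x hx
        have := PhragmenLindelof.quadrant_I (f := fun ζ => reversedLaplace f c ((1 - Complex.I) * ζ) *
          Complex.exp (-δ * ((1 - Complex.I) * ζ))) (C := C) (z := x * ((1 + Complex.I) / 2))
          (hdiff.comp (by fun_prop : Differentiable ℂ fun ζ : ℂ => (1 - Complex.I) * ζ)).diffContOnCl
          (isBigO_of_norm_le_exp (A := B) (K := (2 * c + δ) * ‖1 - Complex.I‖) fun w => by
            have := norm_reversedLaplace_mul_exp_le hf hδ.le ((1 - Complex.I) * w)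
            rwa [norm_mul (1 - Complex.I) w, ← mul_assoc (2 * c + δ)] at this)
          (fun r hr => by
            have := hray r hr
            rwa [mul_comm (r : ℂ)] at this)
          (fun r hr => by
            have := hray' r hr
            have e : (r : ℂ) * (1 + Complex.I) = (1 - Complex.I) * (r * Complex.I) := by
              linear_combination (r : ℂ) * Complex.I_sq
            rwa [e] at this)
          (by simp; positivity) (by simp; positivity)
        have e : (1 - Complex.I) * (x * ((1 + Complex.I) / 2)) = x := by
          linear_combination (-x / 2 : ℂ) * Complex.I_sq
        simp only [e] at this
        exact this
      refine PhragmenLindelof.right_half_plane_of_bounded_on_real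
        (f := fun κ => reversedLaplace f c κ * Complex.exp (-δ * κ))
        hdiff.diffContOnCl (isBigO_of_norm_le_exp fun w =>
          norm_reversedLaplace_mul_exp_le hf hδ.le w) ?_ ?_ hκ
      · exact ⟨C, (eventually_ge_atTop 0).mono fun x hx => hreal x hx⟩
      · intro y
        rw [norm_mul, hn]
        have := norm_reversedLaplace_le hf (κ := y * Complex.I) (K := 0) (by simp) le_rfl
        simpa using this
    have hlim : Tendsto (fun δ : ℝ => ‖reversedLaplace f c κ * Complex.exp (-δ * κ)‖) (𝓝[>] 0)
        (𝓝 ‖reversedLaplace f c κ * Complex.exp (-(0 : ℝ) * κ)‖) :=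
      Tendsto.mono_left (Continuous.tendsto (by fun_prop) 0) nhdsWithin_le_nhds
    have := le_of_tendsto hlim (by
      filter_upwards [self_mem_nhdsWithin] with δ hδ using key δ hδ)
    simpa using this
  have hbd : ∀ κ : ℂ, ‖reversedLaplace f c κ‖ ≤ B := by
    intro κ
    rcases le_total 0 κ.re with hκ | hκ
    · exact hright κ hκ
    · simpa using norm_reversedLaplace_le hf hκ le_rfl
  -- Boundedness in the left half-plane is immediate, so Liouville applies; the constant is 0
  -- because e^{2(c-α)κ} decays as κ → -∞ when α < c.
  have hconst : ∀ w, reversedLaplace f c w = reversedLaplace f c κ := fun w =>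
    hd.apply_eq_apply_of_bounded (isBounded_iff_forall_norm_le.2 ⟨B, by
      rintro _ ⟨w, rfl⟩; exact hbd w⟩) w κ
  have hlim : Tendsto (fun n : ℕ => reversedLaplace f c (-(n : ℂ))) atTop (𝓝 0) := by
    have h0 : (0 : ℂ) = ∫ α in Ioo 0 c, (0 : ℂ) := by simp
    rw [h0]
    refine tendsto_integral_of_dominated_convergence (fun α => |f α| * Real.exp (2 * c * 0))
      (fun n => aestronglyMeasurable_reversed hf _) (hf.abs.mul_const _) (fun n => ?_) ?_
    · filter_upwards [ae_restrict_mem measurableSet_Ioo] with α hα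
        using norm_reversed_le (by simp) le_rfl hα
    · filter_upwards [ae_restrict_mem measurableSet_Ioo] with α hα
      rw [tendsto_zero_iff_norm_tendsto_zero]
      simp_rw [norm_mul, norm_cexp_reversed]
      have h1 : Tendsto (fun n : ℕ => 2 * (c - α) * (n : ℝ)) atTop atTop :=
        tendsto_natCast_atTop_atTop.const_mul_atTop (by linarith [hα.2])
      have h2 := (Real.tendsto_exp_neg_atTop_nhds_zero.comp h1).const_mul ‖(f α : ℂ)‖
      simpa using h2
  exact tendsto_nhds_unique (tendsto_const_nhds (x := reversedLaplace f c κ))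
    (hlim.congr fun n => hconst _)

/-- The positive and the negative part of f are densities of finite measures with the same
characteristic function, so the measures coincide; where the two parts agree, f is zero. -/
theorem ae_eq_zero_of_fourier (hf : IntegrableOn f (Ioo 0 c))
    (h : ∀ t : ℝ, ∫ α in Ioo 0 c, (f α : ℂ) * Complex.exp (t * α * Complex.I) = 0) :
    ∀ᵐ α ∂volume.restrict (Ioo 0 c), f α = 0 := by
  set μ := volume.restrict (Ioo 0 c)
  have hfm : AEMeasurable f μ := hf.aestronglyMeasurable.aemeasurable
  have hfn : AEMeasurable (fun α => -f α) μ := hfm.neg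
  have fin1 : ∫⁻ α, ENNReal.ofReal (f α) ∂μ ≠ ∞ := hf.lintegral_lt_top.ne
  have fin2 : ∫⁻ α, ENNReal.ofReal (-f α) ∂μ ≠ ∞ := (Integrable.neg hf).lintegral_lt_top.ne
  have i1 : IsFiniteMeasure (μ.withDensity fun α => ENNReal.ofReal (f α)) :=
    isFiniteMeasure_withDensity fin1
  have i2 : IsFiniteMeasure (μ.withDensity fun α => ENNReal.ofReal (-f α)) :=
    isFiniteMeasure_withDensity fin2
  have key : (μ.withDensity fun α => ENNReal.ofReal (f α)) =
      μ.withDensity fun α => ENNReal.ofReal (-f α) := by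
    refine Measure.ext_of_charFun ?_
    ext t
    have hsm : ∀ {g : ℝ → ℝ}, AEMeasurable g μ → AEStronglyMeasurable
        (fun α : ℝ => g α • Complex.exp (t * α * Complex.I)) μ := fun hg =>
      hg.aestronglyMeasurable.smul (by fun_prop : Continuous fun α : ℝ =>
        Complex.exp (t * α * Complex.I)).aestronglyMeasurable
    rw [charFun_apply_real, charFun_apply_real,
      integral_withDensity_eq_integral_toReal_smul₀ hfm.ennreal_ofReal (by simp),
      integral_withDensity_eq_integral_toReal_smul₀ hfn.ennreal_ofReal (by simp),
      ← sub_eq_zero, ← integral_sub]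
    · rw [← h t]
      refine integral_congr_ae (ae_of_all _ fun α => ?_)
      simp only [Complex.real_smul, ← sub_mul]
      congr 1
      rw [← Complex.ofReal_sub]
      congr 1
      rcases le_total 0 (f α) with h | h
      · rw [ENNReal.toReal_ofReal h, ENNReal.ofReal_of_nonpos (by linarith)]; simp
      · rw [ENNReal.toReal_ofReal (by linarith : 0 ≤ -f α), ENNReal.ofReal_of_nonpos h]; simp
    all_goals
      refine Integrable.mono hf ?_ (ae_of_all _ fun α => ?_)
      · first
          | exact hsm hfm.ennreal_ofReal.ennreal_toReal
          | exact hsm hfn.ennreal_ofReal.ennreal_toReal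
      · rw [norm_smul, ← Complex.ofReal_mul, Complex.norm_exp_ofReal_mul_I, mul_one,
          Real.norm_eq_abs, Real.norm_eq_abs, ENNReal.toReal_ofReal', abs_of_nonneg (by simp)]
        simp [le_abs_self, neg_le_abs]
  have := (withDensity_eq_iff hfm.ennreal_ofReal hfn.ennreal_ofReal fin1).1 key
  filter_upwards [this] with α hα
  rcases le_total 0 (f α) with h | h
  · rw [ENNReal.ofReal_of_nonpos (by linarith : -f α ≤ 0), ENNReal.ofReal_eq_zero] at hα
    exact le_antisymm hα h
  · rw [ENNReal.ofReal_of_nonpos h, eq_comm, ENNReal.ofReal_eq_zero] at hα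
    linarith

/-- Uniqueness: if the truncated Laplace transform of `f` on `(0, c)` is, along one ray, smaller
than `e^{-2(c-δ)κ}` for all `δ > 0`, then `f` vanishes. -/
theorem ae_eq_zero_of_laplace_small (hf : IntegrableOn f (Ioo 0 c))
    (h : ∀ δ : ℝ, 0 < δ → ∃ C R : ℝ, ∀ r : ℝ, R ≤ r →
      ‖∫ α in Ioo 0 c, (f α : ℂ) * Complex.exp (-2 * (α : ℂ) * (r * (1 - Complex.I)))‖ *
        Real.exp (2 * c * r) ≤ C * Real.exp (δ * r)) :
    ∀ᵐ α ∂volume.restrict (Ioo 0 c), f α = 0 := by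
  refine ae_eq_zero_of_fourier hf fun t => ?_
  -- At κ = -it/2 the kernel e^{-2ακ} is the Fourier character e^{itα}.
  have h0 := reversedLaplace_eq_zero hf (fun δ hδ => ?_) (-(t * Complex.I / 2))
  · rw [reversedLaplace_eq, mul_eq_zero] at h0
    have h1 := h0.resolve_left (Complex.exp_ne_zero _)
    rw [← h1]
    refine integral_congr_ae (ae_of_all _ fun α => ?_)
    simp only
    congr 2
    ring
  · obtain ⟨C, R, hC⟩ := h δ hδ
    set B := ∫ α in Ioo 0 c, |f α|
    have hB0 : 0 ≤ B := integral_nonneg fun _ => abs_nonneg _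
    refine ⟨max C (B * Real.exp (2 * c * R)), fun r hr => ?_⟩
    rcases le_total R r with hRr | hRr
    · rw [reversedLaplace_eq, norm_mul, mul_comm]
      have e : ‖Complex.exp (2 * c * (r * (1 - Complex.I)))‖ = Real.exp (2 * c * r) := by
        rw [Complex.norm_exp]; congr 1; simp
      rw [e]
      refine (hC r hRr).trans ?_
      gcongr
      exact le_max_left _ _
    · have h1 := norm_reversedLaplace_le hf (κ := r * (1 - Complex.I)) (K := R) (by simpa using hRr)
        (hr.trans hRr)
      have h2 : 1 ≤ Real.exp (δ * r) := Real.one_le_exp (by positivity)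
      calc _ ≤ _ := h1
        _ ≤ max C (B * Real.exp (2 * c * R)) := le_max_right _ _
        _ ≤ _ := le_mul_of_one_le_right ((by positivity : 0 ≤ B * Real.exp (2 * c * R)).trans
            (le_max_right _ _)) h2

end

/-! ### Existence for the initial value problem -/

section

variable {D : Set ℝ} {q : ℝ → ℝ} {z : ℂ} {u du : ℝ → ℂ}

theorem HasPrim.pow {f f' : ℝ → ℂ} {a b : ℝ} (h : HasPrim f f' a b) (n : ℕ) :
    HasPrim (fun x => f x ^ (n + 1)) (fun x => (n + 1) * (f x ^ n * f' x)) a b := by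
  induction n with
  | zero => simpa using h
  | succ n ih =>
    refine ((ih.mul h).congr_left fun x _ => (pow_succ _ _).symm).congr_right
      (ae_of_all _ fun x => ?_)
    push_cast
    ring

/-- With Φ the primitive of φ, the integrand is the derivative of Φ^(n+1)/(n+1)! almost everywhere.
This produces the factorials in the Picard bound when φ is merely integrable. -/
theorem integral_primitive_pow {φ : ℝ → ℝ} {x : ℝ} (hx : 0 ≤ x)
    (hφ : IntervalIntegrable φ volume 0 x) (n : ℕ) :
    ∫ t in (0 : ℝ)..x, φ t * ((∫ s in (0 : ℝ)..t, φ s) ^ n / n.factorial) =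
      (∫ s in (0 : ℝ)..x, φ s) ^ (n + 1) / (n + 1).factorial := by
  have h1 : HasPrim (fun t => ∫ s in (0 : ℝ)..t, (φ s : ℂ)) (fun s => (φ s : ℂ)) 0 x :=
    HasPrim.of_integral hx ⟨hφ.1.ofReal, hφ.2.ofReal⟩
  have h2 := (h1.pow n).integral_eq
  simp only [intervalIntegral.integral_ofReal, intervalIntegral.integral_same,
    intervalIntegral.integral_const_mul] at h2
  apply Complex.ofReal_injective
  rw [← intervalIntegral.integral_ofReal]
  have h3 : ((n + 1 : ℂ)) ≠ 0 := by exact_mod_cast Nat.succ_ne_zero n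
  have h4 : ((n.factorial : ℂ)) ≠ 0 := by exact_mod_cast n.factorial_ne_zero
  simp only [Nat.factorial_succ]
  push_cast
  rw [eq_div_iff (mul_ne_zero h3 h4)]
  calc _ = (n + 1) * ∫ t in (0 : ℝ)..x, ((∫ s in (0 : ℝ)..t, φ s : ℝ) : ℂ) ^ n * (φ t : ℂ) := by
        rw [mul_comm, mul_assoc, ← intervalIntegral.integral_const_mul]
        congr 1
        refine intervalIntegral.integral_congr fun t _ => ?_
        field_simp
    _ = _ := by rw [h2]; simp

/-- The Picard iterates for the system `u' = du`, `du' = (q - z) u`. -/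
def picard (q : ℝ → ℝ) (z α β : ℂ) : ℕ → (ℝ → ℂ) × (ℝ → ℂ)
  | 0 => (fun _ => α, fun _ => β)
  | n + 1 => (fun x => ∫ t in (0 : ℝ)..x, (picard q z α β n).2 t,
      fun x => ∫ t in (0 : ℝ)..x, ((q t : ℂ) - z) * (picard q z α β n).1 t)

/-- The majorant `1 + |q| + |z|` of the coefficients of the system. -/
def coeffBound (q : ℝ → ℝ) (z : ℂ) (t : ℝ) : ℝ := 1 + |q t| + ‖z‖

theorem one_le_coeffBound (q : ℝ → ℝ) (z : ℂ) (t : ℝ) : 1 ≤ coeffBound q z t := by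
  unfold coeffBound; linarith [abs_nonneg (q t), norm_nonneg z]

theorem norm_sub_le_coeffBound (q : ℝ → ℝ) (z : ℂ) (t : ℝ) : ‖(q t : ℂ) - z‖ ≤ coeffBound q z t := by
  refine (norm_sub_le _ _).trans ?_
  rw [Complex.norm_real, Real.norm_eq_abs]
  unfold coeffBound; linarith

theorem intervalIntegrable_of_integrableOn_Ioo {x : ℝ} (hx : 0 ≤ x) (h : IntegrableOn q (Ioo 0 x)) :
    IntervalIntegrable q volume 0 x :=
  (intervalIntegrable_iff_integrableOn_Ioo_of_le hx).2 h

theorem intervalIntegrable_coeffBound {x : ℝ} (h : IntervalIntegrable q volume 0 x) (z : ℂ) :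
    IntervalIntegrable (coeffBound q z) volume 0 x :=
  (intervalIntegrable_const.add h.abs).add intervalIntegrable_const

theorem intervalIntegrable_coeff {x : ℝ} (h : IntervalIntegrable q volume 0 x) (z : ℂ) :
    IntervalIntegrable (fun t => (q t : ℂ) - z) volume 0 x :=
  IntervalIntegrable.sub ⟨h.1.ofReal, h.2.ofReal⟩ intervalIntegrable_const

theorem continuousOn_picard {R : ℝ} (hR : 0 ≤ R) (hq : IntervalIntegrable q volume 0 R) (α β : ℂ)
    (n : ℕ) : ContinuousOn (picard q z α β n).1 (Icc 0 R) ∧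
      ContinuousOn (picard q z α β n).2 (Icc 0 R) := by
  induction n with
  | zero => exact ⟨continuousOn_const, continuousOn_const⟩
  | succ n ih =>
    rw [← uIcc_of_le hR] at ih
    exact ⟨(HasPrim.of_integral hR ih.2.intervalIntegrable).continuousOn,
      (HasPrim.of_integral hR
        ((intervalIntegrable_coeff hq z).mul_continuousOn ih.1)).continuousOn⟩

/-- The functions of `picard` are the terms of a series whose sum is the solution. Estimating u and
u' together allows a single majorant of the coefficients to be iterated. -/
theorem norm_picard_le {R : ℝ} (hR : 0 ≤ R) (hq : IntervalIntegrable q volume 0 R) (α β : ℂ)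
    (n : ℕ) {x : ℝ} (hx : x ∈ Icc 0 R) :
    ‖(picard q z α β n).1 x‖ + ‖(picard q z α β n).2 x‖ ≤
      (‖α‖ + ‖β‖) * ((∫ t in (0 : ℝ)..x, coeffBound q z t) ^ n / n.factorial) := by
  induction n generalizing x with
  | zero => simp [picard]
  | succ n ih =>
    have hsub : uIcc 0 x ⊆ Icc 0 R := by rw [uIcc_of_le hx.1]; exact Icc_subset_Icc_right hx.2
    have hqx : IntervalIntegrable q volume 0 x :=
      hq.mono_set (hsub.trans (by rw [uIcc_of_le hR]))
    obtain ⟨c1, c2⟩ := continuousOn_picard (z := z) hR hq α β n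
    have i2 : IntervalIntegrable (picard q z α β n).2 volume 0 x := (c2.mono hsub).intervalIntegrable
    have i1 := (intervalIntegrable_coeff hqx z).mul_continuousOn (c1.mono hsub)
    have hpc : ContinuousOn (fun t => ∫ s in (0 : ℝ)..t, coeffBound q z s) (uIcc 0 x) :=
      intervalIntegral.continuousOn_primitive_interval'
        (intervalIntegrable_coeffBound hqx z) (by simp)
    calc _ ≤ (∫ t in (0 : ℝ)..x, ‖(picard q z α β n).2 t‖) +
          ∫ t in (0 : ℝ)..x, ‖((q t : ℂ) - z) * (picard q z α β n).1 t‖ := by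
          exact add_le_add (intervalIntegral.norm_integral_le_integral_norm hx.1)
            (intervalIntegral.norm_integral_le_integral_norm hx.1)
      _ = ∫ t in (0 : ℝ)..x, (‖(picard q z α β n).2 t‖ +
          ‖((q t : ℂ) - z) * (picard q z α β n).1 t‖) :=
          (intervalIntegral.integral_add i2.norm i1.norm).symm
      _ ≤ ∫ t in (0 : ℝ)..x, (‖α‖ + ‖β‖) * (coeffBound q z t *
          ((∫ s in (0 : ℝ)..t, coeffBound q z s) ^ n / n.factorial)) := by
          refine intervalIntegral.integral_mono_on hx.1 (i2.norm.add i1.norm) ?_ fun t ht => ?_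
          · exact ((intervalIntegrable_coeffBound hqx z).mul_continuousOn
              ((hpc.pow n).div_const _)).const_mul _
          · have h1 := ih (x := t) ⟨ht.1, ht.2.trans hx.2⟩
            have h2 := one_le_coeffBound q z t
            have h3 := norm_sub_le_coeffBound q z t
            have h4 : 0 ≤ coeffBound q z t := zero_le_one.trans h2
            calc _ ≤ coeffBound q z t * ‖(picard q z α β n).2 t‖ +
                  coeffBound q z t * ‖(picard q z α β n).1 t‖ := by
                  rw [norm_mul]
                  exact add_le_add (le_mul_of_one_le_left (norm_nonneg _) h2) (by gcongr)
              _ = coeffBound q z t *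
                  (‖(picard q z α β n).1 t‖ + ‖(picard q z α β n).2 t‖) := by ring
              _ ≤ coeffBound q z t * ((‖α‖ + ‖β‖) *
                  ((∫ s in (0 : ℝ)..t, coeffBound q z s) ^ n / n.factorial)) := by gcongr
              _ = _ := by ring
      _ = _ := by
          rw [intervalIntegral.integral_const_mul,
            integral_primitive_pow hx.1 (intervalIntegrable_coeffBound hqx z)]

/-- Existence for the initial value problem at `0`. -/
theorem exists_isSolution (hq : ∀ a : ℝ, 0 < a → IntegrableOn q (Ioo 0 a)) (z α β : ℂ) :
    ∃ u du, IsSolution (Ici 0) q z u du ∧ u 0 = α ∧ du 0 = β := by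
  have hqi : ∀ R : ℝ, 0 ≤ R → IntervalIntegrable q volume 0 R := fun R hR => by
    rcases hR.eq_or_lt with rfl | h
    · simp
    · exact intervalIntegrable_of_integrableOn_Ioo hR (hq R h)
  set P := picard q z α β
  set Φ : ℝ → ℝ := fun R => ∫ t in (0 : ℝ)..R, coeffBound q z t
  have hΦ : ∀ x R, 0 ≤ x → x ≤ R → Φ x ≤ Φ R := fun x R hx hxR =>
    intervalIntegral.integral_mono_interval le_rfl hx hxR (ae_of_all _ fun t =>
      zero_le_one.trans (one_le_coeffBound q z t)) (intervalIntegrable_coeffBound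
        (hqi R (hx.trans hxR)) z)
  have hΦ0 : ∀ x, 0 ≤ x → 0 ≤ Φ x := fun x hx =>
    intervalIntegral.integral_nonneg hx fun t _ => zero_le_one.trans (one_le_coeffBound q z t)
  set K : ℝ → ℕ → ℝ := fun R n => (‖α‖ + ‖β‖) * (Φ R ^ n / n.factorial)
  have hK : ∀ R, Summable (K R) := fun R => (Real.summable_pow_div_factorial (Φ R)).mul_left _
  have hb : ∀ R, 0 ≤ R → ∀ n x, x ∈ Icc 0 R → ‖(P n).1 x‖ + ‖(P n).2 x‖ ≤ K R n := by
    intro R hR n x hx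
    refine (norm_picard_le hR (hqi R hR) α β n hx).trans ?_
    have := hΦ x R hx.1 hx.2
    have h0 := hΦ0 x hx.1
    change (‖α‖ + ‖β‖) * (Φ x ^ n / n.factorial) ≤ (‖α‖ + ‖β‖) * (Φ R ^ n / n.factorial)
    gcongr
  have hb1 : ∀ R, 0 ≤ R → ∀ n x, x ∈ Icc 0 R → ‖(P n).1 x‖ ≤ K R n := fun R hR n x hx =>
    (le_add_of_nonneg_right (norm_nonneg _)).trans (hb R hR n x hx)
  have hb2 : ∀ R, 0 ≤ R → ∀ n x, x ∈ Icc 0 R → ‖(P n).2 x‖ ≤ K R n := fun R hR n x hx =>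
    (le_add_of_nonneg_left (norm_nonneg _)).trans (hb R hR n x hx)
  have hs1 : ∀ x, 0 ≤ x → Summable fun n => (P n).1 x := fun x hx =>
    Summable.of_norm_bounded (hK x) fun n => hb1 x hx n x ⟨hx, le_rfl⟩
  have hs2 : ∀ x, 0 ≤ x → Summable fun n => (P n).2 x := fun x hx =>
    Summable.of_norm_bounded (hK x) fun n => hb2 x hx n x ⟨hx, le_rfl⟩
  have hc1 : ∀ R, 0 ≤ R → ∀ n, ContinuousOn (P n).1 (Icc 0 R) := fun R hR n =>
    (continuousOn_picard hR (hqi R hR) α β n).1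
  have hc2 : ∀ R, 0 ≤ R → ∀ n, ContinuousOn (P n).2 (Icc 0 R) := fun R hR n =>
    (continuousOn_picard hR (hqi R hR) α β n).2
  have hloc : ∀ {g : ℝ → ℂ}, (∀ R, 0 ≤ R → ContinuousOn g (Icc 0 R)) → ContinuousOn g (Ici 0) := by
    intro g hg x hx
    have hx0 : (0 : ℝ) ≤ x := hx
    refine (hg (x + 1) (by linarith) x ⟨hx, by linarith⟩).mono_of_mem_nhdsWithin ?_
    exact mem_nhdsWithin.2 ⟨Iio (x + 1), isOpen_Iio, by simp, fun y hy => ⟨hy.2, le_of_lt hy.1⟩⟩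
  have hcu : ContinuousOn (fun x => ∑' n, (P n).1 x) (Ici 0) := hloc fun R hR =>
    continuousOn_tsum (hc1 R hR) (hK R) (hb1 R hR)
  have hcdu : ContinuousOn (fun x => ∑' n, (P n).2 x) (Ici 0) := hloc fun R hR =>
    continuousOn_tsum (hc2 R hR) (hK R) (hb2 R hR)
  have hu0 : ∑' n, (P n).1 0 = α := by
    rw [(hs1 0 le_rfl).tsum_eq_zero_add]
    simp [P, picard]
  have hdu0 : ∑' n, (P n).2 0 = β := by
    rw [(hs2 0 le_rfl).tsum_eq_zero_add]
    simp [P, picard]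
  refine ⟨fun x => ∑' n, (P n).1 x, fun x => ∑' n, (P n).2 x, ⟨hcu, hcdu, ?_, ?_⟩, hu0, hdu0⟩
  · intro x hx
    simp only [hu0]
    rw [(hs1 x hx).tsum_eq_zero_add]
    have hsub : uIcc 0 x ⊆ Icc 0 x := by rw [uIcc_of_le hx]
    have := intervalIntegral.hasSum_integral_of_dominated_convergence (μ := volume) (a := 0) (b := x)
      (F := fun n => (P n).2) (f := fun t => ∑' n, (P n).2 t) (fun n _ => K x n)
      (fun n => ((hc2 x hx n).mono hsub).intervalIntegrable.aestronglyMeasurable_restrict_uIoc)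
      (fun n => ae_of_all _ fun t ht => hb2 x hx n t (hsub (uIoc_subset_uIcc ht)))
      (ae_of_all _ fun _ _ => hK x) intervalIntegrable_const
      (ae_of_all _ fun t ht => (hs2 t (hsub (uIoc_subset_uIcc ht)).1).hasSum)
    rw [← this.tsum_eq]
    rfl
  · intro x hx
    simp only [hdu0]
    rw [(hs2 x hx).tsum_eq_zero_add]
    have hsub : uIcc 0 x ⊆ Icc 0 x := by rw [uIcc_of_le hx]
    have hi := intervalIntegrable_coeff (hqi x hx) z
    have := intervalIntegral.hasSum_integral_of_dominated_convergence (μ := volume) (a := 0) (b := x)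
      (F := fun n t => ((q t : ℂ) - z) * (P n).1 t)
      (f := fun t => ((q t : ℂ) - z) * ∑' n, (P n).1 t) (fun n t => ‖(q t : ℂ) - z‖ * K x n)
      (fun n => (hi.mul_continuousOn
        ((hc1 x hx n).mono hsub)).aestronglyMeasurable_restrict_uIoc)
      (fun n => ae_of_all _ fun t ht => by
        rw [norm_mul]
        exact mul_le_mul_of_nonneg_left (hb1 x hx n t (hsub (uIoc_subset_uIcc ht))) (norm_nonneg _))
      (ae_of_all _ fun _ _ => (hK x).mul_left _)
      (by simp_rw [tsum_mul_left]; exact hi.norm.mul_const _)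
      (ae_of_all _ fun t ht => (hs1 t (hsub (uIoc_subset_uIcc ht)).1).hasSum.mul_left _)
    rw [← this.tsum_eq]
    rfl

end

/-! ### Wronskians, the flux, and regular endpoints -/

section

variable {D : Set ℝ} {q : ℝ → ℝ} {z z₁ z₂ : ℂ} {u du f df g dg : ℝ → ℂ}

theorem Icc_subset_dom {B : RightEnd} {c : ℝ} (hc : c ∈ B.dom) : Icc 0 c ⊆ B.dom := fun _ hx =>
  ⟨hx.1, lt_of_le_of_lt (EReal.coe_le_coe_iff.2 hx.2) hc.2⟩

theorem RightEnd.Admissible.integrableOn {B : RightEnd} (h : B.Admissible q) {c : ℝ}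
    (hc : c ∈ B.dom) : IntegrableOn q (Ioo 0 c) := by
  rcases hc.1.eq_or_lt with h0 | h0
  · simp [← h0]
  cases B with
  | robin b _ => exact h.2.mono_set (Ioo_subset_Ioo_right (EReal.coe_lt_coe_iff.1 hc.2).le)
  | dirichlet b => exact h.2.mono_set (Ioo_subset_Ioo_right (EReal.coe_lt_coe_iff.1 hc.2).le)
  | squareIntegrable => exact h.1 c h0
  | limitCircle _ _ => exact h.1 c h0

/-- The Wronskian `f g' - f' g`. -/
def wronskian (f df g dg : ℝ → ℂ) (x : ℝ) : ℂ := f x * dg x - df x * g x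

theorem hasPrim_wronskian (hf : IsSolution D q z₁ f df) (hg : IsSolution D q z₂ g dg) {c : ℝ}
    (hc : 0 ≤ c) (hD : Icc 0 c ⊆ D) (hq : IntegrableOn q (Ioo 0 c)) :
    HasPrim (wronskian f df g dg) (fun t => (z₁ - z₂) * (f t * g t)) 0 c := by
  refine (((hf.hasPrim hc hD).mul (hg.hasPrim_deriv hc hD hq)).sub
    ((hf.hasPrim_deriv hc hD hq).mul (hg.hasPrim hc hD))).congr_right (ae_of_all _ fun t => ?_)
  ring

theorem IsSolution.starRing (h : IsSolution D q z u du) :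
    IsSolution D q (conj z) (fun x => conj (u x)) (fun x => conj (du x)) := by
  refine ⟨Complex.continuous_conj.comp_continuousOn h.cont,
    Complex.continuous_conj.comp_continuousOn h.dcont, fun x hx => ?_, fun x hx => ?_⟩
  · rw [h.eq_u x hx, map_add, ← intervalIntegral.intervalIntegral_conj]
  · rw [h.eq_du x hx, map_add, ← intervalIntegral.intervalIntegral_conj]
    simp

/-- `Im (ū u')`, the imaginary part of the numerator of the Weyl–Titchmarsh function. -/
def flux (u du : ℝ → ℂ) (x : ℝ) : ℝ := (conj (u x) * du x).im

theorem wronskian_conj_self (x : ℝ) :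
    wronskian (fun x => conj (u x)) (fun x => conj (du x)) u du x =
      2 * flux u du x * Complex.I := by
  unfold wronskian flux
  apply Complex.ext <;> simp <;> ring

/-- The flux is, up to the factor 2i, the Wronskian of ū and u, and conj z - z = -2i Im z. For Im z
> 0 it therefore decreases: a flux negative at c stays below that value, and each endpoint condition
has to exclude this. -/
theorem flux_eq (h : IsSolution D q z u du) {x y : ℝ} (hx : 0 ≤ x) (hxy : x ≤ y)
    (hD : Icc 0 y ⊆ D) (hq : IntegrableOn q (Ioo 0 y)) :
    flux u du y = flux u du x - z.im * ∫ t in x..y, ‖u t‖ ^ 2 := by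
  have h1 := ((hasPrim_wronskian h.starRing h (hx.trans hxy) hD hq).mono hx hxy le_rfl).integral_eq
  rw [wronskian_conj_self, wronskian_conj_self] at h1
  have h2 : ∀ t, (conj z - z) * (conj (u t) * u t) =
      (((-2 * z.im) * ‖u t‖ ^ 2 : ℝ) : ℂ) * Complex.I := by
    intro t
    rw [Complex.conj_mul']
    apply Complex.ext <;> simp [Complex.mul_re, Complex.mul_im, ← Complex.ofReal_pow]
    ring
  simp_rw [h2] at h1
  rw [intervalIntegral.integral_mul_const, intervalIntegral.integral_ofReal,
    intervalIntegral.integral_const_mul] at h1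
  have h3 := congrArg Complex.im h1
  simp at h3
  linarith

theorem flux_antitone (h : IsSolution D q z u du) (hz : 0 < z.im) {x y : ℝ} (hx : 0 ≤ x)
    (hxy : x ≤ y) (hD : Icc 0 y ⊆ D) (hq : IntegrableOn q (Ioo 0 y)) :
    flux u du y ≤ flux u du x := by
  rw [flux_eq h hx hxy hD hq]
  have : 0 ≤ ∫ t in x..y, ‖u t‖ ^ 2 := intervalIntegral.integral_nonneg hxy fun t _ => by positivity
  nlinarith

theorem abs_flux_le (x : ℝ) : |flux u du x| ≤ ‖u x‖ * ‖du x‖ := by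
  refine (Complex.abs_im_le_norm _).trans ?_
  rw [norm_mul, Complex.norm_conj]

theorem IsSolution.hasDerivAt (h : IsSolution D q z u du) {x c : ℝ} (hx : 0 < x) (hxc : x < c)
    (hD : Icc 0 c ⊆ D) : HasDerivAt u (du x) x := by
  have hP := h.hasPrim (hx.trans hxc).le hD
  have hs : Icc 0 c ∈ 𝓝 x := Icc_mem_nhds hx hxc
  have h1 : HasDerivAt (fun y => ∫ t in (0 : ℝ)..y, du t) (du x) x :=
    intervalIntegral.integral_hasDerivAt_right (hP.integrable.mono_set
      (uIcc_subset_uIcc_left (by rw [uIcc_of_le hP.le]; exact ⟨hx.le, hxc.le⟩)))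
      ((h.dcont.mono hD).stronglyMeasurableAtFilter_nhdsWithin measurableSet_Icc x |>.filter_mono
        (by rw [nhdsWithin_eq_nhds.2 hs])) ((h.dcont.mono hD).continuousAt hs)
  refine (h1.const_add (u 0)).congr_of_eventuallyEq ?_
  filter_upwards [hs] with y hy using hP.eq y hy

/-- Since h is real, the flux equals Im(ū(u' + hu)). Near b one has |u'| ≤ |h||u| + 1, so Grönwall
bounds u, and the flux tends to 0; being decreasing, it was never negative. -/
theorem flux_nonneg_robin {b h : ℝ} (hq : IntegrableOn q (Ioo 0 b)) (hz : 0 < z.im)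
    (hu : IsSolution (RightEnd.robin b h).dom q z u du)
    (hb : (RightEnd.robin b h).Satisfies u du) {c : ℝ} (hc : c ∈ (RightEnd.robin b h).dom) :
    0 ≤ flux u du c := by
  by_contra! hneg
  have hdom : ∀ x, x ∈ (RightEnd.robin b h).dom ↔ 0 ≤ x ∧ x < b := fun x => by
    simp [RightEnd.dom, RightEnd.b]
  have hsub : ∀ y, y < b → Icc 0 y ⊆ (RightEnd.robin b h).dom := fun y hy x hx =>
    (hdom x).2 ⟨hx.1, hx.2.trans_lt hy⟩
  obtain ⟨hc0, hcb⟩ := (hdom c).1 hc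
  have hlow : ∀ x, c ≤ x → x < b → -flux u du c ≤ ‖u x‖ * ‖du x + h * u x‖ := by
    intro x hcx hxb
    have h1 := flux_antitone hu hz hc0 hcx (hsub x hxb) (hq.mono_set (Ioo_subset_Ioo_right hxb.le))
    have h2 : flux u du x = (conj (u x) * (du x + h * u x)).im := by
      rw [mul_add, Complex.add_im]
      have : (conj (u x) * (h * u x)).im = 0 := by
        rw [mul_left_comm, Complex.conj_mul', ← Complex.ofReal_pow, ← Complex.ofReal_mul,
          Complex.ofReal_im]
      rw [this, add_zero, flux]
    have h3 := Complex.abs_im_le_norm (conj (u x) * (du x + h * u x))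
    rw [← h2, norm_mul, Complex.norm_conj] at h3
    linarith [neg_abs_le (flux u du x)]
  have hlim : Tendsto (fun x => du x + (h : ℂ) * u x) (𝓝[<] b) (𝓝 0) := hb
  have hev : ∀ᶠ x in 𝓝[<] b, ‖du x + h * u x‖ < 1 := by
    have := hlim.norm
    rw [norm_zero] at this
    exact this.eventually (gt_mem_nhds one_pos)
  obtain ⟨l, hlb, hl⟩ := (mem_nhdsLT_iff_exists_Ioo_subset' hcb).1 hev
  obtain ⟨x₁, hx₁, hx₁b⟩ := exists_between (max_lt hcb hlb)
  have hcx₁ : c < x₁ := (le_max_left _ _).trans_lt hx₁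
  have hlx₁ : l < x₁ := (le_max_right _ _).trans_lt hx₁
  set K := gronwallBound ‖u x₁‖ |h| 1 (b - x₁)
  have hbd : ∀ y, x₁ ≤ y → y < b → ‖u y‖ ≤ K := by
    intro y hy hyb
    have := norm_le_gronwallBound_of_norm_deriv_right_le (f := u) (f' := du) (δ := ‖u x₁‖)
      (K := |h|) (ε := 1) (a := x₁) (b := y) (hu.cont.mono fun x hx =>
        hsub y hyb ⟨(hc0.trans hcx₁.le).trans hx.1, hx.2⟩)
      (fun x hx => (hu.hasDerivAt (c := (y + b) / 2) (by linarith [hx.1])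
        (by linarith [hx.2]) (hsub _ (by linarith))).hasDerivWithinAt) le_rfl
      (fun x hx => by
        have h1 : ‖du x + h * u x‖ < 1 := hl ⟨hlx₁.trans_le hx.1, hx.2.trans hyb⟩
        have h2 : du x = (du x + h * u x) - h * u x := by ring
        rw [h2]
        refine (norm_sub_le _ _).trans ?_
        rw [norm_mul, Complex.norm_real, Real.norm_eq_abs]
        linarith) y ⟨hy, le_rfl⟩
    exact this.trans (gronwallBound_mono (norm_nonneg _) zero_le_one (abs_nonneg _) (by linarith))
  have hlim2 : Tendsto (fun x => K * ‖du x + (h : ℂ) * u x‖) (𝓝[<] b) (𝓝 0) := by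
    simpa using hlim.norm.const_mul K
  have := ge_of_tendsto hlim2 (b := -flux u du c) (by
    filter_upwards [Ioo_mem_nhdsLT hx₁b] with x hx
    refine (hlow x (hcx₁.trans hx.1).le hx.2).trans ?_
    gcongr
    exact hbd x hx.1.le hx.2)
  linarith

/-- Near b the solution is bounded and q - z is integrable, so u' stays bounded. With u → 0 the flux
tends to 0. -/
theorem flux_nonneg_dirichlet {b : ℝ} (hq : IntegrableOn q (Ioo 0 b)) (hz : 0 < z.im)
    (hu : IsSolution (RightEnd.dirichlet b).dom q z u du)
    (hb : (RightEnd.dirichlet b).Satisfies u du) {c : ℝ} (hc : c ∈ (RightEnd.dirichlet b).dom) :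
    0 ≤ flux u du c := by
  by_contra! hneg
  have hdom : ∀ x, x ∈ (RightEnd.dirichlet b).dom ↔ 0 ≤ x ∧ x < b := fun x => by
    simp [RightEnd.dom, RightEnd.b]
  have hsub : ∀ y, y < b → Icc 0 y ⊆ (RightEnd.dirichlet b).dom := fun y hy x hx =>
    (hdom x).2 ⟨hx.1, hx.2.trans_lt hy⟩
  obtain ⟨hc0, hcb⟩ := (hdom c).1 hc
  have hlim : Tendsto u (𝓝[<] b) (𝓝 0) := hb
  have hev : ∀ᶠ x in 𝓝[<] b, ‖u x‖ < 1 := by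
    have := hlim.norm
    rw [norm_zero] at this
    exact this.eventually (gt_mem_nhds one_pos)
  obtain ⟨l, hlb, hl⟩ := (mem_nhdsLT_iff_exists_Ioo_subset' hcb).1 hev
  obtain ⟨x₁, hx₁, hx₁b⟩ := exists_between (max_lt hcb hlb)
  have hcx₁ : c < x₁ := (le_max_left _ _).trans_lt hx₁
  have hlx₁ : l < x₁ := (le_max_right _ _).trans_lt hx₁
  have hqb : IntervalIntegrable (coeffBound q z) volume 0 b :=
    intervalIntegrable_coeffBound (intervalIntegrable_of_integrableOn_Ioo (hc0.trans hcb.le) hq) z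
  have h0x₁ : 0 ≤ x₁ := hc0.trans hcx₁.le
  set K := ‖du x₁‖ + ∫ t in (0 : ℝ)..b, coeffBound q z t
  have hbd : ∀ y, x₁ ≤ y → y < b → ‖du y‖ ≤ K := by
    intro y hy hyb
    have hP := ((hu.hasPrim_deriv (h0x₁.trans hy) (hsub y hyb)
      (hq.mono_set (Ioo_subset_Ioo_right hyb.le))).mono h0x₁ hy le_rfl)
    rw [hP.eq y ⟨hy, le_rfl⟩]
    refine (norm_add_le _ _).trans (add_le_add_right ?_ _)
    have hi : IntervalIntegrable (coeffBound q z) volume x₁ y := hqb.mono_set (by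
      rw [uIcc_of_le hy, uIcc_of_le (hc0.trans hcb.le)]
      exact Icc_subset_Icc h0x₁ hyb.le)
    calc _ ≤ ∫ t in x₁..y, coeffBound q z t := by
          refine intervalIntegral.norm_integral_le_of_norm_le hy (ae_of_all _ fun t ht => ?_) hi
          rw [norm_mul]
          have h1 : ‖u t‖ < 1 := hl ⟨hlx₁.trans ht.1, ht.2.trans_lt hyb⟩
          calc _ ≤ coeffBound q z t * 1 :=
                mul_le_mul (norm_sub_le_coeffBound q z t) h1.le (norm_nonneg _)
                  (zero_le_one.trans (one_le_coeffBound q z t))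
            _ = _ := mul_one _
      _ ≤ _ := intervalIntegral.integral_mono_interval h0x₁ hy hyb.le
          (ae_of_all _ fun t => zero_le_one.trans (one_le_coeffBound q z t)) hqb
  have hlim2 : Tendsto (fun x => ‖u x‖ * K) (𝓝[<] b) (𝓝 0) := by
    simpa using hlim.norm.mul_const K
  have := ge_of_tendsto hlim2 (b := -flux u du c) (by
    filter_upwards [Ioo_mem_nhdsLT hx₁b] with x hx
    have h1 := flux_antitone hu hz hc0 (hcx₁.trans hx.1).le (hsub x hx.2)
      (hq.mono_set (Ioo_subset_Ioo_right hx.2.le))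
    have h2 := abs_flux_le (u := u) (du := du) x
    calc -flux u du c ≤ |flux u du x| := by linarith [neg_abs_le (flux u du x)]
      _ ≤ ‖u x‖ * ‖du x‖ := h2
      _ ≤ _ := by gcongr; exact hbd x hx.1.le hx.2)
  linarith

end

/-! ### The flux in the limit circle and limit point cases -/

section

variable {q : ℝ → ℝ} {z z₁ z₂ : ℂ} {u du f df g dg : ℝ → ℂ}

theorem Icc_zero_subset_Ici (c : ℝ) : Icc 0 c ⊆ Ici (0 : ℝ) := fun _ hx => hx.1

theorem integrableOn_Ioo_of_forall (hq : ∀ a : ℝ, 0 < a → IntegrableOn q (Ioo 0 a)) (a : ℝ) :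
    IntegrableOn q (Ioo 0 a) := by
  rcases lt_or_ge 0 a with h | h
  · exact hq a h
  · simp [Ioo_eq_empty_of_le h]

theorem L2AtInfinity.integrableOn (h : L2AtInfinity u) (hc : ContinuousOn u (Ici 0)) :
    IntegrableOn (fun x => ‖u x‖ ^ 2) (Ioi 0) := by
  obtain ⟨R, hR, hi⟩ := h
  rw [← Ioc_union_Ioi_eq_Ioi hR]
  refine IntegrableOn.union ?_ hi
  exact ((hc.mono (Icc_zero_subset_Ici R)).norm.pow 2).integrableOn_Icc.mono_set Ioc_subset_Icc_self

theorem intervalIntegral_le_of_integrableOn {F : ℝ → ℝ} (hF : IntegrableOn F (Ioi 0))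
    (h0 : ∀ x, 0 ≤ F x) {x y : ℝ} (hx : 0 ≤ x) (hxy : x ≤ y) :
    ∫ t in x..y, F t ≤ ∫ t in Ioi (0 : ℝ), F t := by
  rw [intervalIntegral.integral_of_le hxy]
  exact setIntegral_mono_set hF (ae_of_all _ h0)
    (Eventually.of_forall fun t ht => lt_of_le_of_lt hx ht.1)

/-- The derivative of the Wronskian is a multiple of fg, which is integrable when f and g are square
integrable. -/
theorem norm_wronskian_le (hq : ∀ a : ℝ, 0 < a → IntegrableOn q (Ioo 0 a))
    (hf : IsSolution (Ici 0) q z₁ f df) (hg : IsSolution (Ici 0) q z₂ g dg)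
    (hf2 : L2AtInfinity f) (hg2 : L2AtInfinity g) :
    ∃ C : ℝ, 0 ≤ C ∧ ∀ x : ℝ, 0 ≤ x → ‖wronskian f df g dg x‖ ≤ C := by
  have i1 := hf2.integrableOn hf.cont
  have i2 := hg2.integrableOn hg.cont
  refine ⟨‖wronskian f df g dg 0‖ + ‖z₁ - z₂‖ *
    ∫ t in Ioi (0 : ℝ), (‖f t‖ ^ 2 + ‖g t‖ ^ 2), ?_, fun x hx => ?_⟩
  · have : 0 ≤ ∫ t in Ioi (0 : ℝ), (‖f t‖ ^ 2 + ‖g t‖ ^ 2) :=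
      integral_nonneg fun t => by positivity
    positivity
  have hP := hasPrim_wronskian hf hg hx (Icc_zero_subset_Ici x) (integrableOn_Ioo_of_forall hq x)
  rw [hP.eq x ⟨hx, le_rfl⟩]
  refine (norm_add_le _ _).trans (add_le_add_right ?_ _)
  rw [intervalIntegral.integral_const_mul, norm_mul]
  gcongr
  refine le_trans ?_ (intervalIntegral_le_of_integrableOn (i1.add i2) (fun t => by
    simp only [Pi.add_apply]; positivity) le_rfl hx)
  refine intervalIntegral.norm_integral_le_of_norm_le hx (ae_of_all _ fun t _ => ?_) ?_
  · rw [norm_mul]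
    simp only [Pi.add_apply]
    nlinarith [sq_nonneg (‖f t‖ - ‖g t‖), sq_nonneg (‖f t‖ + ‖g t‖)]
  · exact (intervalIntegrable_iff_integrableOn_Ioc_of_le hx).2
      ((i1.add i2).mono_set Ioc_subset_Ioi_self)

theorem flux_le_of_le (hq : ∀ a : ℝ, 0 < a → IntegrableOn q (Ioo 0 a))
    (hz : 0 < z.im) (hu : IsSolution (Ici 0) q z u du) {c x : ℝ} (hc : 0 ≤ c) (hcx : c ≤ x) :
    flux u du x ≤ flux u du c :=
  flux_antitone hu hz hc hcx (Icc_zero_subset_Ici x) (integrableOn_Ioo_of_forall hq x)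

/-- All solutions are square integrable, so their Wronskians are bounded. Two Plücker identities
among u₀, u, their conjugates and a second solution y at z = i then transfer the two limits at
infinity to the Wronskian of ū and u, which is the flux. -/
theorem flux_nonneg_limitCircle {u₀ du₀ : ℝ → ℂ}
    (hq : ∀ a : ℝ, 0 < a → IntegrableOn q (Ioo 0 a)) (hlc : LimitCircle q)
    (hu₀ : IsNonzeroSolution (Ici 0) q Complex.I u₀ du₀)
    (hsa : Tendsto (fun x => u₀ x * conj (du₀ x) - du₀ x * conj (u₀ x)) atTop (𝓝 0))
    (hz : 0 < z.im) (hu : IsSolution (Ici 0) q z u du)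
    (hb : Tendsto (fun x => u₀ x * du x - du₀ x * u x) atTop (𝓝 0)) {c : ℝ} (hc : 0 ≤ c) :
    0 ≤ flux u du c := by
  by_contra! hneg
  have hsa' : Tendsto (flux u₀ du₀) atTop (𝓝 0) := by
    have h1 := (Complex.continuous_im.tendsto _).comp hsa
    have h2 := h1.const_mul (-1 / 2)
    simp only [Complex.zero_im, mul_zero] at h2
    refine h2.congr fun x => ?_
    simp [flux]; ring
  -- If u₀(0) = 0, the flux of u₀ starts at 0 and becomes negative once u₀ has been nonzero; by
  -- monotonicity it cannot return to the limit 0 required by self-adjointness.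
  have h00 : u₀ 0 ≠ 0 := by
    intro h0
    obtain ⟨x, hx, hux⟩ := hu₀.2
    have hx' : (0 : ℝ) ≤ x := hx
    have hcont : ∀ y : ℝ, 0 ≤ y → ContinuousOn (fun t => ‖u₀ t‖ ^ 2) (Icc 0 y) := fun y _ =>
      ((hu₀.1.cont.mono (Icc_zero_subset_Ici y)).norm.pow 2)
    have hlt : flux u₀ du₀ (x + 1) < 0 := by
      rw [flux_eq hu₀.1 le_rfl (by linarith : 0 ≤ x + 1) (Icc_zero_subset_Ici _)
        (integrableOn_Ioo_of_forall hq _)]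
      have : 0 < ∫ t in (0 : ℝ)..(x + 1), ‖u₀ t‖ ^ 2 :=
        intervalIntegral.integral_pos (by linarith) (hcont _ (by linarith))
          (fun t _ => by positivity) ⟨x, ⟨hx, by linarith⟩, by positivity⟩
      have h1 : flux u₀ du₀ 0 = 0 := by simp [flux, h0]
      rw [h1]; simp; exact this
    have := le_of_tendsto hsa' ((eventually_ge_atTop (x + 1)).mono fun y hy =>
      flux_le_of_le hq (by simp) hu₀.1 (by linarith : 0 ≤ x + 1) hy)
    linarith
  obtain ⟨y, dy, hy, hy0, hdy0⟩ := exists_isSolution hq Complex.I 0 1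
  have hw : ∀ x : ℝ, 0 ≤ x → wronskian u₀ du₀ y dy x = u₀ 0 := by
    intro x hx
    have hP := hasPrim_wronskian hu₀.1 hy hx (Icc_zero_subset_Ici x)
      (integrableOn_Ioo_of_forall hq x)
    rw [hP.eq_of_zero (fun t _ => by simp) ⟨hx, le_rfl⟩]
    simp [wronskian, hy0, hdy0]
  have hI : 0 < Complex.I.im := by simp
  have hy2 := hlc _ hI y dy hy
  have hu2 := hlc _ hz u du hu
  have hub2 : L2AtInfinity fun x => conj (u x) := by
    simpa only [L2AtInfinity, Complex.norm_conj] using hu2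
  obtain ⟨C₁, hC₁, h1⟩ := norm_wronskian_le hq hy hu hy2 hu2
  obtain ⟨C₂, hC₂, h2⟩ := norm_wronskian_le hq hy hu.starRing hy2 hub2
  obtain ⟨C₃, hC₃, h3⟩ := norm_wronskian_le hq hu.starRing hu hub2 hu2
  set a : ℝ → ℂ := fun x => u₀ x * du x - du₀ x * u x
  set b : ℝ → ℂ := fun x => u₀ x * conj (du x) - du₀ x * conj (u x)
  set e : ℝ → ℂ := fun x => u₀ x * conj (du₀ x) - du₀ x * conj (u₀ x)
  -- First Plücker identity: b differs from a only through e = W(u₀, ū₀), which tends to 0, times a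
  -- bounded Wronskian. Hence b → 0 as well.
  have hbsq : ∀ x : ℝ, 0 ≤ x → ‖b x‖ ^ 2 ≤ ‖a x‖ ^ 2 + ‖e x‖ * C₃ := by
    intro x hx
    have key : b x * conj (b x) = a x * conj (a x) +
        e x * wronskian (fun x => conj (u x)) (fun x => conj (du x)) u du x := by
      simp only [a, b, e, wronskian, map_sub, map_mul, Complex.conj_conj]
      ring
    have h4 : ‖b x * conj (b x)‖ = ‖b x‖ ^ 2 := by rw [norm_mul, Complex.norm_conj, sq]
    have h5 : ‖a x * conj (a x)‖ = ‖a x‖ ^ 2 := by rw [norm_mul, Complex.norm_conj, sq]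
    rw [← h4, ← h5, key]
    refine (norm_add_le _ _).trans (add_le_add_right ?_ _)
    rw [norm_mul]
    exact mul_le_mul_of_nonneg_left (h3 x hx) (norm_nonneg _)
  have hbt : Tendsto (fun x => ‖b x‖) atTop (𝓝 0) := by
    have h6 : Tendsto (fun x => ‖a x‖ ^ 2 + ‖e x‖ * C₃) atTop (𝓝 0) := by
      simpa using (hb.norm.pow 2).add (hsa.norm.mul_const C₃)
    have h7 : Tendsto (fun x => ‖b x‖ ^ 2) atTop (𝓝 0) :=
      squeeze_zero' (Eventually.of_forall fun x => by positivity)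
        ((eventually_ge_atTop 0).mono hbsq) h6
    have h8 := (Real.continuous_sqrt.tendsto _).comp h7
    simpa [Function.comp_def, Real.sqrt_sq (norm_nonneg _)] using h8
  -- Second Plücker identity. It bounds the flux because W(u₀, y) is the nonzero constant u₀(0),
  -- while a and b on the right tend to 0.
  have hlow : ∀ x : ℝ, c ≤ x → ‖u₀ 0‖ * (2 * -flux u du c) ≤ ‖a x‖ * C₂ + ‖b x‖ * C₁ := by
    intro x hx
    have hx0 : 0 ≤ x := hc.trans hx
    have key : wronskian u₀ du₀ y dy x *
        wronskian (fun x => conj (u x)) (fun x => conj (du x)) u du x =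
        b x * wronskian y dy u du x -
          a x * wronskian y dy (fun x => conj (u x)) (fun x => conj (du x)) x := by
      simp only [a, b, wronskian]
      ring
    have h4 := congrArg norm key
    rw [hw x hx0, wronskian_conj_self, norm_mul, norm_mul, norm_mul, Complex.norm_I, mul_one,
      Complex.norm_real, Complex.norm_ofNat, Real.norm_eq_abs] at h4
    have h5 := flux_le_of_le hq hz hu hc hx
    have h6 : -flux u du c ≤ |flux u du x| := by linarith [neg_abs_le (flux u du x)]
    calc _ ≤ ‖u₀ 0‖ * (2 * |flux u du x|) := by gcongr
      _ ≤ _ := by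
        rw [h4]
        refine (norm_sub_le _ _).trans ?_
        rw [norm_mul, norm_mul, add_comm]
        exact add_le_add (mul_le_mul_of_nonneg_left (h2 x hx0) (norm_nonneg _))
          (mul_le_mul_of_nonneg_left (h1 x hx0) (norm_nonneg _))
  have hlim : Tendsto (fun x => ‖a x‖ * C₂ + ‖b x‖ * C₁) atTop (𝓝 0) := by
    simpa using (hb.norm.mul_const C₂).add (hbt.mul_const C₁)
  have := ge_of_tendsto hlim ((eventually_ge_atTop c).mono hlow)
  have h9 : 0 < ‖u₀ 0‖ * (2 * -flux u du c) := by
    have := norm_pos_iff.2 h00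
    have : 0 < -flux u du c := by linarith
    positivity
  linarith

/-- A Weyl disc argument. If the flux of u were negative at c, then the second solution y, with y(0)
= 0, would be square integrable: for each x a suitable y + ku vanishes at x, and the flux identity
on [c, x] bounds k and the norm of y + ku uniformly in x. The limit point property then makes y a
multiple of u, contradicting u(0) ≠ 0. -/
theorem flux_nonneg_limitPoint (hq : ∀ a : ℝ, 0 < a → IntegrableOn q (Ioo 0 a))
    (hlp : LimitPoint q) (hz : 0 < z.im) (hu : IsSolution (Ici 0) q z u du)
    (hu2 : L2AtInfinity u) (hu0 : u 0 ≠ 0) {c : ℝ} (hc : 0 ≤ c) : 0 ≤ flux u du c := by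
  by_contra! hneg
  obtain ⟨y, dy, hy, hy0, hdy0⟩ := exists_isSolution hq z 0 1
  have hyne : ∃ x ∈ Ici (0 : ℝ), y x ≠ 0 := by
    by_contra! hcon
    have h1 : ∀ x : ℝ, 0 < x → dy x = 0 := by
      intro x hx
      have h2 := hy.hasDerivAt hx (lt_add_one x) (Icc_zero_subset_Ici _)
      refine h2.unique ((hasDerivAt_const x (0 : ℂ)).congr_of_eventuallyEq ?_)
      filter_upwards [lt_mem_nhds hx] with t ht using hcon t ht.le
    have h3 : Tendsto dy (𝓝[>] 0) (𝓝 (dy 0)) :=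
      (hy.dcont 0 self_mem_Ici).mono_left (nhdsWithin_mono _ Ioi_subset_Ici_self)
    have h4 : Tendsto dy (𝓝[>] 0) (𝓝 0) :=
      tendsto_const_nhds.congr' (by
        filter_upwards [self_mem_nhdsWithin] with t ht using (h1 t ht).symm)
    have := tendsto_nhds_unique h3 h4
    rw [hdy0] at this
    exact one_ne_zero this
  have hiu := hu2.integrableOn hu.cont
  set η := -flux u du c
  have hη : 0 < η := by simp only [η]; linarith
  have hune : ∀ x, c ≤ x → u x ≠ 0 := by
    intro x hx h0
    have := flux_le_of_le hq hz hu hc hx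
    have h1 : flux u du x = 0 := by simp [flux, h0]
    linarith
  set Y := |flux y dy c|
  set K := ‖y c‖ * ‖du c‖ + ‖u c‖ * ‖dy c‖
  -- Chosen so that Y + K|k| - η|k|² < 0 whenever |k| > M; this quantity is bounded below by Im z
  -- times an integral of a square.
  set M := (K + Y + 1) / η + 1
  have hK : 0 ≤ K := by positivity
  have hY : 0 ≤ Y := abs_nonneg _
  have hM : 0 ≤ M := by positivity
  have hM1 : 1 ≤ M := by
    have : 0 ≤ (K + Y + 1) / η := by positivity
    simp only [M]; linarith
  have hbd : ∀ x, c ≤ x → ∫ t in c..x, ‖y t‖ ^ 2 ≤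
      2 * (Y + K * M) / z.im + 2 * M ^ 2 * ∫ t in Ioi (0 : ℝ), ‖u t‖ ^ 2 := by
    intro x hx
    set k := -y x / u x
    have hsol : IsSolution (Ici 0) q z (fun t => y t + k * u t) (fun t => dy t + k * du t) := by
      refine ⟨hy.cont.add (continuousOn_const.mul hu.cont),
        hy.dcont.add (continuousOn_const.mul hu.dcont), fun t ht => ?_, fun t ht => ?_⟩
      · have ht' : (0 : ℝ) ≤ t := ht
        exact ((hy.hasPrim ht' (Icc_zero_subset_Ici t)).add
          ((hu.hasPrim ht' (Icc_zero_subset_Ici t)).const_mul k)).eq t ⟨ht', le_rfl⟩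
      · have ht' : (0 : ℝ) ≤ t := ht
        have hqt := integrableOn_Ioo_of_forall hq t
        exact (((hy.hasPrim_deriv ht' (Icc_zero_subset_Ici t) hqt).add
          ((hu.hasPrim_deriv ht' (Icc_zero_subset_Ici t) hqt).const_mul k)).congr_right
            (g' := fun s => ((q s : ℂ) - z) * (y s + k * u s))
            (ae_of_all _ fun s => by ring)).eq t ⟨ht', le_rfl⟩
    have hfx : flux (fun t => y t + k * u t) (fun t => dy t + k * du t) x = 0 := by
      have : y x + k * u x = 0 := by
        simp only [k]
        rw [div_mul_cancel₀ _ (hune x hx)]; ring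
      simp [flux, this]
    have h1 := flux_eq hsol hc hx (Icc_zero_subset_Ici x) (integrableOn_Ioo_of_forall hq x)
    rw [hfx] at h1
    have h2 : flux (fun t => y t + k * u t) (fun t => dy t + k * du t) c =
        flux y dy c - ‖k‖ ^ 2 * η + (conj (y c) * (k * du c) + conj (k * u c) * dy c).im := by
      have e1 : conj (y c + k * u c) * (dy c + k * du c) = conj (y c) * dy c +
          (‖k‖ ^ 2 : ℝ) * (conj (u c) * du c) +
            (conj (y c) * (k * du c) + conj (k * u c) * dy c) := by
        rw [map_add, map_mul, Complex.ofReal_pow, ← Complex.conj_mul' k]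
        ring
      unfold flux
      simp only [η, flux]
      rw [e1, Complex.add_im, Complex.add_im, Complex.im_ofReal_mul]
      ring
    have h3 : (conj (y c) * (k * du c) + conj (k * u c) * dy c).im ≤ K * ‖k‖ := by
      refine (Complex.im_le_norm _).trans ((norm_add_le _ _).trans (le_of_eq ?_))
      simp only [norm_mul, Complex.norm_conj, K]
      ring
    have h4 : flux y dy c ≤ Y := le_abs_self _
    have hint : 0 ≤ ∫ t in c..x, ‖y t + k * u t‖ ^ 2 :=
      intervalIntegral.integral_nonneg hx fun t _ => by positivity
    have h5 : 0 ≤ Y - ‖k‖ ^ 2 * η + K * ‖k‖ := by nlinarith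
    have hkM : ‖k‖ ≤ M := by
      by_contra! hlt
      have h6 : K + Y + 1 ≤ (‖k‖ - 1) * η := by
        rw [← div_le_iff₀ hη]
        simp only [M] at hlt
        linarith
      nlinarith [norm_nonneg k]
    have h7 : z.im * ∫ t in c..x, ‖y t + k * u t‖ ^ 2 ≤ Y + K * M := by
      have : K * ‖k‖ ≤ K * M := by gcongr
      nlinarith [sq_nonneg ‖k‖]
    have h8 : ∫ t in c..x, ‖y t + k * u t‖ ^ 2 ≤ (Y + K * M) / z.im := by
      rw [le_div_iff₀ hz]; linarith
    have hcy : ∀ {v : ℝ → ℂ}, ContinuousOn v (Ici 0) →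
        IntervalIntegrable (fun t => ‖v t‖ ^ 2) volume c x := fun hv =>
      ((hv.mono (by rw [uIcc_of_le hx]; exact fun t ht => hc.trans ht.1)).norm.pow
        2).intervalIntegrable
    have iu := hcy hu.cont
    have iv := hcy hsol.cont
    calc _ ≤ ∫ t in c..x, (2 * ‖y t + k * u t‖ ^ 2 + 2 * M ^ 2 * ‖u t‖ ^ 2) := by
          refine intervalIntegral.integral_mono_on hx (hcy hy.cont)
            ((iv.const_mul 2).add (iu.const_mul _)) fun t _ => ?_
          have e1 : ‖y t‖ ≤ ‖y t + k * u t‖ + M * ‖u t‖ := by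
            calc ‖y t‖ = ‖(y t + k * u t) - k * u t‖ := by congr 1; ring
              _ ≤ ‖y t + k * u t‖ + ‖k * u t‖ := norm_sub_le _ _
              _ ≤ _ := by rw [norm_mul]; gcongr
          calc ‖y t‖ ^ 2 ≤ (‖y t + k * u t‖ + M * ‖u t‖) ^ 2 := by gcongr
            _ ≤ _ := by nlinarith [sq_nonneg (‖y t + k * u t‖ - M * ‖u t‖)]
      _ = 2 * (∫ t in c..x, ‖y t + k * u t‖ ^ 2) + 2 * M ^ 2 * ∫ t in c..x, ‖u t‖ ^ 2 := by
          rw [intervalIntegral.integral_add (iv.const_mul 2) (iu.const_mul _),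
            intervalIntegral.integral_const_mul, intervalIntegral.integral_const_mul]
      _ ≤ _ := by
          rw [mul_div_assoc]
          gcongr
          exact intervalIntegral_le_of_integrableOn hiu (fun t => by positivity) hc hx
  obtain ⟨N, hN⟩ : ∃ N : ℝ, ∀ x, c ≤ x → ∫ t in c..x, ‖y t‖ ^ 2 ≤ N := ⟨_, hbd⟩
  have hy2 : L2AtInfinity y := by
    refine ⟨c, hc, integrableOn_Ioi_of_intervalIntegral_norm_bounded (l := atTop) (b := id) N c
      (fun x => ?_) tendsto_id ((eventually_ge_atTop c).mono fun x hx => ?_)⟩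
    · exact (((hy.cont.mono fun t ht => hc.trans ht.1).norm.pow 2).integrableOn_Icc
        (b := x)).mono_set Ioc_subset_Icc_self
    · simp only [id, norm_pow, norm_norm]
      exact hN x hx
  obtain ⟨k, hk⟩ := (hlp z hz).2 u du y dy ⟨hu, 0, self_mem_Ici, hu0⟩ hu2 ⟨hy, hyne⟩ hy2
  have hk0 := hk 0 self_mem_Ici
  rw [hy0, eq_comm, mul_eq_zero] at hk0
  obtain ⟨x, hx, hne⟩ := hyne
  rw [hk x hx, hk0.resolve_right hu0, zero_mul] at hne
  exact hne rfl

end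

/-! ### The flux for potentials essentially bounded below, and for all endpoints -/

section

variable {q : ℝ → ℝ} {z : ℂ} {u du : ℝ → ℂ}

/-- `Re (ū u')`, half the derivative of `|u|²`. -/
def growth (u du : ℝ → ℂ) (x : ℝ) : ℝ := (conj (u x) * du x).re

theorem continuousOn_growth {D : Set ℝ} (h : IsSolution D q z u du) :
    ContinuousOn (growth u du) D :=
  Complex.continuous_re.comp_continuousOn
    ((Complex.continuous_conj.comp_continuousOn h.cont).mul h.dcont)

theorem hasPrim_norm_sq (hu : IsSolution (Ici 0) q z u du) {c : ℝ} (hc : 0 ≤ c) :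
    HasPrim (fun t => ((‖u t‖ ^ 2 : ℝ) : ℂ)) (fun t => ((2 * growth u du t : ℝ) : ℂ)) 0 c := by
  have h := hu.hasPrim hc (Icc_zero_subset_Ici c)
  refine ((h.starRing.mul h).congr_left fun t _ => ?_).congr_right (ae_of_all _ fun t => ?_)
  · rw [Complex.conj_mul', Complex.ofReal_pow]
  · unfold growth
    apply Complex.ext <;> simp <;> ring

theorem norm_sq_sub (hu : IsSolution (Ici 0) q z u du) {x y : ℝ} (hx : 0 ≤ x) (hxy : x ≤ y) :
    ‖u y‖ ^ 2 - ‖u x‖ ^ 2 = ∫ t in x..y, 2 * growth u du t := by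
  have h := ((hasPrim_norm_sq hu (hx.trans hxy)).mono hx hxy le_rfl).integral_eq
  rw [intervalIntegral.integral_ofReal] at h
  exact_mod_cast h.symm

theorem growth_sub (hq : ∀ a : ℝ, 0 < a → IntegrableOn q (Ioo 0 a))
    (hu : IsSolution (Ici 0) q z u du) {x y : ℝ} (hx : 0 ≤ x) (hxy : x ≤ y) :
    growth u du y - growth u du x =
      ∫ t in x..y, (‖du t‖ ^ 2 + (q t - z.re) * ‖u t‖ ^ 2) := by
  have hy := hx.trans hxy
  have h := ((hu.hasPrim hy (Icc_zero_subset_Ici y)).starRing.mul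
    (hu.hasPrim_deriv hy (Icc_zero_subset_Ici y) (integrableOn_Ioo_of_forall hq y))).mono
      hx hxy le_rfl
  have h1 := congrArg Complex.re h.integral_eq
  have h2 := Complex.reCLM.intervalIntegral_comp_comm h.integrable
  simp only [Complex.reCLM_apply] at h2
  rw [← h2, Complex.sub_re] at h1
  rw [growth, growth, ← h1]
  refine intervalIntegral.integral_congr fun t _ => ?_
  rw [Complex.add_re, Complex.conj_mul', mul_left_comm, Complex.conj_mul', ← Complex.ofReal_pow,
    ← Complex.ofReal_pow, Complex.ofReal_re, Complex.re_mul_ofReal]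
  simp

/-- A Sobolev estimate: write |u(x)|² - |u(s)|² as the integral of 2 Re(ū u'), split it by Young's
inequality and average over s. The weight 1/(2C) is fixed so that, after multiplication by C, half
of the energy ∫|u'|² is used up. -/
theorem sq_norm_le_of_unit_interval (hu : IsSolution (Ici 0) q z u du) {a : ℝ} (ha : 0 ≤ a)
    {C : ℝ} (hC : 0 < C) {x : ℝ} (hx : x ∈ Icc a (a + 1)) :
    ‖u x‖ ^ 2 ≤ (1 + 2 * C) * (∫ t in a..(a + 1), ‖u t‖ ^ 2) +
      1 / (2 * C) * ∫ t in a..(a + 1), ‖du t‖ ^ 2 := by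
  have hsub : uIcc a (a + 1) ⊆ Ici 0 := by
    rw [uIcc_of_le (by linarith)]; exact fun t ht => ha.trans ht.1
  have iu : IntervalIntegrable (fun t => ‖u t‖ ^ 2) volume a (a + 1) :=
    ((hu.cont.mono hsub).norm.pow 2).intervalIntegrable
  have idu : IntervalIntegrable (fun t => ‖du t‖ ^ 2) volume a (a + 1) :=
    ((hu.dcont.mono hsub).norm.pow 2).intervalIntegrable
  have ig : IntervalIntegrable (fun t => 2 * growth u du t) volume a (a + 1) :=
    (continuousOn_const.mul ((continuousOn_growth hu).mono hsub)).intervalIntegrable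
  have iT := (iu.const_mul (2 * C)).add (idu.const_mul (1 / (2 * C)))
  have hG : ∀ t, |2 * growth u du t| ≤ 2 * C * ‖u t‖ ^ 2 + 1 / (2 * C) * ‖du t‖ ^ 2 := by
    intro t
    have h1 : |growth u du t| ≤ ‖u t‖ * ‖du t‖ := by
      refine (Complex.abs_re_le_norm _).trans ?_
      rw [norm_mul, Complex.norm_conj]
    rw [abs_mul, abs_two]
    have h2 : 2 * (‖u t‖ * ‖du t‖) ≤ 2 * C * ‖u t‖ ^ 2 + 1 / (2 * C) * ‖du t‖ ^ 2 := by
      have h3 : 2 * C * ‖u t‖ ^ 2 + 1 / (2 * C) * ‖du t‖ ^ 2 - 2 * (‖u t‖ * ‖du t‖) =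
          1 / (2 * C) * (2 * C * ‖u t‖ - ‖du t‖) ^ 2 := by field_simp; ring
      have h4 : 0 ≤ 1 / (2 * C) * (2 * C * ‖u t‖ - ‖du t‖) ^ 2 := by positivity
      linarith
    linarith
  set T := ∫ t in a..(a + 1), (2 * C * ‖u t‖ ^ 2 + 1 / (2 * C) * ‖du t‖ ^ 2) with hT
  have key : ∀ s ∈ Icc a (a + 1), ‖u x‖ ^ 2 - T ≤ ‖u s‖ ^ 2 := by
    intro s hs
    have hi : ∀ y ∈ Icc a (a + 1), IntervalIntegrable (fun t => 2 * growth u du t) volume a y :=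
      fun y hy => ig.mono_set (uIcc_subset_uIcc_left (by rwa [uIcc_of_le (by linarith)]))
    have e : ‖u x‖ ^ 2 - ‖u s‖ ^ 2 = ∫ t in s..x, 2 * growth u du t := by
      have e1 := norm_sq_sub hu ha hx.1
      have e2 := norm_sq_sub hu ha hs.1
      rw [← intervalIntegral.integral_interval_sub_left (hi x hx) (hi s hs)]
      linarith
    have e2 : ∫ t in s..x, 2 * growth u du t ≤ T := by
      refine (le_abs_self _).trans ?_
      rw [← Real.norm_eq_abs]
      refine intervalIntegral.norm_integral_le_integral_norm_uIoc.trans ?_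
      rw [hT, intervalIntegral.integral_of_le (by linarith)]
      have hs2 : uIoc s x ⊆ Ioc a (a + 1) := by
        intro t ht
        rw [mem_uIoc] at ht
        rcases ht with ht | ht
        · exact ⟨hs.1.trans_lt ht.1, ht.2.trans hx.2⟩
        · exact ⟨hx.1.trans_lt ht.1, ht.2.trans hs.2⟩
      refine (setIntegral_mono (ig.norm.1.mono_set hs2) (iT.1.mono_set hs2) hG).trans ?_
      exact setIntegral_mono_set iT.1 (ae_of_all _ fun t => by
        simp only [Pi.zero_apply]; positivity) (Eventually.of_forall hs2)
    linarith
  have h1 := intervalIntegral.integral_mono_on (by linarith : a ≤ a + 1)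
    intervalIntegrable_const iu key
  rw [intervalIntegral.integral_const, add_sub_cancel_left, one_smul] at h1
  have h2 : T = 2 * C * (∫ t in a..(a + 1), ‖u t‖ ^ 2) +
      1 / (2 * C) * ∫ t in a..(a + 1), ‖du t‖ ^ 2 := by
    rw [hT, intervalIntegral.integral_add (iu.const_mul _) (idu.const_mul _),
      intervalIntegral.integral_const_mul, intervalIntegral.integral_const_mul]
  linarith

/-- The negative part of q absorbs at most half of ∫|u'|² and a multiple of ∫|u|². The other half
still yields the gain η, because η ≤ |u||u'| ≤ (|u|² + |u'|²)/2. -/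
theorem growth_add_one_ge (hq : ∀ a : ℝ, 0 < a → IntegrableOn q (Ioo 0 a))
    (hu : IsSolution (Ici 0) q z u du) {C : ℝ} (hC : 0 < C)
    (hb : ∀ a : ℝ, 0 < a → ∫ x in a..(a + 1), max (-q x) 0 ≤ C) {a η : ℝ} (ha : 0 < a)
    (hη : ∀ x, a ≤ x → η ≤ ‖u x‖ * ‖du x‖) :
    growth u du a + η - (C * (1 + 2 * C) + |z.re| + 1 / 2) * ∫ t in a..(a + 1), ‖u t‖ ^ 2 ≤
      growth u du (a + 1) := by
  have hsub : uIcc a (a + 1) ⊆ Ici 0 := by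
    rw [uIcc_of_le (by linarith)]; exact fun t ht => ha.le.trans ht.1
  have hle : a ≤ a + 1 := by linarith
  have cu : ContinuousOn (fun t => ‖u t‖ ^ 2) (uIcc a (a + 1)) := (hu.cont.mono hsub).norm.pow 2
  have iu : IntervalIntegrable (fun t => ‖u t‖ ^ 2) volume a (a + 1) := cu.intervalIntegrable
  have idu : IntervalIntegrable (fun t => ‖du t‖ ^ 2) volume a (a + 1) :=
    ((hu.dcont.mono hsub).norm.pow 2).intervalIntegrable
  have iq : IntervalIntegrable q volume a (a + 1) :=
    (intervalIntegrable_of_integrableOn_Ioo (by linarith) (hq (a + 1) (by linarith))).mono_set (by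
      rw [uIcc_of_le hle, uIcc_of_le (by linarith)]; exact Icc_subset_Icc_left ha.le)
  have iqm : IntervalIntegrable (fun t => max (-q t) 0) volume a (a + 1) :=
    ⟨iq.1.neg.pos_part, iq.2.neg.pos_part⟩
  set S := ∫ t in a..(a + 1), ‖u t‖ ^ 2
  set I := ∫ t in a..(a + 1), ‖du t‖ ^ 2
  set s := (1 + 2 * C) * S + 1 / (2 * C) * I
  have hI0 : 0 ≤ I := intervalIntegral.integral_nonneg hle fun t _ => by positivity
  have hS0 : 0 ≤ S := intervalIntegral.integral_nonneg hle fun t _ => by positivity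
  have hs0 : 0 ≤ s := by positivity
  have h1 : ∫ t in a..(a + 1), max (-q t) 0 * ‖u t‖ ^ 2 ≤ C * s := by
    calc _ ≤ ∫ t in a..(a + 1), max (-q t) 0 * s :=
          intervalIntegral.integral_mono_on hle (iqm.mul_continuousOn cu) (iqm.mul_const s)
            fun t ht => mul_le_mul_of_nonneg_left
              (sq_norm_le_of_unit_interval hu ha.le hC ht) (le_max_right _ _)
      _ ≤ C * s := by
          rw [intervalIntegral.integral_mul_const]
          exact mul_le_mul_of_nonneg_right (hb a ha) hs0
  have h2 : ∫ t in a..(a + 1), (‖du t‖ ^ 2 - max (-q t) 0 * ‖u t‖ ^ 2 - |z.re| * ‖u t‖ ^ 2) ≤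
      growth u du (a + 1) - growth u du a := by
    rw [growth_sub hq hu ha.le hle]
    refine intervalIntegral.integral_mono_on hle
      ((idu.sub (iqm.mul_continuousOn cu)).sub (iu.const_mul _))
      (idu.add ((iq.sub intervalIntegrable_const).mul_continuousOn cu)) fun t _ => ?_
    have e1 := le_max_left (-q t) 0
    have e2 := le_abs_self z.re
    nlinarith [sq_nonneg ‖u t‖]
  rw [intervalIntegral.integral_sub (idu.sub (iqm.mul_continuousOn cu)) (iu.const_mul _),
    intervalIntegral.integral_sub idu (iqm.mul_continuousOn cu),
    intervalIntegral.integral_const_mul] at h2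
  have h3 : 2 * η ≤ I + S := by
    have := intervalIntegral.integral_mono_on hle (intervalIntegrable_const (c := 2 * η))
      (idu.add iu) fun t ht => by
        have := hη t ht.1
        nlinarith [sq_nonneg (‖du t‖ - ‖u t‖)]
    rwa [intervalIntegral.integral_const, add_sub_cancel_left, one_smul,
      intervalIntegral.integral_add idu iu] at this
  have h4 : C * s = C * (1 + 2 * C) * S + I / 2 := by
    simp only [s]; field_simp
  have h5 : I - C * s - |z.re| * S ≤ growth u du (a + 1) - growth u du a := by
    change I - _ - |z.re| * S ≤ _ at h2
    linarith
  rw [h4] at h5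
  linarith

/-- A negative flux keeps |u||u'| away from 0, so Re(ū u') gains a fixed amount on every unit
interval, with total loss bounded by a multiple of the finite ∫|u|². Hence |u|² eventually grows,
contradicting square integrability. -/
theorem flux_nonneg_essBoundedBelow (hq : ∀ a : ℝ, 0 < a → IntegrableOn q (Ioo 0 a))
    (hb : EssBoundedBelow q) (hz : 0 < z.im) (hu : IsSolution (Ici 0) q z u du)
    (hu2 : L2AtInfinity u) {c : ℝ} (hc : 0 ≤ c) : 0 ≤ flux u du c := by
  by_contra! hneg
  obtain ⟨C₀, hC₀⟩ := hb
  set C := max C₀ 1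
  have hC : 0 < C := zero_lt_one.trans_le (le_max_right _ _)
  set η := -flux u du c
  have hη : 0 < η := by simp only [η]; linarith
  have hlow : ∀ x, c ≤ x → η ≤ ‖u x‖ * ‖du x‖ := fun x hx => by
    have h1 := flux_le_of_le hq hz hu hc hx
    have h2 := abs_flux_le (u := u) (du := du) x
    have h3 := neg_abs_le (flux u du x)
    simp only [η]
    linarith
  have hi := hu2.integrableOn hu.cont
  set S := ∫ t in Ioi (0 : ℝ), ‖u t‖ ^ 2
  set L := C * (1 + 2 * C) + |z.re| + 1 / 2
  have hL : 0 ≤ L := by positivity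
  set X := c + 1
  have hX : 0 < X := by simp only [X]; linarith
  have hcX : c ≤ X := by simp only [X]; linarith
  have hint : ∀ x y : ℝ, 0 ≤ x → x ≤ y → IntervalIntegrable (fun t => ‖u t‖ ^ 2) volume x y :=
    fun x y hx hxy => ((hu.cont.mono (by
      rw [uIcc_of_le hxy]
      exact fun t ht => hx.trans ht.1)).norm.pow 2).intervalIntegrable
  have hstep : ∀ (n : ℕ) (a : ℝ), X ≤ a →
      growth u du a + n * η - L * (∫ t in a..(a + n), ‖u t‖ ^ 2) ≤ growth u du (a + n) := by
    intro n a ha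
    induction n with
    | zero => simp
    | succ n ih =>
      have hn : (0 : ℝ) ≤ n := n.cast_nonneg
      have h1 := growth_add_one_ge hq hu hC (fun a ha => (hC₀ a ha).trans (le_max_left _ _))
        (a := a + n) (η := η) (by linarith) fun x hx => hlow x (by linarith)
      have h2 := intervalIntegral.integral_add_adjacent_intervals
        (hint a (a + n) (by linarith) (by linarith))
        (hint (a + n) (a + n + 1) (by linarith) (by linarith))
      push_cast
      rw [← add_assoc, ← h2, mul_add]
      change _ - L * _ ≤ _ at h1
      linarith
  -- Every large x is reached by unit steps from a point of [X, X + 1], so a bound on this compact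
  -- interval controls all starting values.
  obtain ⟨G, hG⟩ := isCompact_Icc.exists_bound_of_continuousOn
    ((continuousOn_growth hu).mono (fun t (ht : t ∈ Icc X (X + 1)) => hX.le.trans ht.1))
  have hlin : ∀ x, X ≤ x → -G - L * S + (x - X - 1) * η ≤ growth u du x := by
    intro x hx
    set n := ⌊x - X⌋₊
    have h1 : (n : ℝ) ≤ x - X := Nat.floor_le (by linarith)
    have h2 : x - X < n + 1 := Nat.lt_floor_add_one _
    have h3 := hstep n (x - n) (by linarith)
    have h4 := hG (x - n) ⟨by linarith, by linarith⟩
    rw [sub_add_cancel] at h3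
    have h5 : ∫ t in (x - n)..x, ‖u t‖ ^ 2 ≤ S :=
      intervalIntegral_le_of_integrableOn hi (fun t => by positivity) (by linarith)
        (by linarith [n.cast_nonneg (α := ℝ)])
    rw [Real.norm_eq_abs] at h4
    have h6 := neg_abs_le (growth u du (x - n))
    nlinarith
  set X₁ := X + 1 + (1 + G + L * S) / η
  have hS0 : 0 ≤ S := integral_nonneg fun t => by positivity
  have hG0 : 0 ≤ G := (norm_nonneg _).trans (hG X ⟨le_rfl, by linarith⟩)
  have hXX₁ : X ≤ X₁ := by
    have : 0 ≤ (1 + G + L * S) / η := by positivity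
    simp only [X₁]; linarith
  have hgr : ∀ x, X₁ ≤ x → 1 ≤ growth u du x := by
    intro x hx
    have h1 := hlin x (hXX₁.trans hx)
    have h2 : (1 + G + L * S) / η ≤ x - X - 1 := by simp only [X₁] at hx; linarith
    rw [div_le_iff₀ hη] at h2
    linarith
  have hge : ∀ x, X₁ + 1 ≤ x → 1 ≤ ‖u x‖ ^ 2 := by
    intro x hx
    have h1 := norm_sq_sub hu (hX.le.trans hXX₁) (by linarith : X₁ ≤ x)
    have hsub : uIcc X₁ x ⊆ Ici 0 := by
      rw [uIcc_of_le (by linarith : X₁ ≤ x)]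
      exact fun t ht => (hX.le.trans hXX₁).trans ht.1
    have ig : IntervalIntegrable (fun t => 2 * growth u du t) volume X₁ x :=
      (continuousOn_const.mul ((continuousOn_growth hu).mono hsub)).intervalIntegrable
    have h2 := intervalIntegral.integral_mono_on (by linarith : X₁ ≤ x)
      (intervalIntegrable_const (c := (1 : ℝ))) ig fun t ht => by linarith [hgr t ht.1]
    rw [intervalIntegral.integral_const, smul_eq_mul, mul_one] at h2
    nlinarith [sq_nonneg ‖u X₁‖]
  have hX₁ : 0 ≤ X₁ + 1 := by linarith
  have h1 := intervalIntegral.integral_mono_on (by linarith : X₁ + 1 ≤ X₁ + 1 + (S + 1))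
    (intervalIntegrable_const (c := (1 : ℝ))) (hint (X₁ + 1) (X₁ + 1 + (S + 1)) hX₁ (by linarith))
    fun t ht => hge t ht.1
  rw [intervalIntegral.integral_const, smul_eq_mul, mul_one] at h1
  have h2 := intervalIntegral_le_of_integrableOn hi (fun t => by positivity) hX₁
    (by linarith : X₁ + 1 ≤ X₁ + 1 + (S + 1))
  linarith

/-- The Herglotz property: a solution satisfying the condition at the right endpoint has
`Im (ū u') ≥ 0` everywhere. -/
theorem flux_nonneg {B : RightEnd} (hB : B.Admissible q) (hz : 0 < z.im)
    (hu : IsSolution B.dom q z u du) (hs : B.Satisfies u du) (hu0 : u 0 ≠ 0) {c : ℝ}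
    (hc : c ∈ B.dom) : 0 ≤ flux u du c := by
  have htop : ∀ {B : RightEnd}, B.b = ⊤ → B.dom = Ici 0 := fun h => by
    ext x; simp [RightEnd.dom, h, EReal.coe_lt_top]
  cases B with
  | robin b h => exact flux_nonneg_robin hB.2 hz hu hs hc
  | dirichlet b => exact flux_nonneg_dirichlet hB.2 hz hu hs hc
  | squareIntegrable =>
    rw [htop rfl] at hu
    rcases hB.2 with h | h
    · exact flux_nonneg_essBoundedBelow hB.1 h hz hu hs hc.1
    · exact flux_nonneg_limitPoint hB.1 h hz hu hs hu0 hc.1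
  | limitCircle u₀ du₀ =>
    rw [htop rfl] at hu
    exact flux_nonneg_limitCircle hB.1 hB.2.1 hB.2.2.1 hB.2.2.2 hz hu hs hc.1

end

/-! ### The Riccati equation for the Laplace transform of the kernel -/

section

open scoped ENNReal

variable {f : Bool → ℝ → ℝ≥0∞} {c : ℝ} {κ : ℂ}

theorem hasPrim_cexp_mul (a : ℂ) (hc : 0 ≤ c) :
    HasPrim (fun t : ℝ => Complex.exp (a * t)) (fun t : ℝ => a * Complex.exp (a * t)) 0 c := by
  refine HasPrim.of_hasDerivAt hc (fun x _ => ?_) (by fun_prop)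
  have := ((Complex.ofRealCLM.hasDerivAt (x := x)).const_mul a).cexp
  simpa [mul_comm] using this

/-- Solution of the linear equation `V' = 2κV - g`, `V(c) = 0`. -/
theorem hasPrim_linear {g : ℝ → ℂ} (hc : 0 ≤ c) (hg : IntervalIntegrable g volume 0 c) (κ : ℂ) :
    HasPrim (fun x => ∫ t in x..c, Complex.exp (-2 * κ * (t - x : ℝ)) * g t)
      (fun x => 2 * κ * (∫ t in x..c, Complex.exp (-2 * κ * (t - x : ℝ)) * g t) - g x) 0 c := by
  have hi : IntervalIntegrable (fun t : ℝ => Complex.exp (-2 * κ * t) * g t) volume 0 c :=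
    hg.continuousOn_mul (by fun_prop)
  have h1 := (HasPrim.const (∫ t in (0 : ℝ)..c, Complex.exp (-2 * κ * t) * g t) hc).sub
    (HasPrim.of_integral hc hi)
  have h2 := (hasPrim_cexp_mul (2 * κ) hc).mul h1
  have e : ∀ x ∈ Icc 0 c, Complex.exp (2 * κ * x) *
      ((∫ t in (0 : ℝ)..c, Complex.exp (-2 * κ * t) * g t) -
        ∫ t in (0 : ℝ)..x, Complex.exp (-2 * κ * t) * g t) =
      ∫ t in x..c, Complex.exp (-2 * κ * (t - x : ℝ)) * g t := by
    intro x hx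
    rw [intervalIntegral.integral_interval_sub_left hi (hi.mono_set (uIcc_subset_uIcc_left
      (by rwa [uIcc_of_le hc]))), ← intervalIntegral.integral_const_mul]
    refine intervalIntegral.integral_congr fun t _ => ?_
    rw [← mul_assoc, ← Complex.exp_add]
    congr 2
    push_cast
    ring
  refine (h2.congr_left e).congr_right ?_
  filter_upwards [ae_restrict_mem measurableSet_Ioc] with x hx
  rw [← e x (Ioc_subset_Icc_self hx)]
  have : Complex.exp (2 * κ * x) * Complex.exp (-2 * κ * x) = 1 := by
    rw [← Complex.exp_add]; simp
  linear_combination (-g x) * this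

theorem norm_laplace_le {g : ℝ → ℝ≥0∞} (κ : ℂ) :
    ENNReal.ofReal ‖laplace g κ‖ ≤ ∫⁻ α, expWeight κ.re α * g α := by
  unfold laplace
  rw [ofReal_norm]
  refine (enorm_integral_le_lintegral_enorm _).trans (lintegral_mono fun α => ?_)
  rw [enorm_mul, enorm_cexp_weight, mul_comm]
  gcongr
  rw [← ofReal_norm, Complex.norm_real, Real.norm_of_nonneg ENNReal.toReal_nonneg]
  exact ENNReal.ofReal_toReal_le

theorem measurable_laplace_kernel (hf : ∀ σ, Measurable (f σ)) (κ : ℂ) (σ : Bool) :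
    Measurable fun x => laplace (kernel f c σ x) κ := by
  have h : Measurable fun p : ℝ × ℝ => ((kernel f c σ p.1 p.2).toReal : ℂ) *
      Complex.exp (-2 * κ * p.2) :=
    (Complex.measurable_ofReal.comp (measurable_kernel hf σ).ennreal_toReal).mul (by fun_prop)
  exact h.stronglyMeasurable.integral_prod_right'.measurable

/-- The hypotheses on the data of the kernel equation: `f` lives on `(0, c)`, and `M` is a bound for
the norm of the kernel with exponential weight `k`. -/
structure KernelData (f : Bool → ℝ → ℝ≥0∞) (c Q M k : ℝ) : Prop where
  measurable : ∀ σ, Measurable (f σ)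
  support : ∀ σ t, t ∉ Ioo 0 c → f σ t = 0
  c_pos : 0 < c
  k_pos : 0 < k
  Q_nonneg : 0 ≤ Q
  lintegral_le : ∑ σ, ∫⁻ t, f σ t ≤ ENNReal.ofReal Q
  le : Q + M ^ 2 / (2 * k) ≤ M

namespace KernelData

variable {Q M k : ℝ} (h : KernelData f c Q M k)
include h

theorem M_nonneg : 0 ≤ M := by
  have := h.k_pos
  have := h.Q_nonneg
  have : 0 ≤ M ^ 2 / (2 * k) := by positivity
  linarith [h.le]

theorem lintegral_kernel_le (x : ℝ) :
    ∑ σ, ∫⁻ α, expWeight k α * kernel f c σ x α ≤ ENNReal.ofReal M := by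
  refine lintegral_expWeight_kernel_le h.measurable h.k_pos ?_ x
  have hk := h.k_pos
  rw [← ENNReal.ofReal_pow h.M_nonneg, ← ENNReal.ofReal_mul (by positivity)]
  refine (add_le_add_left h.lintegral_le _).trans ?_
  rw [← ENNReal.ofReal_add h.Q_nonneg (by positivity)]
  refine ENNReal.ofReal_le_ofReal ?_
  rw [mul_one_div]
  exact h.le

theorem lintegral_kernel_ne_top (σ : Bool) (x : ℝ) :
    ∫⁻ α, expWeight k α * kernel f c σ x α ≠ ∞ :=
  ne_top_of_le_ne_top ENNReal.ofReal_ne_top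
    ((Finset.single_le_sum (f := fun σ => ∫⁻ α, expWeight k α * kernel f c σ x α)
      (fun _ _ => zero_le) (Finset.mem_univ σ)).trans (h.lintegral_kernel_le x))

theorem norm_laplace_add_le (hκ : κ.re = k) (x : ℝ) :
    ‖laplace (kernel f c false x) κ‖ + ‖laplace (kernel f c true x) κ‖ ≤ M := by
  rw [← ENNReal.ofReal_le_ofReal_iff h.M_nonneg, ENNReal.ofReal_add (norm_nonneg _) (norm_nonneg _)]
  refine (add_le_add (norm_laplace_le κ) (norm_laplace_le κ)).trans ?_
  have := h.lintegral_kernel_le x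
  rw [Fintype.sum_bool, add_comm] at this
  rwa [hκ]

theorem lintegral_ne_top (σ : Bool) : ∫⁻ t, f σ t ≠ ∞ :=
  ne_top_of_le_ne_top ENNReal.ofReal_ne_top
    ((Finset.single_le_sum (f := fun σ => ∫⁻ t, f σ t)
      (fun _ _ => zero_le) (Finset.mem_univ σ)).trans h.lintegral_le)

theorem integrable_toReal (σ : Bool) : Integrable fun t => (f σ t).toReal :=
  integrable_toReal_of_lintegral_ne_top (h.measurable σ).aemeasurable (h.lintegral_ne_top σ)

theorem integral_toReal_le :
    (∫ t, (f false t).toReal) + ∫ t, (f true t).toReal ≤ Q := by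
  rw [integral_toReal (h.measurable _).aemeasurable (ae_lt_top (h.measurable _)
    (h.lintegral_ne_top _)), integral_toReal (h.measurable _).aemeasurable
    (ae_lt_top (h.measurable _) (h.lintegral_ne_top _)),
    ← ENNReal.toReal_add (h.lintegral_ne_top _) (h.lintegral_ne_top _)]
  have := h.lintegral_le
  rw [Fintype.sum_bool, add_comm] at this
  exact ENNReal.toReal_le_of_le_ofReal h.Q_nonneg this

theorem laplace_eq (hκ : κ.re = k) (σ : Bool) {x : ℝ} (hx : x ≤ c) :
    laplace (kernel f c σ x) κ = ∫ t in x..c, Complex.exp (-2 * κ * (t - x : ℝ)) *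
      (((f σ t).toReal : ℂ) +
        ∑ τ, laplace (kernel f c τ t) κ * laplace (kernel f c (xor σ τ) t) κ) := by
  rw [laplace_kernel_eq h.measurable (fun σ x => by rw [hκ]; exact h.lintegral_kernel_ne_top σ x)]
  have hexp : Continuous fun t : ℝ => Complex.exp (-2 * κ * (t - x : ℝ)) := by fun_prop
  have i1 : IntegrableOn (fun t => Complex.exp (-2 * κ * (t - x : ℝ)) * ((f σ t).toReal : ℂ))
      (Ioc x c) := by
    have := (h.integrable_toReal σ).ofReal (𝕜 := ℂ)
    exact ((intervalIntegrable_iff_integrableOn_Ioc_of_le hx).1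
      (IntervalIntegrable.continuousOn_mul (a := x) (b := c) ⟨this.integrableOn, this.integrableOn⟩
        hexp.continuousOn))
  have i2 : ∀ τ, IntegrableOn (fun t => Complex.exp (-2 * κ * (t - x : ℝ)) *
      (laplace (kernel f c τ t) κ * laplace (kernel f c (xor σ τ) t) κ)) (Ioc x c) := by
    intro τ
    have hb : ∀ σ t, ‖laplace (kernel f c σ t) κ‖ ≤ M := fun σ t => by
      have := h.norm_laplace_add_le hκ t
      cases σ
      · linarith [norm_nonneg (laplace (kernel f c true t) κ)]
      · linarith [norm_nonneg (laplace (kernel f c false t) κ)]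
    have i0 : IntegrableOn (fun t => laplace (kernel f c τ t) κ * laplace (kernel f c (xor σ τ) t) κ)
        (Ioc x c) := by
      refine Measure.integrableOn_of_bounded (M := M * M) (by simp)
        ((measurable_laplace_kernel h.measurable κ τ).mul
          (measurable_laplace_kernel h.measurable κ _)).aestronglyMeasurable
        (ae_of_all _ fun t => ?_)
      rw [norm_mul]
      exact mul_le_mul (hb _ _) (hb _ _) (norm_nonneg _) h.M_nonneg
    exact ((intervalIntegrable_iff_integrableOn_Ioc_of_le hx).1
      (((intervalIntegrable_iff_integrableOn_Ioc_of_le hx).2 i0).continuousOn_mul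
        hexp.continuousOn))
  have e1 : ∫ t in Ioi x, ((f σ t).toReal : ℂ) * Complex.exp (-2 * κ * (t - x : ℝ)) =
      ∫ t in Ioc x c, Complex.exp (-2 * κ * (t - x : ℝ)) * ((f σ t).toReal : ℂ) := by
    rw [← integral_indicator measurableSet_Ioi, ← integral_indicator measurableSet_Ioc]
    congr 1
    ext t
    by_cases h1 : t ∈ Ioc x c
    · rw [indicator_of_mem h1, indicator_of_mem (Ioc_subset_Ioi_self h1), mul_comm]
    · rw [indicator_of_notMem h1]
      by_cases h2 : t ∈ Ioi x
      · rw [indicator_of_mem h2, h.support σ t fun h3 => h1 ⟨h2, h3.2.le⟩]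
        simp
      · rw [indicator_of_notMem h2]
  rw [e1, ← integral_finsetSum _ (fun τ _ => i2 τ), ← integral_add i1
    (integrable_finsetSum _ fun τ _ => i2 τ), intervalIntegral.integral_of_le hx]
  refine integral_congr_ae (ae_of_all _ fun t => ?_)
  simp only [mul_add, Finset.mul_sum]

/-- The signed combinations of the Laplace transforms of the kernel solve a Riccati equation. -/
theorem exists_riccati (hκ : κ.re = k) {s : ℝ} (hs : s ^ 2 = 1) :
    ∃ w : ℝ → ℂ,
      w 0 = laplace (kernel f c false 0) κ + s * laplace (kernel f c true 0) κ ∧ w c = 0 ∧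
      HasPrim w (fun t => 2 * κ * w t -
        ((((f false t).toReal + s * (f true t).toReal : ℝ) : ℂ) + w t ^ 2)) 0 c ∧
      ∫ t in (0 : ℝ)..c, ‖w t‖ ≤ (Q + M ^ 2 * c) / (2 * k) := by
  have hsabs : |s| = 1 := by
    rw [← sq_eq_sq₀ (abs_nonneg _) zero_le_one, sq_abs, hs, one_pow]
  have hk := h.k_pos
  have hc := h.c_pos
  set L : Bool → ℝ → ℂ := fun σ x => laplace (kernel f c σ x) κ
  set p : ℝ → ℝ := fun t => (f false t).toReal + s * (f true t).toReal
  -- A sign s = ±1 is a character of ℤ/2, so this combination collapses the graded quadratic system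
  -- to one scalar equation; the mismatch is a multiple of s² - 1.
  set w : ℝ → ℂ := fun x => L false x + s * L true x with hw
  have hwb : ∀ t, ‖w t‖ ≤ M := by
    intro t
    refine (norm_add_le _ _).trans ?_
    rw [norm_mul, Complex.norm_real, Real.norm_eq_abs, hsabs, one_mul]
    exact h.norm_laplace_add_le hκ t
  have hwm : Measurable w := (measurable_laplace_kernel h.measurable κ false).add
    ((measurable_laplace_kernel h.measurable κ true).const_mul _)
  have hpi : Integrable p := (h.integrable_toReal false).add ((h.integrable_toReal true).const_mul s)
  have ip : IntervalIntegrable (fun t => ((p t : ℝ) : ℂ)) volume 0 c :=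
    ⟨hpi.ofReal.integrableOn, hpi.ofReal.integrableOn⟩
  have hwb2 : ∀ t, ‖w t ^ 2‖ ≤ M ^ 2 := fun t => by
    rw [norm_pow]
    exact pow_le_pow_left₀ (norm_nonneg _) (hwb t) 2
  have iw : IntervalIntegrable (fun t => w t ^ 2) volume 0 c := by
    rw [intervalIntegrable_iff_integrableOn_Ioc_of_le hc.le]
    exact Measure.integrableOn_of_bounded (M := M ^ 2) (by simp)
      (hwm.pow_const 2).aestronglyMeasurable (ae_of_all _ hwb2)
  have heq : ∀ x ∈ Icc 0 c, w x = ∫ t in x..c, Complex.exp (-2 * κ * (t - x : ℝ)) *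
      ((p t : ℂ) + w t ^ 2) := by
    intro x hx
    have hmono : ∀ {F : ℝ → ℂ}, IntervalIntegrable F volume 0 c →
        IntervalIntegrable (fun t : ℝ => Complex.exp (-2 * κ * (t - x : ℝ)) * F t) volume x c :=
      fun hF => (hF.mono_set (by
        rw [uIcc_of_le hx.2, uIcc_of_le hc.le]
        exact Icc_subset_Icc_left hx.1)).continuousOn_mul (by fun_prop)
    have iL : ∀ σ, IntervalIntegrable (fun t => ∑ τ, L τ t * L (xor σ τ) t) volume 0 c := by
      intro σ
      rw [intervalIntegrable_iff_integrableOn_Ioc_of_le hc.le]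
      refine Measure.integrableOn_of_bounded (M := M ^ 2) (by simp) ?_ (ae_of_all _ fun t => ?_)
      · exact (Finset.measurable_sum _ fun τ _ => (measurable_laplace_kernel h.measurable κ τ).mul
          (measurable_laplace_kernel h.measurable κ _)).aestronglyMeasurable
      · have h1 : ‖L false t‖ + ‖L true t‖ ≤ M := h.norm_laplace_add_le hκ t
        have h2 := norm_nonneg (L false t)
        have h3 := norm_nonneg (L true t)
        refine (norm_sum_le _ _).trans ?_
        simp only [norm_mul, Fintype.sum_bool]
        cases σ <;> simp <;> nlinarith
    have iF : ∀ σ, IntervalIntegrable (fun t => ((f σ t).toReal : ℂ)) volume 0 c := fun σ =>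
      ⟨(h.integrable_toReal σ).ofReal.integrableOn, (h.integrable_toReal σ).ofReal.integrableOn⟩
    have h1 := h.laplace_eq hκ false hx.2
    have h2 := h.laplace_eq hκ true hx.2
    simp only [hw]
    change L false x + s * L true x = _
    simp only [L] at h1 h2 ⊢
    rw [h1, h2, ← intervalIntegral.integral_const_mul, ← intervalIntegral.integral_add
      (hmono ((iF false).add (iL false))) ((hmono ((iF true).add (iL true))).const_mul _)]
    refine intervalIntegral.integral_congr fun t _ => ?_
    have hs' : (s : ℂ) ^ 2 = 1 := by exact_mod_cast hs
    simp only [Fintype.sum_bool, p]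
    push_cast
    simp only [Bool.xor_true, Bool.xor_false, Bool.not_true, Bool.not_false]
    linear_combination (-Complex.exp (-2 * κ * ((t : ℂ) - x)) *
      laplace (kernel f c true t) κ ^ 2) * hs'
  have hP := hasPrim_linear hc.le (ip.add iw) κ
  refine ⟨w, rfl, ?_, ?_, ?_⟩
  · rw [heq c ⟨hc.le, le_rfl⟩]; simp
  · refine (hP.congr_left fun x hx => (heq x hx).symm).congr_right ?_
    filter_upwards [ae_restrict_mem measurableSet_Ioc] with x hx
    rw [← heq x (Ioc_subset_Icc_self hx)]
  -- For the bound in mean, |w| is dominated by the solution V of V' = 2kV - g, V(c) = 0.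
  -- Integrating that equation and using V(0) ≥ 0 gives 2k ∫V ≤ ∫g.
  · set g : ℝ → ℝ := fun t => |p t| + M ^ 2
    have ig : IntervalIntegrable g volume 0 c :=
      IntervalIntegrable.add ⟨hpi.abs.integrableOn, hpi.abs.integrableOn⟩ intervalIntegrable_const
    set V : ℝ → ℝ := fun x => ∫ t in x..c, Real.exp (-2 * k * (t - x)) * g t
    have hV : ∀ x, ∫ t in x..c, Complex.exp (-2 * (k : ℂ) * (t - x : ℝ)) * (g t : ℂ) = (V x : ℂ) := by
      intro x
      simp only [V]
      rw [← intervalIntegral.integral_ofReal]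
      refine intervalIntegral.integral_congr fun t _ => ?_
      push_cast
      rfl
    have hPV := hasPrim_linear hc.le (g := fun t => (g t : ℂ)) ⟨ig.1.ofReal, ig.2.ofReal⟩ k
    simp only [hV] at hPV
    have hVc : ContinuousOn V (Icc 0 c) := by
      have := Complex.continuous_re.comp_continuousOn hPV.continuousOn
      simpa [Function.comp_def] using this
    have iV : IntervalIntegrable V volume 0 c :=
      (hVc.mono (by rw [uIcc_of_le hc.le])).intervalIntegrable
    have hVle : ∀ x ∈ Icc 0 c, ‖w x‖ ≤ V x := by
      intro x hx
      rw [heq x hx]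
      refine intervalIntegral.norm_integral_le_of_norm_le hx.2 (ae_of_all _ fun t _ => ?_) ?_
      · rw [norm_mul, norm_cexp_weight, hκ]
        gcongr
        refine (norm_add_le _ _).trans (add_le_add ?_ (hwb2 t))
        rw [Complex.norm_real, Real.norm_eq_abs]
      · exact (ig.mono_set (by
          rw [uIcc_of_le hx.2, uIcc_of_le hc.le]
          exact Icc_subset_Icc_left hx.1)).continuousOn_mul (by fun_prop)
    have h0 := hPV.integral_eq
    have e1 : ∀ t, 2 * (k : ℂ) * (V t : ℂ) - (g t : ℂ) = ((2 * k * V t - g t : ℝ) : ℂ) := fun t => by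
      push_cast; ring
    simp_rw [e1] at h0
    rw [intervalIntegral.integral_ofReal] at h0
    have h1 : ∫ t in (0 : ℝ)..c, (2 * k * V t - g t) = V c - V 0 := by exact_mod_cast h0
    rw [intervalIntegral.integral_sub (iV.const_mul _) ig, intervalIntegral.integral_const_mul] at h1
    have h2 : V c = 0 := by simp [V]
    have h3 : 0 ≤ V 0 := (norm_nonneg _).trans (hVle 0 ⟨le_rfl, hc.le⟩)
    have h4 : ∫ t in (0 : ℝ)..c, g t ≤ Q + M ^ 2 * c := by
      simp only [g]
      rw [intervalIntegral.integral_add ⟨hpi.abs.integrableOn, hpi.abs.integrableOn⟩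
        intervalIntegrable_const, intervalIntegral.integral_const, smul_eq_mul, sub_zero,
        mul_comm c]
      gcongr
      refine le_trans ?_ h.integral_toReal_le
      rw [← integral_add (h.integrable_toReal _) (h.integrable_toReal _),
        intervalIntegral.integral_of_le hc.le]
      refine (setIntegral_le_integral hpi.abs (ae_of_all _ fun t => abs_nonneg _)).trans ?_
      refine integral_mono hpi.abs ((h.integrable_toReal _).add (h.integrable_toReal _)) fun t => ?_
      simp only [p]
      refine (abs_add_le _ _).trans ?_
      rw [abs_mul, hsabs, one_mul, abs_of_nonneg ENNReal.toReal_nonneg,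
        abs_of_nonneg ENNReal.toReal_nonneg]
    rw [le_div_iff₀ (by positivity), mul_comm]
    have iwn : IntervalIntegrable (fun t => ‖w t‖) volume 0 c := by
      rw [intervalIntegrable_iff_integrableOn_Ioc_of_le hc.le]
      exact Measure.integrableOn_of_bounded (M := M) (by simp)
        hwm.norm.aestronglyMeasurable (ae_of_all _ fun t => by simpa using hwb t)
    have h5 : ∫ t in (0 : ℝ)..c, ‖w t‖ ≤ ∫ t in (0 : ℝ)..c, V t :=
      intervalIntegral.integral_mono_on hc.le iwn iV hVle
    nlinarith

end KernelData

end

/-! ### Comparison of Riccati solutions on the ray κ = r(1 - i) -/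

section

open scoped ENNReal

/-- Extending w by constants outside [0, c] gives a primitive with two-sided derivatives at the
endpoints also. -/
theorem exists_hasDerivAt_of_continuousOn {w : ℝ → ℂ} {c : ℝ} (hc : 0 ≤ c)
    (hw : ContinuousOn w (Icc 0 c)) :
    ∃ N : ℝ → ℂ, N 0 = 0 ∧ (∀ x ∈ Icc 0 c, HasDerivAt N (w x) x) ∧
      ∀ x ∈ Icc 0 c, ‖N x‖ ≤ ∫ t in (0 : ℝ)..c, ‖w t‖ := by
  set W : ℝ → ℂ := IccExtend hc ((Icc 0 c).domRestrict w)
  have hW : Continuous W := hw.domRestrict.Icc_extend'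
  have e : ∀ x ∈ Icc 0 c, W x = w x := fun x hx => by
    simp only [W, IccExtend_of_mem hc _ hx, domRestrict_apply]
  refine ⟨fun x => ∫ t in (0 : ℝ)..x, W t, by simp, fun x hx => ?_, fun x hx => ?_⟩
  · rw [← e x hx]
    exact hW.integral_hasStrictDerivAt 0 x |>.hasDerivAt
  · have e2 : ∫ t in (0 : ℝ)..c, ‖w t‖ = ∫ t in (0 : ℝ)..c, ‖W t‖ :=
      intervalIntegral.integral_congr fun t ht => by
        rw [uIcc_of_le hc] at ht
        simp only [e t ht]
    rw [e2]
    refine (intervalIntegral.norm_integral_le_integral_norm hx.1).trans ?_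
    exact intervalIntegral.integral_mono_interval le_rfl hx.1 hx.2
      (ae_of_all _ fun t => norm_nonneg _) (hW.norm.intervalIntegrable _ _)

/-- The elementary estimate behind the comparison of two solutions of the Riccati equation of which
one has its imaginary part in the upper half-plane at the right endpoint. -/
theorem norm_le_ten {T δ : ℂ} {θ : ℝ} (hθ : θ ≤ 1 / 20) (hδ : ‖δ‖ ≤ θ * ‖T‖)
    (h : 0 ≤ ((1 - Complex.I) * (conj (1 + (T / 2 + δ)) * (T - (1 + (T / 2 + δ))))).im) :
    ‖T‖ ≤ 10 := by
  have hδ' : ‖δ‖ ≤ ‖T‖ / 20 := by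
    have := mul_le_mul_of_nonneg_right hθ (norm_nonneg T)
    linarith
  have hT := Complex.sq_norm T
  have hd := Complex.sq_norm δ
  rw [Complex.normSq_apply] at hT hd
  have a1 := Complex.abs_re_le_norm T
  have a2 := Complex.abs_im_le_norm T
  have a3 := Complex.abs_re_le_norm δ
  have a4 := Complex.abs_im_le_norm δ
  simp only [Complex.mul_im, Complex.sub_re, Complex.one_re, Complex.I_re, Complex.sub_im,
    Complex.one_im, Complex.I_im, Complex.mul_re, Complex.conj_re, Complex.conj_im, Complex.add_re,
    Complex.add_im, Complex.div_ofNat_re, Complex.div_ofNat_im] at h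
  set t := ‖T‖
  set a := T.re
  set b := T.im
  set x := δ.re
  set y := δ.im
  have ht : 0 ≤ t := norm_nonneg T
  have b1 := abs_le.1 a1
  have b2 := abs_le.1 a2
  have hx : |x| ≤ t / 20 := a3.trans hδ'
  have hy : |y| ≤ t / 20 := a4.trans hδ'
  have c1 : |x * b| ≤ t / 20 * t := by rw [abs_mul]; gcongr
  have c2 : |y * a| ≤ t / 20 * t := by rw [abs_mul]; gcongr
  have d1 := abs_le.1 c1
  have d2 := abs_le.1 c2
  have d3 := abs_le.1 hx
  have d4 := abs_le.1 hy
  -- For δ = 0 the hypothesis reads |T|²/4 ≤ 1 + Im T, which bounds T; the factor 1 - i is what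
  -- makes the quadratic term negative. The remaining terms are the perturbation by δ.
  have key : t ^ 2 / 4 ≤ 1 + b + (2 * x + x ^ 2 + y ^ 2) + (x * b - y * a) := by
    linarith
  have n1 : x ^ 2 + y ^ 2 ≤ (t / 20) ^ 2 := by
    have := pow_le_pow_left₀ (norm_nonneg δ) hδ' 2
    linarith
  by_contra hcon
  have : 10 < t := not_le.1 hcon
  nlinarith

/-- Two solutions of the Riccati equation on the ray `κ = r (1 - i)`: one with `-κ` as its value
at `c`, the other from a solution of the Schrödinger equation with nonnegative flux at `c`. -/
theorem norm_sub_le_of_riccati {r c ν : ℝ} {p : ℝ → ℝ} {w u du : ℝ → ℂ} {κ : ℂ} (hr : 0 < r)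
    (hκ : κ = r * (1 - Complex.I))
    (hw : HasPrim w (fun t => 2 * κ * w t - ((p t : ℂ) + w t ^ 2)) 0 c) (hwc : w c = 0)
    (hu : HasPrim u du 0 c) (hdu : HasPrim du (fun t => (-(p t : ℂ) + κ ^ 2) * u t) 0 c)
    (hu0 : u 0 ≠ 0) (hflux : 0 ≤ flux u du c)
    (hν : ∫ t in (0 : ℝ)..c, ‖w t‖ ≤ ν)
    (hθ : Real.exp (2 * ν - 2 * r * c) / 2 + ν * Real.exp (4 * ν) ≤ 1 / 20) :
    ‖du 0 / u 0 - (-κ + w 0)‖ ≤ 10 * ‖κ‖ * Real.exp (2 * ν) * Real.exp (-2 * r * c) := by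
  have hc := hw.le
  have c0 : (0 : ℝ) ∈ Icc 0 c := ⟨le_rfl, hc⟩
  have cc : c ∈ Icc 0 c := ⟨hc, le_rfl⟩
  have hκre : κ.re = r := by simp [hκ]
  have hκ0 : κ ≠ 0 := fun h0 => by simp [h0] at hκre; linarith
  obtain ⟨N, hN0, hN, hNb⟩ := exists_hasDerivAt_of_continuousOn hc hw.continuousOn
  have hid : ∀ x : ℝ, HasDerivAt (fun x : ℝ => (x : ℂ)) 1 x := fun x =>
    Complex.ofRealCLM.hasDerivAt
  have hNc : ContinuousOn N (Icc 0 c) := fun x hx => (hN x hx).continuousAt.continuousWithinAt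
  -- E solves the same Schrödinger equation, with logarithmic derivative -κ + w, and F = 1/E. The
  -- defect ρ = u' - (-κ + w)u is a multiple of F, so reduction of order gives (uF)' = ρ(0)F².
  set E : ℝ → ℂ := fun x => Complex.exp (-κ * x + N x)
  set F : ℝ → ℂ := fun x => Complex.exp (κ * x - N x)
  have hE : HasPrim E (fun x => (-κ + w x) * E x) 0 c := by
    refine HasPrim.of_hasDerivAt hc (fun x hx => ?_) ?_
    · have := (((hid x).const_mul (-κ)).add (hN x hx)).cexp
      rw [mul_comm] at this
      refine this.congr_deriv ?_
      simp only [E, Pi.add_apply]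
      ring
    · have := hw.continuousOn
      fun_prop
  have hF : HasPrim F (fun x => -(-κ + w x) * F x) 0 c := by
    refine HasPrim.of_hasDerivAt hc (fun x hx => ?_) ?_
    · have := (((hid x).const_mul κ).sub (hN x hx)).cexp
      rw [mul_comm] at this
      refine this.congr_deriv ?_
      simp only [F, Pi.sub_apply]
      ring
    · have := hw.continuousOn
      fun_prop
  have hEF : ∀ x, E x * F x = 1 := fun x => by
    simp only [E, F]; rw [← Complex.exp_add]; simp
  have hE0 : E 0 = 1 := by simp [E, hN0]
  have hF0 : F 0 = 1 := by simp [F, hN0]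
  set ρ : ℝ → ℂ := fun x => du x - (-κ + w x) * u x
  have hρ : HasPrim ρ (fun x => -(-κ + w x) * ρ x) 0 c := by
    have h1 := hdu.sub (((HasPrim.const (-κ) hc).add hw).mul hu)
    refine h1.congr_right (ae_of_all _ fun x => ?_)
    simp only [ρ]; ring
  have hρE : ∀ x ∈ Icc 0 c, ρ x = ρ 0 * F x := fun x hx => by
    have h1 := (hρ.mul hE).eq_of_zero (fun y _ => by ring) hx
    simp only [hE0, mul_one] at h1
    rw [← h1, mul_assoc, hEF, mul_one]
  set y : ℝ → ℂ := fun x => F x * F x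
  have hy : HasPrim y (fun x => (2 * κ - 2 * w x) * y x) 0 c := by
    refine (hF.mul hF).congr_right (ae_of_all _ fun x => ?_)
    simp only [y]; ring
  have hyc : ContinuousOn y (Icc 0 c) := hy.continuousOn
  have iy : IntervalIntegrable y volume 0 c :=
    (hyc.mono (by rw [uIcc_of_le hc])).intervalIntegrable
  have iwy : IntervalIntegrable (fun x => w x * y x) volume 0 c :=
    ((hw.continuousOn.mul hyc).mono (by rw [uIcc_of_le hc])).intervalIntegrable
  set Y := ∫ x in (0 : ℝ)..c, y x
  have huF : u c * F c = u 0 + ρ 0 * Y := by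
    have h1 : HasPrim (fun x => u x * F x) (fun x => ρ 0 * y x) 0 c := by
      refine (hu.mul hF).congr_right ?_
      filter_upwards [ae_restrict_mem measurableSet_Ioc] with x hx
      have := hρE x (Ioc_subset_Icc_self hx)
      simp only [y]
      rw [← mul_assoc (ρ 0), ← this]
      simp only [ρ]; ring
    have h2 := h1.integral_eq
    rw [intervalIntegral.integral_const_mul, hF0, mul_one] at h2
    rw [h2]; ring
  -- As F² has logarithmic derivative 2κ - 2w with w small in mean, κ∫F² is half of F(c)² up to a
  -- small relative error.
  have hY : κ * Y - y c / 2 = -1 / 2 + ∫ x in (0 : ℝ)..c, w x * y x := by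
    have h1 := hy.integral_eq
    have e : ∀ x, (2 * κ - 2 * w x) * y x = 2 * κ * y x - 2 * (w x * y x) := fun x => by ring
    simp_rw [e] at h1
    rw [intervalIntegral.integral_sub (iy.const_mul _) (iwy.const_mul _),
      intervalIntegral.integral_const_mul, intervalIntegral.integral_const_mul] at h1
    have : y 0 = 1 := by simp [y, hF0]
    rw [this] at h1
    linear_combination h1 / 2
  have hyn : ∀ x, ‖y x‖ = Real.exp (2 * r * x - 2 * (N x).re) := fun x => by
    simp only [y, F]
    rw [← Complex.exp_add, Complex.norm_exp]
    congr 1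
    simp [hκre]; ring
  have hNre : ∀ x ∈ Icc 0 c, |(N x).re| ≤ ν := fun x hx =>
    (Complex.abs_re_le_norm _).trans ((hNb x hx).trans hν)
  have hyge : Real.exp (2 * r * c - 2 * ν) ≤ ‖y c‖ := by
    rw [hyn, Real.exp_le_exp]
    linarith [(abs_le.1 (hNre c cc)).2]
  have hyle : ∀ x ∈ Icc 0 c, ‖y x‖ ≤ Real.exp (2 * r * c + 2 * ν) := fun x hx => by
    rw [hyn, Real.exp_le_exp]
    have := (abs_le.1 (hNre x hx)).1
    nlinarith [hx.2]
  have hν0 : 0 ≤ ν := (norm_nonneg _).trans ((hNb 0 c0).trans hν)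
  set θ := Real.exp (2 * ν - 2 * r * c) / 2 + ν * Real.exp (4 * ν)
  have hYb : ‖κ * Y - y c / 2‖ ≤ θ * ‖y c‖ := by
    have h1 : ‖∫ x in (0 : ℝ)..c, w x * y x‖ ≤ ν * Real.exp (2 * r * c + 2 * ν) := by
      refine (intervalIntegral.norm_integral_le_integral_norm hc).trans ?_
      refine le_trans ?_ (mul_le_mul_of_nonneg_right hν (Real.exp_pos _).le)
      rw [← intervalIntegral.integral_mul_const]
      have hwi : IntervalIntegrable (fun x => ‖w x‖) volume 0 c :=
        (hw.continuousOn.norm.mono (by rw [uIcc_of_le hc])).intervalIntegrable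
      refine intervalIntegral.integral_mono_on hc iwy.norm (hwi.mul_const _) fun x hx => ?_
      rw [norm_mul]
      gcongr
      exact hyle x hx
    have h2 : ‖(-1 / 2 : ℂ)‖ = 1 / 2 := by norm_num
    have h3 : Real.exp (2 * r * c + 2 * ν) = Real.exp (4 * ν) * Real.exp (2 * r * c - 2 * ν) := by
      rw [← Real.exp_add]; congr 1; ring
    have h4 : 1 = Real.exp (2 * ν - 2 * r * c) * Real.exp (2 * r * c - 2 * ν) := by
      rw [← Real.exp_add]; simp
    rw [hY]
    refine (norm_add_le _ _).trans ((add_le_add h2.le h1).trans ?_)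
    refine le_trans (le_of_eq ?_) (mul_le_mul_of_nonneg_left hyge (by positivity : 0 ≤ θ))
    rw [h3]
    simp only [θ]
    linear_combination h4 / 2
  have hyc0 : y c ≠ 0 := by
    rw [← norm_pos_iff]
    exact (Real.exp_pos _).trans_le hyge
  set d := ρ 0 / u 0
  have hd : du 0 / u 0 - (-κ + w 0) = d := by
    simp only [d, ρ]
    field_simp
  -- In these variables u(c) and u'(c) are a common factor times 1 + T/2 + δ and κ(T - (1 + T/2 +
  -- δ)), using w(c) = 0. Nonnegative flux at c is then exactly the hypothesis of `norm_le_ten`, and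
  -- a bounded T makes d of size |κ|/|F(c)|².
  set T := d * y c / κ
  set δ := d * (κ * Y - y c / 2) / κ
  have hD : d * Y = T / 2 + δ := by
    simp only [T, δ]
    field_simp
    ring
  have hδ : ‖δ‖ ≤ θ * ‖T‖ := by
    simp only [δ, T, norm_div, norm_mul]
    have := mul_le_mul_of_nonneg_left hYb (div_nonneg (norm_nonneg d) (norm_nonneg κ))
    calc ‖d‖ * ‖κ * Y - y c / 2‖ / ‖κ‖ = ‖d‖ / ‖κ‖ * ‖κ * Y - y c / 2‖ := by ring
      _ ≤ ‖d‖ / ‖κ‖ * (θ * ‖y c‖) := this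
      _ = _ := by ring
  have hρ0 : ρ 0 = d * u 0 := by simp only [d]; field_simp
  have huc : u c = u 0 * E c * (1 + d * Y) := by
    calc u c = u c * (E c * F c) := by rw [hEF, mul_one]
      _ = E c * (u c * F c) := by ring
      _ = _ := by rw [huF, hρ0]; ring
  have hduc : du c = u 0 * E c * (κ * (T - (1 + d * Y))) := by
    have h1 : du c = ρ 0 * F c - κ * u c := by
      have := hρE c cc
      simp only [ρ, hwc, add_zero] at this ⊢
      rw [← this]; ring
    have h2 : κ * T = d * (F c * F c) := by simp only [T, y]; field_simp
    rw [h1, huc, hρ0, mul_sub, h2]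
    linear_combination (-d * u 0 * F c) * hEF c
  have hfl : flux u du c = ‖u 0 * E c‖ ^ 2 * r *
      ((1 - Complex.I) * (conj (1 + (T / 2 + δ)) * (T - (1 + (T / 2 + δ))))).im := by
    unfold flux
    rw [huc, hduc, hD]
    have e : conj (u 0 * E c * (1 + (T / 2 + δ))) *
        (u 0 * E c * (κ * (T - (1 + (T / 2 + δ))))) = ((‖u 0 * E c‖ ^ 2 * r : ℝ) : ℂ) *
        ((1 - Complex.I) * (conj (1 + (T / 2 + δ)) * (T - (1 + (T / 2 + δ))))) := by
      push_cast
      rw [← Complex.mul_conj', map_mul (starRingEnd ℂ) (u 0 * E c), hκ]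
      ring
    rw [e, Complex.im_ofReal_mul]
  have hpos : 0 < ‖u 0 * E c‖ ^ 2 * r := by
    have : u 0 * E c ≠ 0 := mul_ne_zero hu0 (Complex.exp_ne_zero _)
    have := norm_pos_iff.2 this
    positivity
  have hT10 := norm_le_ten hθ hδ (by
    rw [hfl] at hflux
    exact (mul_nonneg_iff_of_pos_left hpos).1 hflux)
  have hdT : ‖d‖ * ‖y c‖ = ‖T‖ * ‖κ‖ := by
    simp only [T, norm_div, norm_mul]
    have := norm_pos_iff.2 hκ0
    field_simp
  rw [hd]
  have h5 : ‖d‖ * Real.exp (2 * r * c - 2 * ν) ≤ 10 * ‖κ‖ := by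
    refine (mul_le_mul_of_nonneg_left hyge (norm_nonneg d)).trans ?_
    rw [hdT]
    gcongr
  have h6 : Real.exp (2 * ν) * Real.exp (-2 * r * c) * Real.exp (2 * r * c - 2 * ν) = 1 := by
    rw [← Real.exp_add, ← Real.exp_add, Real.exp_eq_one_iff]; ring
  calc ‖d‖ = ‖d‖ * Real.exp (2 * r * c - 2 * ν) * (Real.exp (2 * ν) * Real.exp (-2 * r * c)) := by
        linear_combination -‖d‖ * h6
    _ ≤ 10 * ‖κ‖ * (Real.exp (2 * ν) * Real.exp (-2 * r * c)) := by gcongr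
    _ = _ := by ring

end

/-! ### Identification of the amplitude with the kernel -/

section

open scoped ENNReal

/-- The function equal to ∞ on α > 0 and 0 elsewhere is a supersolution: for α ≤ 0 and t > x the two
arguments of the convolution have negative sum, so one factor vanishes. -/
theorem kernel_of_nonpos {f : Bool → ℝ → ℝ≥0∞} {c : ℝ} (hf : ∀ σ, Measurable (f σ)) (σ : Bool)
    (x : ℝ) {α : ℝ} (hα : α ≤ 0) : kernel f c σ x α = 0 := by
  have h := sum_kernel_le (c := c) hf (B := (Ioi (0 : ℝ)).indicator fun _ => ∞) (x₀ := x)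
    (fun y β _ => ?_) le_rfl α
  · rw [indicator_of_notMem (by simpa using hα)] at h
    exact le_zero_iff.1 ((Finset.single_le_sum (f := fun σ => kernel f c σ x α)
      (fun _ _ => zero_le) (Finset.mem_univ σ)).trans h)
  · by_cases hβ : 0 < β
    · rw [indicator_of_mem (a := β) (f := fun _ => ∞) (mem_Ioi.2 hβ)]
      exact le_top
    · have h1 : β ∉ Ioi (0 : ℝ) := hβ
      rw [indicator_of_notMem h1, indicator_of_notMem h1, zero_add]
      refine le_of_eq ?_
      refine (setLIntegral_congr_fun measurableSet_Ioc fun t ht => ?_).trans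
        (lintegral_zero (μ := volume.restrict (Ioc y c)))
      refine (lintegral_congr fun τ => ?_).trans lintegral_zero
      by_cases hτ : 0 < τ
      · rw [indicator_of_notMem (a := β + y - t - τ), mul_zero]
        simp only [mem_Ioi, not_lt] at hβ ⊢
        linarith [ht.1]
      · rw [indicator_of_notMem (a := τ) (by simpa using hτ), zero_mul]

/-- The truncation error of a Laplace transform. -/
theorem norm_laplace_sub_le {g : ℝ → ℝ≥0∞} (hg : Measurable g) (h0 : ∀ α ≤ 0, g α = 0) {k c : ℝ}
    {κ : ℂ} (hc : 0 < c) (hfin : ∫⁻ α, expWeight k α * g α ≠ ∞)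
    (hfin' : ∫⁻ α, expWeight κ.re α * g α ≠ ∞) (hk : k ≤ κ.re) :
    ‖laplace g κ - ∫ α in Ioo 0 c, ((g α).toReal : ℂ) * Complex.exp (-2 * κ * α)‖ ≤
      Real.exp (-2 * c * (κ.re - k)) * ∫ α, (g α).toReal * Real.exp (-2 * k * α) := by
  have hi := integrable_laplace hg hfin'
  have hik : Integrable fun α : ℝ => (g α).toReal * Real.exp (-2 * k * α) := by
    have := (integrable_laplace (κ := (k : ℂ)) hg hfin).norm
    refine this.congr (ae_of_all _ fun α => ?_)
    simp only [norm_mul, norm_cexp_weight, Complex.norm_real, Complex.ofReal_re, Real.norm_eq_abs,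
      abs_of_nonneg ENNReal.toReal_nonneg]
  have e1 : laplace g κ = ∫ α in Ioi 0, ((g α).toReal : ℂ) * Complex.exp (-2 * κ * α) := by
    rw [← integral_indicator measurableSet_Ioi, laplace]
    congr 1
    ext α
    by_cases hα : α ∈ Ioi (0 : ℝ)
    · rw [indicator_of_mem hα]
    · rw [indicator_of_notMem hα, h0 α (not_lt.1 hα)]
      simp
  have e2 : Ioo 0 c ∪ Ici c = Ioi 0 := Ioo_union_Ici_eq_Ioi hc
  rw [e1, ← e2, setIntegral_union (by
    rw [Set.disjoint_left]
    exact fun x hx hx' => absurd hx.2 (not_lt.2 hx')) measurableSet_Ici hi.integrableOn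
    hi.integrableOn, add_sub_cancel_left, ← integral_const_mul]
  refine (norm_integral_le_of_norm_le (hik.const_mul _).integrableOn (g := fun α =>
    Real.exp (-2 * c * (κ.re - k)) * ((g α).toReal * Real.exp (-2 * k * α))) ?_).trans
    (setIntegral_le_integral (hik.const_mul _) (ae_of_all _ fun α => by positivity))
  filter_upwards [ae_restrict_mem measurableSet_Ici] with α hα
  rw [norm_mul, norm_cexp_weight, Complex.norm_real, Real.norm_eq_abs,
    abs_of_nonneg ENNReal.toReal_nonneg, mul_left_comm]
  gcongr
  rw [← Real.exp_add, Real.exp_le_exp]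
  have := mul_le_mul_of_nonneg_right (mem_Ici.1 hα) (sub_nonneg.2 hk)
  linarith

/-- The ray has argument -π/4, strictly between -3π/8 and -π/8. -/
theorem tendsto_sectorInfinity :
    Tendsto (fun r : ℝ => (r : ℂ) * (1 - Complex.I)) atTop (sectorInfinity (Real.pi / 8)) := by
  have e : ∀ r : ℝ, (r : ℂ) * (1 - Complex.I) = ((r * √2 : ℝ) : ℂ) *
      (Complex.cos ((-(Real.pi / 4) : ℝ) : ℂ) + Complex.sin ((-(Real.pi / 4) : ℝ) : ℂ) *
        Complex.I) := fun r => by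
    rw [← Complex.ofReal_cos, ← Complex.ofReal_sin, Real.cos_neg, Real.sin_neg, Real.cos_pi_div_four,
      Real.sin_pi_div_four]
    have h2 : ((√2 : ℝ) : ℂ) * ((√2 : ℝ) : ℂ) = 2 := by
      rw [← Complex.ofReal_mul, Real.mul_self_sqrt zero_le_two]; simp
    push_cast
    linear_combination (-(r : ℂ) * (1 - Complex.I) / 2) * h2
  have hpi := Real.pi_pos
  refine tendsto_inf.2 ⟨tendsto_comap_iff.2 ?_, tendsto_principal.2 ?_⟩
  · have : Tendsto (fun r : ℝ => |r| * ‖1 - Complex.I‖) atTop atTop :=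
      tendsto_abs_atTop_atTop.atTop_mul_const (norm_pos_iff.2 fun h => by
        simpa using congrArg Complex.re h)
    refine this.congr fun r => ?_
    simp
  · filter_upwards [eventually_gt_atTop (0 : ℝ)] with r hr
    rw [e, Complex.arg_mul_cos_add_sin_mul_I (by positivity)
      ⟨by linarith, by linarith⟩]
    constructor <;> linarith

/-- A value of `m` different from `0` comes from a solution that does not vanish at `0`. -/
theorem exists_of_weylM_ne_zero {q : ℝ → ℝ} {B : RightEnd} {z : ℂ} (h : weylM q B z ≠ 0) :
    ∃ u du, IsSolution B.dom q z u du ∧ B.Satisfies u du ∧ u 0 ≠ 0 ∧ weylM q B z = du 0 / u 0 := by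
  unfold weylM at h ⊢
  split_ifs at h ⊢ with hex
  · obtain ⟨u, du, hu, hs, he⟩ := hex.choose_spec
    refine ⟨u, du, hu.1, hs, fun h0 => h ?_, he⟩
    rw [he, h0, div_zero]
  · exact absurd rfl h

/-- The asymptotics of `m` along the ray `κ = r (1 - i)`. -/
theorem IsAmplitude.eventually_le {q A : ℝ → ℝ} {B : RightEnd} (hA : IsAmplitude q B A) {c : ℝ}
    (hc : 0 < c) (hcb : (c : EReal) < B.b) {δ : ℝ} (hδ : 0 < δ) :
    ∀ᶠ r : ℝ in atTop, ‖weylM q B (-((r : ℂ) * (1 - Complex.I)) ^ 2) -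
      (-((r : ℂ) * (1 - Complex.I)) -
        ∫ α in Ioo 0 c, (A α : ℂ) * Complex.exp (-2 * (α : ℂ) * (r * (1 - Complex.I))))‖ *
      Real.exp (2 * c * r) ≤ Real.exp (δ * r) := by
  have h := ((hA.asymptotics c hc hcb (Real.pi / 8) (by positivity)).2 (δ / (2 * c))
    (by positivity)).comp tendsto_sectorInfinity
  have h1 := h.norm.eventually_lt_const (u := 1) (by rw [norm_zero]; exact one_pos)
  filter_upwards [h1] with r hr
  simp only [Function.comp_def] at hr
  rw [intervalIntegral.integral_of_le hc.le, integral_Ioc_eq_integral_Ioo, norm_mul, norm_div,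
    Complex.norm_real, Real.norm_eq_abs, abs_of_nonneg (by positivity), Complex.norm_exp] at hr
  have e1 : (-2 * (c : ℂ) * (r * (1 - Complex.I))).re = -2 * c * r := by simp
  rw [e1, ← Real.exp_mul, div_eq_mul_inv, ← Real.exp_neg] at hr
  have e2 : Real.exp (-(-2 * c * r)) = Real.exp (2 * c * r) := by ring_nf
  have e3 : Real.exp (-2 * c * r * (δ / (2 * c))) = (Real.exp (δ * r))⁻¹ := by
    rw [← Real.exp_neg]; congr 1; field_simp
  rw [e2, e3, ← div_eq_mul_inv, div_lt_one (Real.exp_pos _)] at hr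
  exact hr.le

/-- The asymptotics force m to be close to -κ - ∫A e^{-2ακ}, which is large. Hence the default value
0 is excluded and m comes from an actual solution with u(0) ≠ 0; existence of that solution need not
be proved separately. -/
theorem IsAmplitude.eventually_weylM_ne_zero {q A : ℝ → ℝ} {B : RightEnd} (hA : IsAmplitude q B A)
    {c : ℝ} (hc : 0 < c) (hcb : (c : EReal) < B.b) :
    ∀ᶠ r : ℝ in atTop, weylM q B (-((r : ℂ) * (1 - Complex.I)) ^ 2) ≠ 0 := by
  filter_upwards [hA.eventually_le hc hcb (δ := 2 * c) (by positivity),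
    eventually_gt_atTop (1 + ∫ α in Ioo 0 c, |A α|), eventually_gt_atTop 0] with r h1 h2 h3 h0
  rw [h0] at h1
  set J := ∫ α in Ioo 0 c, (A α : ℂ) * Complex.exp (-2 * (α : ℂ) * (r * (1 - Complex.I)))
  have h4 : ‖(r : ℂ) * (1 - Complex.I) + J‖ ≤ 1 := by
    have e : (r : ℂ) * (1 - Complex.I) + J = 0 - (-((r : ℂ) * (1 - Complex.I)) - J) := by ring
    rw [e]
    exact le_of_mul_le_mul_right (h1.trans_eq (one_mul _).symm) (Real.exp_pos _)
  have h5 : ‖J‖ ≤ ∫ α in Ioo 0 c, |A α| := by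
    refine norm_integral_le_of_norm_le (hA.integrable c hc hcb).abs ?_
    filter_upwards [ae_restrict_mem measurableSet_Ioo] with α hα
    rw [norm_mul, Complex.norm_real, Real.norm_eq_abs, Complex.norm_exp]
    refine mul_le_of_le_one_right (abs_nonneg _) (Real.exp_le_one_iff.2 ?_)
    have : (-2 * (α : ℂ) * (r * (1 - Complex.I))).re = -(2 * (α * r)) := by simp; ring
    rw [this]
    have := mul_pos hα.1 h3
    linarith
  have h6 : r ≤ ‖(r : ℂ) * (1 - Complex.I)‖ := by
    refine le_trans (le_of_eq ?_) (Complex.re_le_norm _)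
    simp
  have h7 := norm_sub_norm_le ((r : ℂ) * (1 - Complex.I)) (-J)
  rw [sub_neg_eq_add, norm_neg] at h7
  linarith

/-- The `A`-amplitude is, on `(0, c)`, the negative of a signed combination of the kernels. -/
theorem IsAmplitude.ae_eq_kernel {q A : ℝ → ℝ} {B : RightEnd} {f : Bool → ℝ → ℝ≥0∞} {c Q s : ℝ}
    (hB : B.Admissible q) (hA : IsAmplitude q B A) (hc : 0 < c) (hcb : (c : EReal) < B.b)
    (hf : ∀ σ, Measurable (f σ)) (hsupp : ∀ σ t, t ∉ Ioo 0 c → f σ t = 0) (hQ : 0 ≤ Q)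
    (hfQ : ∑ σ, ∫⁻ t, f σ t ≤ ENNReal.ofReal Q) (hs : s ^ 2 = 1)
    (hp : ∀ᵐ t ∂volume.restrict (Ioo 0 c), (f false t).toReal + s * (f true t).toReal = -q t) :
    ∀ᵐ α ∂volume.restrict (Ioo 0 c),
      A α = -((kernel f c false 0 α).toReal + s * (kernel f c true 0 α).toReal) := by
  have hsabs : |s| = 1 := by
    rw [← sq_eq_sq₀ (abs_nonneg _) zero_le_one, sq_abs, hs, one_pow]
  -- With M = 2Q + 1 and k ≥ M² the quadratic term is at most 1/2, and Q + 1/2 ≤ M.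
  set M := 2 * Q + 1
  have hM1 : 1 ≤ M := by simp only [M]; linarith
  have hdata : ∀ k, M ^ 2 ≤ k → KernelData f c Q M k := fun k hk => by
    have hk0 : 0 < k := lt_of_lt_of_le (by positivity) hk
    refine ⟨hf, hsupp, hc, hk0, hQ, hfQ, ?_⟩
    have : M ^ 2 / (2 * k) ≤ 1 / 2 := by
      rw [div_le_div_iff₀ (by positivity) (by positivity)]; linarith
    simp only [M] at this ⊢
    linarith
  set k₀ := M ^ 2
  set κ : ℝ → ℂ := fun r => (r : ℂ) * (1 - Complex.I)
  have hκre : ∀ r, (κ r).re = r := fun r => by simp [κ]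
  have hmk : ∀ σ, Measurable (kernel f c σ 0) := fun σ =>
    (measurable_kernel hf σ).comp (f := fun α => ((0 : ℝ), α)) (by fun_prop)
  set K : Bool → ℝ → ℝ := fun σ α => (kernel f c σ 0 α).toReal
  have hKi : ∀ σ r, k₀ ≤ r → Integrable fun α : ℝ => (K σ α : ℂ) * Complex.exp (-2 * κ r * α) :=
    fun σ r hr => integrable_laplace (hmk σ) (by
      rw [hκre]; exact (hdata r hr).lintegral_kernel_ne_top σ 0)
  have hKI : ∀ σ, IntegrableOn (K σ) (Ioo 0 c) := by
    intro σ
    have h1 := (integrable_laplace (κ := (k₀ : ℂ)) (hmk σ)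
      ((hdata k₀ le_rfl).lintegral_kernel_ne_top σ 0)).norm.integrableOn (s := Ioo 0 c)
    have h2 : IntegrableOn (fun α : ℝ => ‖((kernel f c σ 0 α).toReal : ℂ) *
        Complex.exp (-2 * (k₀ : ℂ) * α)‖ * Real.exp (2 * k₀ * α)) (Ioo 0 c) := by
      rw [← intervalIntegrable_iff_integrableOn_Ioo_of_le hc.le] at h1 ⊢
      exact h1.mul_continuousOn (by fun_prop)
    refine h2.congr_fun (fun α _ => ?_) measurableSet_Ioo
    simp only [norm_mul, norm_cexp_weight, Complex.norm_real, Complex.ofReal_re, Real.norm_eq_abs,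
      abs_of_nonneg ENNReal.toReal_nonneg]
    rw [mul_assoc, ← Real.exp_add]
    simp [K]
  set C₁ : Bool → ℝ := fun σ => Real.exp (2 * c * k₀) *
    ∫ α, (kernel f c σ 0 α).toReal * Real.exp (-2 * k₀ * α)
  have htail : ∀ σ r, k₀ ≤ r → ‖laplace (kernel f c σ 0) (κ r) -
      ∫ α in Ioo 0 c, (K σ α : ℂ) * Complex.exp (-2 * κ r * α)‖ * Real.exp (2 * c * r) ≤ C₁ σ := by
    intro σ r hr
    have := norm_laplace_sub_le (κ := κ r) (hmk σ) (fun α hα => kernel_of_nonpos hf σ 0 hα) hc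
      ((hdata k₀ le_rfl).lintegral_kernel_ne_top σ 0)
      (by rw [hκre]; exact (hdata r hr).lintegral_kernel_ne_top σ 0) (by rwa [hκre])
    refine (mul_le_mul_of_nonneg_right this (Real.exp_pos _).le).trans (le_of_eq ?_)
    simp only [C₁]
    rw [mul_right_comm, ← Real.exp_add, hκre]
    congr 2
    ring
  have hν : Tendsto (fun r : ℝ => (Q + M ^ 2 * c) / (2 * r)) atTop (𝓝 0) :=
    tendsto_const_nhds.div_atTop (tendsto_id.const_mul_atTop zero_lt_two)
  have hθ : Tendsto (fun r : ℝ => Real.exp (2 * ((Q + M ^ 2 * c) / (2 * r)) - 2 * r * c) / 2 +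
      (Q + M ^ 2 * c) / (2 * r) * Real.exp (4 * ((Q + M ^ 2 * c) / (2 * r)))) atTop (𝓝 0) := by
    have h1 : Tendsto (fun r : ℝ => 2 * ((Q + M ^ 2 * c) / (2 * r)) - 2 * r * c) atTop atBot := by
      have h2 : Tendsto (fun r : ℝ => -(2 * r * c)) atTop atBot :=
        tendsto_neg_atTop_atBot.comp
          ((tendsto_id.const_mul_atTop zero_lt_two).atTop_mul_const hc)
      simpa [sub_eq_add_neg] using (hν.const_mul 2).add_atBot h2
    have h3 := ((Real.tendsto_exp_atBot.comp h1).div_const 2).add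
      (hν.mul ((Real.continuous_exp.tendsto _).comp (hν.const_mul 4)))
    simpa [Function.comp_def] using h3
  have hI : IntegrableOn (fun α => A α + (K false α + s * K true α)) (Ioo 0 c) :=
    (hA.integrable c hc hcb).add ((hKI false).add ((hKI true).const_mul s))
  have main := ae_eq_zero_of_laplace_small hI fun δ hδ => ?_
  · filter_upwards [main] with α hα
    linarith
  -- The transform of A plus the kernels splits into the error in the asymptotics of m, the Riccati
  -- comparison error, and the truncation of the two kernel transforms to (0, c). Each is at most a
  -- constant times e^{δr - 2cr}; a factor r is absorbed by r ≤ e^{δr}/δ.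
  have hev : ∀ᶠ r : ℝ in atTop, ‖∫ α in Ioo 0 c, ((A α + (K false α + s * K true α) : ℝ) : ℂ) *
      Complex.exp (-2 * (α : ℂ) * κ r)‖ * Real.exp (2 * c * r) ≤
      (20 * Real.exp 1 / δ + 1 + (C₁ false + C₁ true)) * Real.exp (δ * r) := by
    filter_upwards [hA.eventually_le hc hcb hδ, hA.eventually_weylM_ne_zero hc hcb,
      eventually_ge_atTop k₀, eventually_gt_atTop (0 : ℝ),
      hν.eventually_le_const (u := 1 / 2) (by norm_num),
      hθ.eventually_le_const (u := 1 / 20) (by norm_num)]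
      with r h1 h2 hrk hr hν1 hθ1
    have hd := hdata r hrk
    obtain ⟨u, du, hu, hus, hu0, hm⟩ := exists_of_weylM_ne_zero h2
    obtain ⟨w, hw0, hwc, hwP, hwn⟩ := hd.exists_riccati (hκre r) hs
    have hcdom : c ∈ B.dom := ⟨hc.le, hcb⟩
    have hsub := Icc_subset_dom hcdom
    have hz : 0 < (-((r : ℂ) * (1 - Complex.I)) ^ 2).im := by
      have : -((r : ℂ) * (1 - Complex.I)) ^ 2 = ((2 * r ^ 2 : ℝ) : ℂ) * Complex.I := by
        push_cast
        linear_combination (-(r : ℂ) ^ 2) * Complex.I_sq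
      rw [this, Complex.im_ofReal_mul, Complex.I_im]
      positivity
    have hdu := (hu.hasPrim_deriv hc.le hsub (hB.integrableOn hcdom)).congr_right
      (g' := fun t => (-((((f false t).toReal + s * (f true t).toReal : ℝ)) : ℂ) + κ r ^ 2) * u t)
      (by
        rw [← Measure.restrict_congr_set (Ioo_ae_eq_Ioc (a := (0 : ℝ)) (b := c))]
        filter_upwards [hp] with t ht
        rw [ht]
        push_cast
        simp only [κ]
        ring)
    have hcmp := norm_sub_le_of_riccati hr rfl hwP hwc (hu.hasPrim hc.le hsub) hdu hu0
      (flux_nonneg hB hz hu hus hu0 hcdom) hwn hθ1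
    have i1 : IntegrableOn (fun α => (A α : ℂ) * Complex.exp (-2 * (α : ℂ) * κ r)) (Ioo 0 c) := by
      have h3 : IntegrableOn (fun α => (A α : ℂ)) (Ioo 0 c) := (hA.integrable c hc hcb).ofReal
      rw [← intervalIntegrable_iff_integrableOn_Ioo_of_le hc.le] at h3 ⊢
      exact h3.mul_continuousOn (by fun_prop)
    set J := ∫ α in Ioo 0 c, (A α : ℂ) * Complex.exp (-2 * (α : ℂ) * κ r)
    set JK : Bool → ℂ := fun σ => ∫ α in Ioo 0 c, (K σ α : ℂ) * Complex.exp (-2 * κ r * α)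
    have hsplit : ∫ α in Ioo 0 c, ((A α + (K false α + s * K true α) : ℝ) : ℂ) *
        Complex.exp (-2 * (α : ℂ) * κ r) = J + (JK false + s * JK true) := by
      have i2 : IntegrableOn (fun α => (K false α : ℂ) * Complex.exp (-2 * κ r * α) +
          s * ((K true α : ℂ) * Complex.exp (-2 * κ r * α))) (Ioo 0 c) :=
        (hKi false r hrk).integrableOn.add ((hKi true r hrk).integrableOn.const_mul _)
      simp only [J, JK]
      rw [← integral_const_mul, ← integral_add (hKi false r hrk).integrableOn
        ((hKi true r hrk).integrableOn.const_mul _), ← integral_add i1 i2]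
      refine integral_congr_ae (ae_of_all _ fun α => ?_)
      simp only
      rw [mul_right_comm (-2 : ℂ)]
      push_cast
      ring
    have t0 := htail false r hrk
    have t1 := htail true r hrk
    rw [hsplit]
    set L : Bool → ℂ := fun σ => laplace (kernel f c σ 0) (κ r)
    have hdecomp : J + (JK false + s * JK true) =
        (weylM q B (-((r : ℂ) * (1 - Complex.I)) ^ 2) - (-κ r - J)) -
          (du 0 / u 0 - (-κ r + w 0)) - (L false - JK false) - s * (L true - JK true) := by
      rw [hm, hw0]; ring
    have hnorm : ‖J + (JK false + s * JK true)‖ ≤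
        ‖weylM q B (-((r : ℂ) * (1 - Complex.I)) ^ 2) - (-κ r - J)‖ +
          ‖du 0 / u 0 - (-κ r + w 0)‖ + ‖L false - JK false‖ + ‖L true - JK true‖ := by
      rw [hdecomp]
      refine (norm_sub_le _ _).trans (add_le_add ((norm_sub_le _ _).trans
        (add_le_add (norm_sub_le _ _) le_rfl)) ?_)
      rw [norm_mul, Complex.norm_real, Real.norm_eq_abs, hsabs, one_mul]
    have hκn : ‖κ r‖ ≤ 2 * r := by
      simp only [κ]
      rw [norm_mul, Complex.norm_real, Real.norm_eq_abs, abs_of_pos hr, mul_comm]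
      gcongr
      refine (norm_sub_le _ _).trans ?_
      simp
      norm_num
    have hrexp : r ≤ Real.exp (δ * r) / δ := by
      rw [le_div_iff₀ hδ]
      have := Real.add_one_le_exp (δ * r)
      linarith
    have hone : 1 ≤ Real.exp (δ * r) := Real.one_le_exp (by positivity)
    have hcmp' : ‖du 0 / u 0 - (-κ r + w 0)‖ * Real.exp (2 * c * r) ≤
        20 * Real.exp 1 / δ * Real.exp (δ * r) := by
      refine (mul_le_mul_of_nonneg_right hcmp (Real.exp_pos _).le).trans ?_
      have e : Real.exp (-2 * r * c) * Real.exp (2 * c * r) = 1 := by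
        rw [← Real.exp_add, Real.exp_eq_one_iff]; ring
      rw [mul_assoc, e, mul_one]
      calc 10 * ‖κ r‖ * Real.exp (2 * ((Q + M ^ 2 * c) / (2 * r)))
          ≤ 10 * (2 * (Real.exp (δ * r) / δ)) * Real.exp 1 := by
            gcongr
            · exact hκn.trans (by gcongr)
            · linarith
        _ = _ := by ring
    have hC : ∀ σ, 0 ≤ C₁ σ := fun σ => by
      refine mul_nonneg (Real.exp_pos _).le (integral_nonneg fun α => ?_)
      positivity
    have hC' : C₁ false + C₁ true ≤ (C₁ false + C₁ true) * Real.exp (δ * r) :=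
      le_mul_of_one_le_right (add_nonneg (hC _) (hC _)) hone
    refine (mul_le_mul_of_nonneg_right hnorm (Real.exp_pos _).le).trans ?_
    simp only [add_mul]
    simp only [add_mul] at hC'
    linarith
  obtain ⟨R, hR⟩ := eventually_atTop.1 hev
  exact ⟨_, R, hR⟩

end

/-! ### Comparison of amplitudes, and the value at zero -/

section

open scoped ENNReal

section Split

/-- The even and the odd part of a pair `|g₁| ≤ g₂` on `(0, c)`, as data of the kernel equation. -/
def splitData (c : ℝ) (g₁ g₂ : ℝ → ℝ) (σ : Bool) : ℝ → ℝ≥0∞ :=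
  (Ioo 0 c).indicator fun t => ENNReal.ofReal ((g₂ t + bif σ then -g₁ t else g₁ t) / 2)

variable {c : ℝ} {g₁ g₂ : ℝ → ℝ}

theorem measurable_splitData (h₁ : Measurable g₁) (h₂ : Measurable g₂) (σ : Bool) :
    Measurable (splitData c g₁ g₂ σ) := by
  refine Measurable.indicator ?_ measurableSet_Ioo
  cases σ
  · exact ((h₂.add h₁).div_const 2).ennreal_ofReal
  · exact ((h₂.add h₁.neg).div_const 2).ennreal_ofReal

theorem splitData_of_notMem (σ : Bool) {t : ℝ} (ht : t ∉ Ioo 0 c) : splitData c g₁ g₂ σ t = 0 :=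
  indicator_of_notMem ht _

theorem toReal_splitData_false (hle : ∀ t, |g₁ t| ≤ g₂ t) {t : ℝ} (ht : t ∈ Ioo 0 c) :
    (splitData c g₁ g₂ false t).toReal = (g₂ t + g₁ t) / 2 := by
  rw [splitData, indicator_of_mem ht, ENNReal.toReal_ofReal]
  · rfl
  · have := (abs_le.1 (hle t)).1
    simp only [cond_false]
    linarith

theorem toReal_splitData_true (hle : ∀ t, |g₁ t| ≤ g₂ t) {t : ℝ} (ht : t ∈ Ioo 0 c) :
    (splitData c g₁ g₂ true t).toReal = (g₂ t - g₁ t) / 2 := by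
  rw [splitData, indicator_of_mem ht, ENNReal.toReal_ofReal]
  · rfl
  · have := (abs_le.1 (hle t)).2
    simp only [cond_true]
    linarith

theorem sum_splitData (hle : ∀ t, |g₁ t| ≤ g₂ t) (t : ℝ) :
    ∑ σ, splitData c g₁ g₂ σ t = (Ioo 0 c).indicator (fun t => ENNReal.ofReal (g₂ t)) t := by
  by_cases ht : t ∈ Ioo 0 c
  · have := abs_le.1 (hle t)
    simp only [Fintype.sum_bool, splitData, indicator_of_mem ht, cond_true, cond_false]
    rw [← ENNReal.ofReal_add (by linarith) (by linarith)]
    congr 1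
    ring
  · simp [splitData, indicator_of_notMem ht]

theorem sum_lintegral_splitData (h₁ : Measurable g₁) (h₂ : Measurable g₂)
    (hle : ∀ t, |g₁ t| ≤ g₂ t) (hi : IntegrableOn g₂ (Ioo 0 c)) :
    ∑ σ, ∫⁻ t, splitData c g₁ g₂ σ t = ENNReal.ofReal (∫ t in Ioo 0 c, g₂ t) := by
  rw [← lintegral_finsetSum _ fun σ _ => measurable_splitData h₁ h₂ σ]
  simp_rw [sum_splitData hle]
  rw [lintegral_indicator measurableSet_Ioo, ofReal_integral_eq_lintegral_ofReal hi
    (ae_of_all _ fun t => (abs_nonneg _).trans (hle t))]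

/-- Measurable representatives are clamped so that the inequality, given almost everywhere, holds
everywhere; the nonnegative data of the kernel equation need this. -/
theorem exists_measurable_of_abs_le {μ : Measure ℝ} {p₁ p₂ : ℝ → ℝ} (h₁ : AEMeasurable p₁ μ)
    (h₂ : AEMeasurable p₂ μ) (h : ∀ᵐ t ∂μ, |p₁ t| ≤ p₂ t) :
    ∃ g₁ g₂ : ℝ → ℝ, Measurable g₁ ∧ Measurable g₂ ∧ (∀ t, |g₁ t| ≤ g₂ t) ∧ g₁ =ᵐ[μ] p₁ ∧
      g₂ =ᵐ[μ] p₂ := by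
  set u := h₁.mk p₁
  set v := fun t => max (h₂.mk p₂ t) 0
  have hv : Measurable v := h₂.measurable_mk.max measurable_const
  have hv0 : ∀ t, 0 ≤ v t := fun t => le_max_right _ _
  refine ⟨fun t => max (-v t) (min (u t) (v t)), v, hv.neg.max (h₁.measurable_mk.min hv), hv,
    fun t => abs_le.2 ⟨le_max_left _ _, max_le (by linarith [hv0 t]) (min_le_right _ _)⟩, ?_, ?_⟩
  · filter_upwards [h, h₁.ae_eq_mk, h₂.ae_eq_mk] with t ht e₁ e₂
    have h3 : v t = p₂ t := by
      simp only [v]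
      rw [← e₂, max_eq_left ((abs_nonneg _).trans ht)]
    rw [h3]
    simp only [u]
    rw [← e₁, min_eq_left (abs_le.1 ht).2, max_eq_right (abs_le.1 ht).1]
  · filter_upwards [h, h₂.ae_eq_mk] with t ht e₂
    simp only [v]
    rw [← e₂, max_eq_left ((abs_nonneg _).trans ht)]

end Split

/-- The nonlinear part of the kernel at `x = 0`. -/
def kernelExcess (f : Bool → ℝ → ℝ≥0∞) (c : ℝ) (σ : Bool) (α : ℝ) : ℝ≥0∞ :=
  kernelStep (fun _ _ => 0) c (kernel f c) σ 0 α

variable {f : Bool → ℝ → ℝ≥0∞} {c Q s : ℝ} {q A : ℝ → ℝ} {B : RightEnd}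

theorem kernel_eq_add_kernelExcess (hf : ∀ σ, Measurable (f σ)) (σ : Bool) {α : ℝ} (hα : 0 < α) :
    kernel f c σ 0 α = f σ α + kernelExcess f c σ α := by
  rw [kernel_eq hf, kernelExcess, kernelStep, kernelStep, indicator_of_mem (mem_Ioi.2 hα)]
  simp

theorem measurable_kernelExcess (hf : ∀ σ, Measurable (f σ)) (σ : Bool) :
    Measurable (kernelExcess f c σ) :=
  (measurable_kernelStep (fun _ => measurable_const) (measurable_kernel hf) σ).comp
    (f := fun α => ((0 : ℝ), α)) (by fun_prop)

theorem KernelData.sum_lintegral_kernelExcess_le {M k : ℝ} (h : KernelData f c Q M k) :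
    ∑ σ, ∫⁻ α, expWeight k α * kernelExcess f c σ α ≤ ENNReal.ofReal (M ^ 2 / (2 * k)) := by
  refine (sum_lintegral_expWeight_kernelStep_le (fun _ => measurable_const)
    (measurable_kernel h.measurable) h.k_pos h.lintegral_kernel_le 0).trans (le_of_eq ?_)
  rw [← ENNReal.ofReal_pow h.M_nonneg, ← ENNReal.ofReal_mul (sq_nonneg _)]
  simp [div_eq_mul_inv]

theorem ae_kernel_lt_top (hf : ∀ σ, Measurable (f σ)) (hsupp : ∀ σ t, t ∉ Ioo 0 c → f σ t = 0)
    (hc : 0 < c) (hQ : 0 ≤ Q) (hfQ : ∑ σ, ∫⁻ t, f σ t ≤ ENNReal.ofReal Q) (σ : Bool) :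
    ∀ᵐ α, kernel f c σ 0 α < ∞ := by
  -- M = 2Q leaves room Q for the quadratic term, which is 4Q²/(2(2Q + 1)) ≤ Q.
  have h : KernelData f c Q (2 * Q) (2 * Q + 1) := by
    refine ⟨hf, hsupp, hc, by positivity, hQ, hfQ, ?_⟩
    have : (2 * Q) ^ 2 / (2 * (2 * Q + 1)) ≤ Q := by
      rw [div_le_iff₀ (by positivity)]
      nlinarith
    linarith
  exact ae_lt_top_of_weight (measurable_expWeight _)
    ((measurable_kernel hf σ).comp (f := fun α => ((0 : ℝ), α)) (by fun_prop))
    (fun x => expWeight_ne_zero _ x) (h.lintegral_kernel_ne_top σ 0)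

/-- The linear term of the kernel equation at x = 0 accounts exactly for q. Subtracting it leaves
the continuous function A - q, so that estimates almost everywhere can later be carried to every
point. -/
theorem IsAmplitude.ae_sub_eq (hB : B.Admissible q) (hA : IsAmplitude q B A) (hc : 0 < c)
    (hcb : (c : EReal) < B.b) (hf : ∀ σ, Measurable (f σ))
    (hsupp : ∀ σ t, t ∉ Ioo 0 c → f σ t = 0) (hQ : 0 ≤ Q)
    (hfQ : ∑ σ, ∫⁻ t, f σ t ≤ ENNReal.ofReal Q) (hs : s ^ 2 = 1)
    (hp : ∀ᵐ t ∂volume.restrict (Ioo 0 c), (f false t).toReal + s * (f true t).toReal = -q t) :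
    ∀ᵐ α ∂volume.restrict (Ioo 0 c), (∀ σ, kernelExcess f c σ α < ∞) ∧
      A α - q α = -((kernelExcess f c false α).toReal + s * (kernelExcess f c true α).toReal) := by
  have hfin := ae_kernel_lt_top hf hsupp hc hQ hfQ
  filter_upwards [hA.ae_eq_kernel hB hc hcb hf hsupp hQ hfQ hs hp, hp,
    ae_restrict_of_ae (hfin false), ae_restrict_of_ae (hfin true),
    ae_restrict_mem measurableSet_Ioo] with α h1 h2 h3 h4 hα
  have e := fun σ => kernel_eq_add_kernelExcess (c := c) hf σ hα.1
  rw [e, ENNReal.add_lt_top] at h3 h4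
  rw [e, e, ENNReal.toReal_add h3.1.ne h3.2.ne, ENNReal.toReal_add h4.1.ne h4.2.ne] at h1
  refine ⟨fun σ => ?_, by linarith⟩
  cases σ
  exacts [h3.2, h4.2]

/-- With sign -1 the datum is f₀ - f₁ = g₁, and the difference of the even and odd excess is at most
their sum, which belongs to g₂. -/
theorem IsAmplitude.ae_abs_sub_le {g₁ g₂ : ℝ → ℝ} (hB : B.Admissible q) (hA : IsAmplitude q B A)
    (hc : 0 < c) (hcb : (c : EReal) < B.b) (h₁ : Measurable g₁) (h₂ : Measurable g₂)
    (hle : ∀ t, |g₁ t| ≤ g₂ t) (hi : IntegrableOn g₂ (Ioo 0 c))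
    (hq : ∀ᵐ t ∂volume.restrict (Ioo 0 c), g₁ t = -q t) :
    ∀ᵐ α ∂volume.restrict (Ioo 0 c), (∀ σ, kernelExcess (splitData c g₁ g₂) c σ α < ∞) ∧
      |A α - q α| ≤ (kernelExcess (splitData c g₁ g₂) c false α).toReal +
        (kernelExcess (splitData c g₁ g₂) c true α).toReal := by
  filter_upwards [hA.ae_sub_eq hB hc hcb (s := -1) (f := splitData c g₁ g₂)
    (Q := ∫ t in Ioo 0 c, g₂ t) (measurable_splitData h₁ h₂)
    (fun σ t ht => splitData_of_notMem σ ht)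
    (integral_nonneg fun t => (abs_nonneg _).trans (hle t))
    (sum_lintegral_splitData h₁ h₂ hle hi).le (by norm_num) (by
      filter_upwards [hq, ae_restrict_mem measurableSet_Ioo] with t ht htm
      rw [toReal_splitData_false hle htm, toReal_splitData_true hle htm, ← ht]
      ring)] with α hα
  refine ⟨hα.1, ?_⟩
  have a1 : 0 ≤ (kernelExcess (splitData c g₁ g₂) c false α).toReal := ENNReal.toReal_nonneg
  have a2 : 0 ≤ (kernelExcess (splitData c g₁ g₂) c true α).toReal := ENNReal.toReal_nonneg
  rw [hα.2, abs_le]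
  constructor <;> linarith

/-- An inequality almost everywhere between continuous functions holds at the right endpoint. -/
theorem le_of_ae_le_Ioo {F G : ℝ → ℝ} {α : ℝ} (hα : 0 < α) (hF : ContinuousOn F (Icc 0 α))
    (hG : ContinuousOn G (Icc 0 α)) (h : ∀ᵐ x ∂volume.restrict (Ioo 0 α), F x ≤ G x) :
    F α ≤ G α := by
  have h1 : (fun x => max (F x) (G x)) =ᵐ[volume.restrict (Icc 0 α)] G := by
    rw [← Measure.restrict_congr_set (Ioo_ae_eq_Icc (a := (0 : ℝ)) (b := α))]
    filter_upwards [h] with x hx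
    exact max_eq_right hx
  have h2 := Measure.eqOn_Icc_of_ae_eq volume hα.ne h1 (hF.sup hG) hG
    (right_mem_Icc.2 hα.le)
  exact max_eq_right_iff.1 h2

theorem IsAmplitude.continuousOn_Icc (hA : IsAmplitude q B A) {α : ℝ} (hα : 0 ≤ α)
    (hαb : (α : EReal) < B.b) : ContinuousOn (fun x => A x - q x) (Icc 0 α) :=
  hA.continuous_sub.mono (Icc_subset_dom ⟨hα, hαb⟩)

/-- The heart of the comparison: one pair of kernels describes both amplitudes, as the difference of
its components for q₁ and as their sum for q₂. -/
theorem abs_sub_le_of_abs_le {q₁ q₂ A₁ A₂ : ℝ → ℝ} {B₁ B₂ : RightEnd} {α : ℝ}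
    (hB₁ : B₁.Admissible q₁) (hB₂ : B₂.Admissible q₂) (hA₁ : IsAmplitude q₁ B₁ A₁)
    (hA₂ : IsAmplitude q₂ B₂ A₂) (hα : 0 < α) (hb₁ : (α : EReal) < B₁.b) (hb₂ : (α : EReal) < B₂.b)
    (h : ∀ᵐ x ∂volume.restrict (Ioo 0 α), |q₁ x| ≤ -q₂ x) :
    |A₁ α - q₁ α| ≤ -(A₂ α - q₂ α) := by
  have i₁ : IntegrableOn q₁ (Ioo 0 α) := hB₁.integrableOn ⟨hα.le, hb₁⟩
  have i₂ : IntegrableOn q₂ (Ioo 0 α) := hB₂.integrableOn ⟨hα.le, hb₂⟩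
  obtain ⟨g₁, g₂, h₁, h₂, hle, e₁, e₂⟩ := exists_measurable_of_abs_le (p₁ := fun t => -q₁ t)
    (p₂ := fun t => -q₂ t) i₁.neg.aemeasurable i₂.neg.aemeasurable (by simpa using h)
  have hi : IntegrableOn g₂ (Ioo 0 α) := i₂.neg.congr e₂.symm
  refine le_of_ae_le_Ioo hα (hA₁.continuousOn_Icc hα.le hb₁).abs
    (hA₂.continuousOn_Icc hα.le hb₂).neg ?_
  filter_upwards [hA₁.ae_abs_sub_le hB₁ hα hb₁ h₁ h₂ hle hi e₁,
    hA₂.ae_sub_eq hB₂ hα hb₂ (s := 1) (f := splitData α g₁ g₂)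
    (Q := ∫ t in Ioo 0 α, g₂ t) (measurable_splitData h₁ h₂)
    (fun σ t ht => splitData_of_notMem σ ht)
    (integral_nonneg fun t => (abs_nonneg _).trans (hle t))
    (sum_lintegral_splitData h₁ h₂ hle hi).le (by norm_num) (by
      filter_upwards [e₂, ae_restrict_mem measurableSet_Ioo] with t ht htm
      rw [toReal_splitData_false hle htm, toReal_splitData_true hle htm, ← ht]
      ring)] with x hx₁ hx₂
  rw [Pi.neg_apply, hx₂.2]
  linarith [hx₁.2]

/-- The `A`-amplitude agrees with the potential at `0`. -/
theorem IsAmplitude.apply_zero (hB : B.Admissible q) (hA : IsAmplitude q B A)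
    (hb : (0 : EReal) < B.b) : A 0 = q 0 := by
  by_contra hne
  set D : ℝ → ℝ := fun x => A x - q x
  set d := |D 0|
  have hd : 0 < d := abs_pos.2 (sub_ne_zero.2 hne)
  obtain ⟨b, hb0, hbb⟩ := EReal.lt_iff_exists_real_btwn.1 hb
  have hb0' : 0 < b := EReal.coe_pos.1 hb0
  have hDc : ContinuousOn D (Icc 0 b) := hA.continuousOn_Icc hb0'.le hbb
  have hqi : IntegrableOn q (Ioo 0 b) := hB.integrableOn ⟨hb0'.le, hbb⟩
  have hqii : IntervalIntegrable (fun t => |q t|) volume 0 b :=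
    (intervalIntegrable_of_integrableOn_Ioo hb0'.le hqi).abs
  set Φ : ℝ → ℝ := fun x => ∫ t in (0 : ℝ)..x, |q t|
  have hΦ : ContinuousOn Φ (Icc 0 b) := by
    have := intervalIntegral.continuousOn_primitive_interval' hqii left_mem_uIcc
    rwa [uIcc_of_le hb0'.le] at this
  have h0 : (0 : ℝ) ∈ Icc 0 b := ⟨le_rfl, hb0'.le⟩
  have hmem : Icc 0 b ∈ 𝓝[>] (0 : ℝ) := Icc_mem_nhdsGT hb0'
  have t1 : Tendsto (fun x => |D x|) (𝓝[>] 0) (𝓝 d) :=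
    ((hDc 0 h0).mono_of_mem_nhdsWithin hmem).tendsto.abs
  have t2 : Tendsto (fun x => (2 * Φ x) ^ 2) (𝓝[>] 0) (𝓝 0) := by
    have := (((hΦ 0 h0).mono_of_mem_nhdsWithin hmem).tendsto.const_mul 2).pow 2
    simpa [Φ] using this
  have ev1 : ∀ᶠ x in 𝓝[>] (0 : ℝ), d / 2 < |D x| := t1.eventually_const_lt (by linarith)
  obtain ⟨c₁, hc₁, hD⟩ := mem_nhdsGT_iff_exists_Ioo_subset.1 ev1
  -- The interval is taken so short that (2Q)² < d/8, with Q the integral of |q| over (0, c); the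
  -- estimate below will force (2Q)² ≥ d/6.
  obtain ⟨c, hc, hcΦ⟩ := ((t2.eventually_lt_const (u := d / 8) (by positivity)).and
    (Ioo_mem_nhdsGT (lt_min hc₁ hb0'))).exists
  obtain ⟨hc0, hcm⟩ := hcΦ
  have hcb : c < b := hcm.trans_le (min_le_right _ _)
  have hcc₁ : c < c₁ := hcm.trans_le (min_le_left _ _)
  have hcB : (c : EReal) < B.b := (EReal.coe_lt_coe_iff.2 hcb).trans hbb
  have hqc : IntegrableOn q (Ioo 0 c) := hqi.mono_set (Ioo_subset_Ioo_right hcb.le)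
  obtain ⟨g₁, g₂, h₁, h₂, hle, e₁, e₂⟩ := exists_measurable_of_abs_le (p₁ := fun t => -q t)
    (p₂ := fun t => |q t|) hqc.neg.aemeasurable hqc.abs.aemeasurable (ae_of_all _ fun t => by simp)
  have hi : IntegrableOn g₂ (Ioo 0 c) := Integrable.congr hqc.abs e₂.symm
  set Q := ∫ t in Ioo 0 c, g₂ t
  have hQΦ : Q = Φ c := by
    simp only [Φ]
    rw [intervalIntegral.integral_of_le hc0.le, integral_Ioc_eq_integral_Ioo]
    exact integral_congr_ae e₂
  have hQ : 0 ≤ Q := integral_nonneg fun t => (abs_nonneg _).trans (hle t)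
  -- The term 2Q makes M = 2Q admissible. The term 1/(2c) places (0, 1/(2k)) inside (0, c), where |A
  -- - q| > d/2, and on it the weight e^{-2kα} is at least e^{-1} ≥ 1/3.
  set k := 2 * Q + 1 / (2 * c)
  have hk : 0 < k := by positivity
  have hkc : 1 / (2 * k) ≤ c := by
    rw [div_le_iff₀ (by positivity)]
    have : 1 / (2 * c) ≤ k := le_add_of_nonneg_left (by positivity)
    rw [div_le_iff₀ (by positivity)] at this
    linarith
  have hdata : KernelData (splitData c g₁ g₂) c Q (2 * Q) k := by
    refine ⟨measurable_splitData h₁ h₂, fun σ t ht => splitData_of_notMem σ ht, hc0, hk, hQ,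
      (sum_lintegral_splitData h₁ h₂ hle hi).le, ?_⟩
    have h2 : 2 * Q ≤ k := le_add_of_nonneg_right (by positivity)
    have : (2 * Q) ^ 2 / (2 * k) ≤ Q := by
      rw [div_le_iff₀ (by positivity)]
      nlinarith
    linarith
  have hex := hdata.sum_lintegral_kernelExcess_le
  have hae := hA.ae_abs_sub_le hB hc0 hcB h₁ h₂ hle hi e₁
  have hlow : ENNReal.ofReal (d / 2) * (ENNReal.ofReal (1 / 3) * ENNReal.ofReal (1 / (2 * k))) ≤
      ∑ σ, ∫⁻ α, expWeight k α * kernelExcess (splitData c g₁ g₂) c σ α := by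
    have hvol : ENNReal.ofReal (1 / (2 * k)) = volume (Ioo 0 (1 / (2 * k))) := by
      rw [Real.volume_Ioo, sub_zero]
    have hmeas : ∀ σ, Measurable fun α =>
        expWeight k α * kernelExcess (splitData c g₁ g₂) c σ α := fun σ =>
      (measurable_expWeight k).mul (measurable_kernelExcess hdata.measurable σ)
    rw [← lintegral_finsetSum _ fun σ _ => hmeas σ, hvol, ← mul_assoc, ← setLIntegral_const]
    refine le_trans (setLIntegral_mono_ae' measurableSet_Ioo ?_) (setLIntegral_le_lintegral _ _)
    have hae' := (ae_restrict_iff' measurableSet_Ioo).1 hae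
    filter_upwards [hae'] with α hα hαm
    have hαc : α ∈ Ioo 0 c := ⟨hαm.1, hαm.2.trans_le hkc⟩
    obtain ⟨hfin, hαle⟩ := hα hαc
    rw [← Finset.mul_sum, mul_comm]
    refine mul_le_mul' (ENNReal.ofReal_le_ofReal ?_) ?_
    · have hα2 : 2 * k * α ≤ 1 := by
        have := (lt_div_iff₀ (by positivity)).1 hαm.2
        linarith
      have h3 : Real.exp (-1) ≤ Real.exp (-2 * k * α) := Real.exp_le_exp.2 (by linarith)
      refine le_trans ?_ h3
      rw [Real.exp_neg, one_div]
      exact inv_anti₀ (Real.exp_pos _) (by linarith [Real.exp_one_lt_d9])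
    · rw [Fintype.sum_bool, ← ENNReal.ofReal_toReal (hfin true).ne,
        ← ENNReal.ofReal_toReal (hfin false).ne, ← ENNReal.ofReal_add ENNReal.toReal_nonneg
        ENNReal.toReal_nonneg]
      refine ENNReal.ofReal_le_ofReal ?_
      have h4 : d / 2 < |D α| := hD ⟨hαc.1, hαc.2.trans hcc₁⟩
      linarith
  have hfinal := hlow.trans hex
  rw [← ENNReal.ofReal_mul (by positivity), ← ENNReal.ofReal_mul (by positivity),
    ENNReal.ofReal_le_ofReal_iff (by positivity)] at hfinal
  have h5 : d / 6 ≤ (2 * Q) ^ 2 := by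
    have e : d / 2 * (1 / 3 * (1 / (2 * k))) = d / 6 / (2 * k) := by ring
    rw [e] at hfinal
    exact (div_le_div_iff_of_pos_right (by positivity)).1 hfinal
  rw [hQΦ] at h5
  linarith

end

/-! ### The Bessel majorant for bounded potentials -/

section

open scoped ENNReal

section Bessel

/-- The Beta integral by repeated integration by parts, each trading one power of y - β for one of
β; hence the induction on m with n free. -/
theorem integral_pow_div_factorial_mul (n m : ℕ) (y : ℝ) :
    ∫ β in (0 : ℝ)..y, β ^ n / (n.factorial : ℝ) * ((y - β) ^ m / (m.factorial : ℝ)) =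
      y ^ (n + m + 1) / ((n + m + 1).factorial : ℝ) := by
  have hd : ∀ (n : ℕ) (x : ℝ), HasDerivAt (fun x : ℝ => x ^ (n + 1) / ((n + 1).factorial : ℝ))
      (x ^ n / (n.factorial : ℝ)) x := fun n x => by
    refine ((hasDerivAt_pow (n + 1) x).div_const _).congr_deriv ?_
    rw [Nat.factorial_succ]
    push_cast
    have : (n.factorial : ℝ) ≠ 0 := by positivity
    field_simp
  induction m generalizing n with
  | zero =>
    simp only [pow_zero, Nat.factorial_zero, Nat.cast_one, div_one, mul_one, add_zero]
    rw [intervalIntegral.integral_eq_sub_of_hasDerivAt (fun x _ => hd n x)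
      (Continuous.intervalIntegrable (by fun_prop) _ _)]
    simp
  | succ m ih =>
    have hd' : ∀ x : ℝ, HasDerivAt (fun x : ℝ => (y - x) ^ (m + 1) / ((m + 1).factorial : ℝ))
        (-((y - x) ^ m / (m.factorial : ℝ))) x := fun x => by
      have := (hd m (y - x)).comp_const_sub y x
      exact this
    have h := intervalIntegral.integral_mul_deriv_eq_deriv_mul (a := 0) (b := y)
      (fun x _ => hd' x) (fun x _ => hd n x)
      (Continuous.intervalIntegrable (by fun_prop) _ _)
      (Continuous.intervalIntegrable (by fun_prop) _ _)
    have h2 := ih (n + 1)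
    rw [show n + 1 + m + 1 = n + (m + 1) + 1 by ring] at h2
    rw [← h2]
    simp only [mul_comm (_ ^ n / _ : ℝ)]
    rw [h]
    simp only [neg_mul, intervalIntegral.integral_neg]
    simp [mul_comm]

/-- The divided power `y ^ n / n!` on the positive half-line. -/
def dividedPow (n : ℕ) : ℝ → ℝ≥0∞ :=
  (Ioi (0 : ℝ)).indicator fun y => ENNReal.ofReal (y ^ n / (n.factorial : ℝ))

@[fun_prop]
theorem measurable_dividedPow (n : ℕ) : Measurable (dividedPow n) :=
  Measurable.indicator (by fun_prop) measurableSet_Ioi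

theorem dividedPow_of_pos (n : ℕ) {y : ℝ} (hy : 0 < y) :
    dividedPow n y = ENNReal.ofReal (y ^ n / (n.factorial : ℝ)) :=
  indicator_of_mem (mem_Ioi.2 hy) _

theorem dividedPow_of_nonpos (n : ℕ) {y : ℝ} (hy : y ≤ 0) : dividedPow n y = 0 :=
  indicator_of_notMem (by simpa using hy) _

theorem dividedPow_mono (n : ℕ) : Monotone (dividedPow n) := by
  intro x y hxy
  rcases le_or_gt x 0 with hx | hx
  · rw [dividedPow_of_nonpos n hx]
    exact zero_le
  · rw [dividedPow_of_pos n hx, dividedPow_of_pos n (hx.trans_le hxy)]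
    gcongr

theorem lintegral_dividedPow_mul (n m : ℕ) (y : ℝ) :
    ∫⁻ β, dividedPow n β * dividedPow m (y - β) = dividedPow (n + m + 1) y := by
  have h0 : ∀ β, β ∉ Ioo 0 y → dividedPow n β * dividedPow m (y - β) = 0 := by
    intro β hβ
    rcases le_or_gt β 0 with h | h
    · rw [dividedPow_of_nonpos n h, zero_mul]
    · rw [dividedPow_of_nonpos m, mul_zero]
      by_contra! h2
      exact hβ ⟨h, by linarith⟩
  rcases le_or_gt y 0 with hy | hy
  · rw [dividedPow_of_nonpos _ hy, ← lintegral_zero]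
    refine lintegral_congr fun β => h0 β ?_
    rw [Ioo_eq_empty (not_lt.2 hy)]
    exact notMem_empty β
  rw [dividedPow_of_pos _ hy, ← integral_pow_div_factorial_mul,
    intervalIntegral.integral_of_le hy.le, integral_Ioc_eq_integral_Ioo,
    ofReal_integral_eq_lintegral_ofReal]
  · rw [← lintegral_indicator measurableSet_Ioo]
    refine lintegral_congr fun β => ?_
    by_cases hβ : β ∈ Ioo 0 y
    · rw [indicator_of_mem hβ, dividedPow_of_pos n hβ.1, dividedPow_of_pos m (sub_pos.2 hβ.2),
        ENNReal.ofReal_mul (div_nonneg (pow_nonneg hβ.1.le _) (by positivity))]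
    · rw [indicator_of_notMem hβ, h0 β hβ]
  · exact (Continuous.integrableOn_Icc (by fun_prop)).mono_set Ioo_subset_Icc_self
  · filter_upwards [ae_restrict_mem measurableSet_Ioo] with β hβ
    have := sub_pos.2 hβ.2
    have := hβ.1
    simp only [Pi.zero_apply]
    positivity

/-- Integration in t > x is convolution with the indicator of the positive axis, and the restriction
t ≤ c only decreases it. -/
theorem setLIntegral_dividedPow_le (n : ℕ) (x c α : ℝ) :
    ∫⁻ t in Ioc x c, dividedPow n (α + x - t) ≤ dividedPow (n + 1) α := by
  have h := lintegral_dividedPow_mul 0 n α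
  rw [zero_add] at h
  rw [← h, ← lintegral_sub_right_eq_self (fun β => dividedPow 0 β * dividedPow n (α - β)) x,
    ← lintegral_indicator measurableSet_Ioc]
  refine lintegral_mono fun t => ?_
  by_cases ht : t ∈ Ioc x c
  · rw [indicator_of_mem ht, dividedPow_of_pos 0 (sub_pos.2 ht.1),
      show α - (t - x) = α + x - t by ring]
    simp
  · rw [indicator_of_notMem ht]
    exact zero_le

/-- The coefficients of the Bessel function in terms of divided powers. -/
def besselCoeff (N : ℝ) (n : ℕ) : ℝ≥0∞ := ENNReal.ofReal (N ^ (2 * n + 2) * catalan n)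

/-- The Catalan recursion. It makes the majorant the formal solution of B' = B * B with B(0) = N².
-/
theorem sum_besselCoeff_mul {N : ℝ} (k : ℕ) :
    ∑ p ∈ Finset.HasAntidiagonal.antidiagonal k, besselCoeff N p.1 * besselCoeff N p.2 = besselCoeff N (k + 1) := by
  have hnn : ∀ n, 0 ≤ N ^ (2 * n + 2) * (catalan n : ℝ) := fun n => by
    rw [show 2 * n + 2 = 2 * (n + 1) by ring, pow_mul]
    positivity
  unfold besselCoeff
  simp_rw [← ENNReal.ofReal_mul (hnn _)]
  rw [← ENNReal.ofReal_sum_of_nonneg fun p _ => mul_nonneg (hnn _) (hnn _), catalan_succ']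
  congr 1
  push_cast
  rw [Finset.mul_sum]
  refine Finset.sum_congr rfl fun p hp => ?_
  have := Finset.HasAntidiagonal.mem_antidiagonal.1 hp
  rw [← this]
  ring

/-- The constant-potential majorant of the kernel. -/
def besselMajorant (N α : ℝ) : ℝ≥0∞ := ∑' n, besselCoeff N n * dividedPow (2 * n) α

theorem besselMajorant_mono (N : ℝ) : Monotone (besselMajorant N) := fun _ _ h =>
  ENNReal.tsum_le_tsum fun _ => mul_le_mul_right (dividedPow_mono _ h) _

theorem lintegral_besselMajorant_mul (N y : ℝ) :
    ∫⁻ β, besselMajorant N β * besselMajorant N (y - β) =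
      ∑' k, besselCoeff N (k + 1) * dividedPow (2 * k + 1) y := by
  have e : ∀ β, besselMajorant N β * besselMajorant N (y - β) =
      ∑' p : ℕ × ℕ, besselCoeff N p.1 * besselCoeff N p.2 *
        (dividedPow (2 * p.1) β * dividedPow (2 * p.2) (y - β)) := fun β => by
    rw [ENNReal.tsum_prod', besselMajorant, besselMajorant, ← ENNReal.tsum_mul_right]
    refine tsum_congr fun n => ?_
    rw [← ENNReal.tsum_mul_left]
    refine tsum_congr fun m => ?_
    ring
  simp_rw [e]
  rw [lintegral_tsum fun p => by fun_prop]
  rw [← Finset.HasAntidiagonal.sigmaAntidiagonalEquivProd.tsum_eq, ENNReal.tsum_sigma']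
  refine tsum_congr fun k => ?_
  rw [← sum_besselCoeff_mul, Finset.sum_mul, tsum_fintype,
    ← Finset.sum_attach (Finset.HasAntidiagonal.antidiagonal k), Finset.univ_eq_attach]
  refine Finset.sum_congr rfl fun p _ => ?_
  have hp := Finset.HasAntidiagonal.mem_antidiagonal.1 p.2
  simp only [Finset.HasAntidiagonal.sigmaAntidiagonalEquivProd_apply]
  rw [lintegral_const_mul _ (by fun_prop), lintegral_dividedPow_mul, ← mul_add, hp]

/-- Termwise: convolution produces the coefficient of index k + 1 with power 2k + 1, the integral in
t raises the power to 2k + 2, and so the terms with n ≥ 1 are reproduced. The term n = 0 is the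
datum N². -/
theorem besselMajorant_supersolution (N x c α : ℝ) :
    (Ioi (0 : ℝ)).indicator (fun _ => ENNReal.ofReal (N ^ 2)) α +
      ∫⁻ t in Ioc x c, ∫⁻ β, besselMajorant N β * besselMajorant N (α + x - t - β) ≤
        besselMajorant N α := by
  simp_rw [lintegral_besselMajorant_mul]
  rw [lintegral_tsum fun k => by fun_prop, besselMajorant,
    tsum_eq_zero_add' (f := fun n => besselCoeff N n * dividedPow (2 * n) α) ENNReal.summable]
  refine add_le_add (le_of_eq ?_) (ENNReal.tsum_le_tsum fun k => ?_)
  · rcases le_or_gt α 0 with h | h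
    · rw [indicator_of_notMem (by simpa using h), dividedPow_of_nonpos _ h, mul_zero]
    · rw [indicator_of_mem (mem_Ioi.2 h), dividedPow_of_pos _ h]
      simp [besselCoeff]
  · rw [lintegral_const_mul _ (by fun_prop)]
    exact mul_le_mul_right (setLIntegral_dividedPow_le _ _ _ _) _

/-- The binomial coefficient (2n+1 choose n) is at most 2^(2n+1), so the Bessel series is dominated
by the odd part of the exponential series. -/
theorem besselI1_term_le {x : ℝ} (hx : 0 ≤ x) (n : ℕ) :
    (x / 2) ^ (2 * n + 1) / ((n.factorial : ℝ) * ((n + 1).factorial : ℝ)) ≤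
      x ^ (2 * n + 1) / ((2 * n + 1).factorial : ℝ) := by
  have h1 : (2 * n + 1).choose n * n.factorial * (n + 1).factorial = (2 * n + 1).factorial := by
    have := Nat.choose_mul_factorial_mul_factorial (n := 2 * n + 1) (k := n) (by omega)
    rwa [show 2 * n + 1 - n = n + 1 by omega] at this
  have h2 : (2 * n + 1).choose n ≤ 2 ^ (2 * n + 1) := Nat.choose_le_two_pow _ _
  have h3 : ((2 * n + 1).factorial : ℝ) ≤ 2 ^ (2 * n + 1) * ((n.factorial : ℝ) * (n + 1).factorial) := by
    rw [← h1, mul_assoc]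
    push_cast
    gcongr
    exact_mod_cast h2
  rw [div_pow, div_div, div_le_div_iff₀ (by positivity) (by positivity)]
  exact mul_le_mul_of_nonneg_left h3 (by positivity)

theorem summable_odd_exp (x : ℝ) :
    Summable fun n : ℕ => x ^ (2 * n + 1) / ((2 * n + 1).factorial : ℝ) :=
  (Real.summable_pow_div_factorial x).comp_injective (i := fun n : ℕ => 2 * n + 1)
    fun a b h => by simpa using h

theorem summable_besselI1 {x : ℝ} (hx : 0 ≤ x) : Summable fun n : ℕ =>
    (x / 2) ^ (2 * n + 1) / ((n.factorial : ℝ) * ((n + 1).factorial : ℝ)) :=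
  (summable_odd_exp x).of_nonneg_of_le (fun n => by positivity) (besselI1_term_le hx)

theorem besselI1_le_exp {x : ℝ} (hx : 0 ≤ x) : besselI1 x ≤ Real.exp x := by
  refine ((summable_besselI1 hx).tsum_le_tsum (besselI1_term_le hx) (summable_odd_exp x)).trans ?_
  rw [Real.exp_eq_exp_ℝ, NormedSpace.exp_eq_tsum_div]
  exact tsum_comp_le_tsum_of_inj (Real.summable_pow_div_factorial x) (fun n => by positivity)
    (i := fun n : ℕ => 2 * n + 1) fun a b h => by simpa using h

/-- The Catalan number is (2n)!/(n!(n+1)!), which converts divided powers into the Bessel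
coefficients. -/
theorem besselMajorant_eq {N α : ℝ} (hN : 0 ≤ N) (hα : 0 < α) :
    besselMajorant N α = ENNReal.ofReal (N / α * besselI1 (2 * α * N)) := by
  have hx : 0 ≤ 2 * α * N := by positivity
  unfold besselMajorant besselI1
  rw [← tsum_mul_left, ENNReal.ofReal_tsum_of_nonneg (fun n => by positivity)
    ((summable_besselI1 hx).mul_left _)]
  refine tsum_congr fun n => ?_
  rw [besselCoeff, dividedPow_of_pos _ hα, ← ENNReal.ofReal_mul (by positivity)]
  congr 1
  have h1 : ((n + 1 : ℕ) : ℝ) * catalan n = n.centralBinom := by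
    exact_mod_cast succ_mul_catalan_eq_centralBinom n
  have h2 : (n.centralBinom : ℝ) * n.factorial * n.factorial = (2 * n).factorial := by
    have := Nat.choose_mul_factorial_mul_factorial (n := 2 * n) (k := n) (by omega)
    rw [show 2 * n - n = n by omega] at this
    exact_mod_cast this
  have h3 : (catalan n : ℝ) * (n.factorial * (n + 1).factorial) = (2 * n).factorial := by
    rw [← h2, ← h1, Nat.factorial_succ]
    push_cast
    ring
  rw [← h3]
  have hc : (catalan n : ℝ) ≠ 0 := fun h => by
    rw [h, zero_mul] at h3
    exact (by positivity : ((2 * n).factorial : ℝ) ≠ 0) h3.symm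
  have hf : (n.factorial : ℝ) ≠ 0 := by positivity
  have hf' : ((n + 1).factorial : ℝ) ≠ 0 := by positivity
  rw [show 2 * α * N / 2 = α * N by ring]
  field_simp
  ring

end Bessel

/-- The `A`-amplitude of a bounded potential differs from the potential by at most the difference
for the constant potential. -/
theorem IsAmplitude.abs_sub_le_besselI1 {q A : ℝ → ℝ} {B : RightEnd} {α N : ℝ}
    (hB : B.Admissible q) (hA : IsAmplitude q B A) (hα : 0 < α) (hαb : (α : EReal) < B.b)
    (hN : 0 ≤ N) (hq : ∀ᵐ x ∂volume.restrict (Ioo 0 α), |q x| ≤ N ^ 2) :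
    |A α - q α| ≤ N / α * besselI1 (2 * α * N) - N ^ 2 := by
  have hqi : IntegrableOn q (Ioo 0 α) := hB.integrableOn ⟨hα.le, hαb⟩
  have hm := hqi.neg.aemeasurable
  set g₁ : ℝ → ℝ := fun t => max (-N ^ 2) (min (hm.mk _ t) (N ^ 2))
  have h₁ : Measurable g₁ := measurable_const.max (hm.measurable_mk.min measurable_const)
  have hle : ∀ t, |g₁ t| ≤ N ^ 2 := fun t =>
    abs_le.2 ⟨le_max_left _ _, max_le (by linarith [sq_nonneg N]) (min_le_right _ _)⟩
  have e₁ : ∀ᵐ t ∂volume.restrict (Ioo 0 α), g₁ t = -q t := by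
    filter_upwards [hq, hm.ae_eq_mk] with t ht e
    have h := abs_le.1 ht
    simp only [g₁]
    rw [← e, Pi.neg_apply, min_eq_left (by linarith), max_eq_right (by linarith)]
  -- Here g₂ is the constant N², that is, the comparison potential is -N².
  set f := splitData α g₁ fun _ => N ^ 2
  have hf : ∀ σ, Measurable (f σ) := measurable_splitData h₁ measurable_const
  have hsum : ∀ t, ∑ σ, f σ t ≤ ENNReal.ofReal (N ^ 2) := fun t => by
    rw [sum_splitData hle]
    exact indicator_le_self _ _ t
  have hi : IntegrableOn (fun _ : ℝ => N ^ 2) (Ioo 0 α) := integrableOn_const (by simp)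
  set V := N / α * besselI1 (2 * α * N)
  refine le_of_ae_le_Ioo (α := α) (F := fun x => |A x - q x|) (G := fun _ => V - N ^ 2) hα (hA.continuousOn_Icc hα.le hαb).abs
    continuousOn_const ?_
  filter_upwards [hA.ae_abs_sub_le hB hα hαb h₁ measurable_const hle hi e₁,
    ae_restrict_mem measurableSet_Ioo] with β hβ hβm
  obtain ⟨hfin, hβle⟩ := hβ
  -- The majorant increases in α, so its value at the right endpoint serves for all β < α, and a
  -- constant right-hand side suffices for the passage to the endpoint.
  have h1 : ∑ σ, kernel f α σ 0 β ≤ ENNReal.ofReal V := by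
    refine (sum_kernel_le hf (B := besselMajorant N) (x₀ := 0) (fun x y _ => ?_) le_rfl β).trans
      ((besselMajorant_mono N hβm.2.le).trans_eq (besselMajorant_eq hN hα))
    refine le_trans (add_le_add_left (indicator_le_indicator (hsum _)) _)
      (besselMajorant_supersolution N x α y)
  have h2 : ∑ σ, kernel f α σ 0 β =
      ENNReal.ofReal (N ^ 2 + ((kernelExcess f α false β).toReal +
        (kernelExcess f α true β).toReal)) := by
    have h3 := sum_splitData hle β (c := α)
    rw [indicator_of_mem hβm] at h3
    simp_rw [kernel_eq_add_kernelExcess hf _ hβm.1]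
    rw [Finset.sum_add_distrib, h3, Fintype.sum_bool, ENNReal.ofReal_add (sq_nonneg N)
      (by positivity), ENNReal.ofReal_add (by positivity) (by positivity),
      ENNReal.ofReal_toReal (hfin _).ne, ENNReal.ofReal_toReal (hfin _).ne,
      add_comm (kernelExcess f α true β)]
  have hV : 0 ≤ V := mul_nonneg (div_nonneg hN hα.le) (tsum_nonneg fun n => by positivity)
  rw [h2, ENNReal.ofReal_le_ofReal_iff hV] at h1
  linarith

theorem IsAmplitude.abs_le_besselI1 {q A : ℝ → ℝ} {B : RightEnd} {α N : ℝ}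
    (hB : B.Admissible q) (hA : IsAmplitude q B A) (hα : 0 < α) (hαb : (α : EReal) < B.b)
    (hN : 0 ≤ N) (hq : ∀ᵐ x ∂volume.restrict (Ioo 0 α), |q x| ≤ N ^ 2) (hqα : |q α| ≤ N ^ 2) :
    |A α| ≤ N / α * besselI1 (2 * α * N) := by
  have h1 := hA.abs_sub_le_besselI1 hB hα hαb hN hq
  have h2 := abs_add_le (A α - q α) (q α)
  rw [sub_add_cancel] at h2
  linarith

theorem besselI1_bound_le {α N : ℝ} (hα : 0 < α) (hN : 0 ≤ N) :
    N / α * besselI1 (2 * α * N) ≤ α⁻¹ * N * Real.exp (2 * α * N) := by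
  rw [show N / α = α⁻¹ * N by ring]
  exact mul_le_mul_of_nonneg_left (besselI1_le_exp (by positivity)) (by positivity)

end

/-! ### From A - q to pointwise bounds for A -/

section

theorem RightEnd.measurableSet_dom (B : RightEnd) : MeasurableSet B.dom :=
  (ordConnected_iff.2 fun _ hx _ hy _ _ hz =>
    ⟨hx.1.trans hz.1, (EReal.coe_le_coe_iff.2 hz.2).trans_lt hy.2⟩ : B.dom.OrdConnected).measurableSet

theorem Ioo_subset_dom {B : RightEnd} {α : ℝ} (hα : 0 < α) (hαb : (α : EReal) < B.b) :
    Ioo 0 α ⊆ B.dom :=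
  Ioo_subset_Icc_self.trans (Icc_subset_dom ⟨hα.le, hαb⟩)

theorem abs_le_neg_of_abs_le {q₁ q₂ A₁ A₂ : ℝ → ℝ} {B₁ B₂ : RightEnd} {α : ℝ}
    (hB₁ : B₁.Admissible q₁) (hB₂ : B₂.Admissible q₂) (hA₁ : IsAmplitude q₁ B₁ A₁)
    (hA₂ : IsAmplitude q₂ B₂ A₂) (hα : 0 < α) (hb₁ : (α : EReal) < B₁.b) (hb₂ : (α : EReal) < B₂.b)
    (h : ∀ᵐ x ∂volume.restrict (Ioo 0 α), |q₁ x| ≤ -q₂ x) (hqα : |q₁ α| ≤ -q₂ α) :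
    |A₁ α| ≤ -A₂ α := by
  have h1 := abs_sub_le_of_abs_le hB₁ hB₂ hA₁ hA₂ hα hb₁ hb₂ h
  have h2 := abs_add_le (A₁ α - q₁ α) (q₁ α)
  rw [sub_add_cancel] at h2
  linarith

theorem abs_le_gammaSup_sq {q : ℝ → ℝ} {α : ℝ} (h : BddAbove ((fun x => |q x|) '' Icc 0 α)) {x : ℝ}
    (hx : x ∈ Icc 0 α) : |q x| ≤ gammaSup q α ^ 2 := by
  obtain ⟨C, hC⟩ := h
  have hb : BddAbove ((fun x => √|q x|) '' Icc 0 α) := ⟨√C, by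
    rintro _ ⟨y, hy, rfl⟩
    exact Real.sqrt_le_sqrt (hC ⟨y, hy, rfl⟩)⟩
  have h1 : √|q x| ≤ gammaSup q α := le_csSup hb ⟨x, hx, rfl⟩
  rw [← Real.sq_sqrt (abs_nonneg (q x))]
  exact pow_le_pow_left₀ (Real.sqrt_nonneg _) h1 2

theorem gammaSup_nonneg (q : ℝ → ℝ) (α : ℝ) : 0 ≤ gammaSup q α :=
  Real.sSup_nonneg (by
    rintro _ ⟨y, _, rfl⟩
    exact Real.sqrt_nonneg _)

end

end Schrodinger

end

/-- The first two parts are the comparison theorem, for values at every point and almost everywhere.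
The third part is the bound in terms of `γ(α)`, and the last two are the bound for bounded `q`, with
the supremum of `|q|` at every point and with the norm of `L^∞((0, b))` almost everywhere. -/
theorem theorem10p2 :
    (∀ (q₁ q₂ A₁ A₂ : ℝ → ℝ) (B₁ B₂ : Schrodinger.RightEnd) (a : ℝ),
      B₁.Admissible q₁ → B₂.Admissible q₂ →
      Schrodinger.IsAmplitude q₁ B₁ A₁ → Schrodinger.IsAmplitude q₂ B₂ A₂ →
      0 ≤ a → (a : EReal) ≤ min B₁.b B₂.b →
      ((∀ x ∈ Icc 0 a ∩ B₁.dom ∩ B₂.dom, |q₁ x| ≤ -q₂ x) →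
        ∀ α ∈ Icc 0 a ∩ B₁.dom ∩ B₂.dom, |A₁ α| ≤ -A₂ α) ∧
      ((∀ᵐ x ∂volume.restrict (Ioo 0 a), |q₁ x| ≤ -q₂ x) →
        ∀ᵐ α ∂volume.restrict (Ioo 0 a), |A₁ α| ≤ -A₂ α)) ∧
    (∀ (q A : ℝ → ℝ) (B : Schrodinger.RightEnd),
      B.Admissible q → Schrodinger.IsAmplitude q B A →
      (∀ α : ℝ, 0 < α → (α : EReal) < B.b →
        BddAbove ((fun x => |q x|) '' Icc 0 α) →
        |A α| ≤ Schrodinger.gammaSup q α / α *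
            Schrodinger.besselI1 (2 * α * Schrodinger.gammaSup q α) ∧
        Schrodinger.gammaSup q α / α *
            Schrodinger.besselI1 (2 * α * Schrodinger.gammaSup q α) ≤
          α⁻¹ * Schrodinger.gammaSup q α * Real.exp (2 * α * Schrodinger.gammaSup q α)) ∧
      (BddAbove ((fun x => |q x|) '' B.dom) →
        ∀ α : ℝ, 0 < α → (α : EReal) < B.b →
          |A α| ≤ α⁻¹ * Real.sqrt (sSup ((fun x => |q x|) '' B.dom)) *
            Real.exp (2 * α * Real.sqrt (sSup ((fun x => |q x|) '' B.dom)))) ∧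
      (MemLp q ⊤ (volume.restrict B.dom) →
        ∀ᵐ α ∂volume.restrict B.dom,
          |A α| ≤ α⁻¹ * Real.sqrt (eLpNorm q ⊤ (volume.restrict B.dom)).toReal *
            Real.exp (2 * α *
              Real.sqrt (eLpNorm q ⊤ (volume.restrict B.dom)).toReal))) := by
  refine ⟨fun q₁ q₂ A₁ A₂ B₁ B₂ a hB₁ hB₂ hA₁ hA₂ _ hab => ⟨fun h α hα => ?_, fun h => ?_⟩,
    fun q A B hB hA => ⟨fun α hα hαb hbd => ?_, fun hbd α hα hαb => ?_, fun hq => ?_⟩⟩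
  · obtain ⟨⟨⟨hα0, hαa⟩, hα₁⟩, hα₂⟩ := hα
    have hqα := h α ⟨⟨⟨hα0, hαa⟩, hα₁⟩, hα₂⟩
    rcases hα0.eq_or_lt with rfl | hpos
    -- For a = 0 the hypothesis concerns the point 0 alone, so no continuity argument is available;
    -- the amplitudes equal the potentials there.
    · rwa [hA₁.apply_zero hB₁ hα₁.2, hA₂.apply_zero hB₂ hα₂.2]
    · refine Schrodinger.abs_le_neg_of_abs_le hB₁ hB₂ hA₁ hA₂ hpos hα₁.2 hα₂.2 ?_ hqα
      filter_upwards [ae_restrict_mem measurableSet_Ioo] with x hx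
      exact h x ⟨⟨⟨hx.1.le, hx.2.le.trans hαa⟩, Schrodinger.Ioo_subset_dom hpos hα₁.2 hx⟩,
        Schrodinger.Ioo_subset_dom hpos hα₂.2 hx⟩
  · filter_upwards [h, ae_restrict_mem measurableSet_Ioo] with α hqα hα
    have hlt : (α : EReal) < min B₁.b B₂.b := (EReal.coe_lt_coe_iff.2 hα.2).trans_le hab
    exact Schrodinger.abs_le_neg_of_abs_le hB₁ hB₂ hA₁ hA₂ hα.1 (hlt.trans_le (min_le_left _ _))
      (hlt.trans_le (min_le_right _ _))
      (ae_restrict_of_ae_restrict_of_subset (Ioo_subset_Ioo_right hα.2.le) h) hqα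
  · refine ⟨hA.abs_le_besselI1 hB hα hαb (Schrodinger.gammaSup_nonneg q α) ?_
      (Schrodinger.abs_le_gammaSup_sq hbd (right_mem_Icc.2 hα.le)),
      Schrodinger.besselI1_bound_le hα (Schrodinger.gammaSup_nonneg q α)⟩
    filter_upwards [ae_restrict_mem measurableSet_Ioo] with x hx
    exact Schrodinger.abs_le_gammaSup_sq hbd (Ioo_subset_Icc_self hx)
  · have hle : ∀ x ∈ B.dom, |q x| ≤ √(sSup ((fun x => |q x|) '' B.dom)) ^ 2 := fun x hx => by
      have h1 : |q x| ≤ sSup ((fun x => |q x|) '' B.dom) := le_csSup hbd ⟨x, hx, rfl⟩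
      rwa [Real.sq_sqrt ((abs_nonneg _).trans h1)]
    refine (hA.abs_le_besselI1 hB hα hαb (Real.sqrt_nonneg _) ?_ (hle α ⟨hα.le, hαb⟩)).trans
      (Schrodinger.besselI1_bound_le hα (Real.sqrt_nonneg _))
    filter_upwards [ae_restrict_mem measurableSet_Ioo] with x hx
    exact hle x (Schrodinger.Ioo_subset_dom hα hαb hx)
  · have hle : ∀ᵐ x ∂volume.restrict B.dom,
        |q x| ≤ √(eLpNorm q ⊤ (volume.restrict B.dom)).toReal ^ 2 := by
      filter_upwards [ae_le_eLpNormEssSup (f := q) (μ := volume.restrict B.dom)] with x hx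
      rw [Real.sq_sqrt ENNReal.toReal_nonneg, ← Real.norm_eq_abs, ← toReal_enorm]
      rw [← eLpNorm_exponent_top] at hx
      exact ENNReal.toReal_mono hq.2.ne hx
    filter_upwards [hle, ae_restrict_mem B.measurableSet_dom,
      ae_restrict_of_ae (Measure.ae_ne volume (0 : ℝ))] with α hqα hα h0
    have hpos : 0 < α := lt_of_le_of_ne hα.1 (Ne.symm h0)
    exact (hA.abs_le_besselI1 hB hpos hα.2 (Real.sqrt_nonneg _)
      (ae_restrict_of_ae_restrict_of_subset (Schrodinger.Ioo_subset_dom hpos hα.2) hle) hqα).trans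
      (Schrodinger.besselI1_bound_le hpos (Real.sqrt_nonneg _))
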